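/- Let $k,m\ge 0$ be integers and $\omega\in S_{k+1}$. **Stable double Grothendieck polynomial.** Put $N=m+k$, and let $x=(x_1,\dots,x_{N+1})$, $y=(y_1,\dots,y_{N+1})$. For $1\le i\le N$ let $s_i$ act on $\mathbb Z[x,y]$ by exchanging $x_i$ and $x_{i+1}$, and put $\delta_i f=\frac{f-s_if}{x_i-x_{i+1}}$ and $\pi_i f=\delta_i f+\delta_i(x_{i+1}f)$. For $w\in S_{N+1}$ let $\pi_w=\pi_{i_1}\cdots\pi_{i_\ell}$, where $w=s_{i_1}\cdots s_{i_\ell}$ and $\ell$ is the number of inversions of $w$. With $w_0$ the longest element of $S_{N+1}$, the double Grothendieck polynomial of $w$ is $$\mathfrak G_w(x,y)=\pi_{w^{-1}w_0}\Big(\prod_{i,j\ge1,\ i+j\le N+1}(x_i+y_j+x_iy_j)\Big).$$ Let $\hat\omega\in S_{m+k+1}$ be the permutation that fixes $1,\dots,m$ and applies $\omega$ to the last $k+1$ letters, and let $\check x=(x_1,\dots,x_{m+1})$, $\check y=(y_1,\dots,y_{m+1})$. The stable double Grothendieck polynomial $\mathcal G_\omega(\check x,\check y)$ is obtained from $\mathfrak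 G_{\hat\omega}(x,y)$ by setting $x_i=y_i=0$ for all $i>m+1$. **Hecke tableaux.** For $1\le i\le k$ let $\bar s_i$ act on arrangements of $1,\dots,k+1$ by exchanging the values $i$ and $i+1$ if $i$ lies to the left of $i+1$, and by doing nothing otherwise. $HT_\omega$ is the set of fillings $T$ of Young diagrams (of any shape $T_s$, drawn with rows getting shorter downwards), with one letter of $\{1,\dots,k\}$ in each box, strictly increasing along rows (left to right) and down columns, such that, if $i_1\cdots i_r$ is the word obtained by reading the rows from left to right, bottom row first, then applying $\bar s_{i_1}\cdots\bar s_{i_r}$ (from right to left) to $(1,2,\dots,k+1)$ gives the one-line notation of $\omega$. (Since entries increase strictly, $HT_\omega$ is finite.) **Symmetric Grothendieck polynomials.** A set-valued tableau of skew shape $\lambda/\rho$ with letters $1,\dots,m+1$ is a filling of the boxes of $\lambda/\rho$ by nonempty subsets of $\{1,\dots,m+1\}$ such that $\max(b)<\min(b')$ whenever box $b$ lies to the left of box $b'$ in the same row, and $\max(b)\le\min(b')$ whenever $b$ lies above $b'$ in the same column. Let $G_{\lambda/\rho}(z_1,\dots,z_{m+1})=\sum_T\prod_i z_i^{\#\{\text{boxes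 of } T \text{ containing } i\}}$, summed over all such tableaux $T$, and $G_\lambda=G_{\lambda/\emptyset}$. Write $\mu'$ for the transpose of a partition $\mu$. **Claim.** We have $$\mathcal G_\omega(\check x,\check y)=\sum_{T\in HT_\omega}\ \sum_{\rho\subseteq\mu\subseteq T_s} G_{T_s/\rho}(\check x)\,G_{\mu'}(\check y),$$ where the inner sum is over all pairs of partitions $\rho\subseteq\mu\subseteq T_s$ such that $\mu/\rho$ has at most one box in each row and at most one box in each column. -/

import Mathlib

/-! Permutations in `S_{N+1}` act on `Fin (N + 1)`, and `w` has the one-line notation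
`(w 0, …, w N)`.  Generators are indexed from `0`: the `i`-th one exchanges `i` and `i + 1`. -/

namespace Groth

/-! ### Permutations and words -/

/-- The simple transposition `s_i` of `S_{N+1}`. -/
def simpleSwap {N : ℕ} (i : Fin N) : Equiv.Perm (Fin (N + 1)) :=
  Equiv.swap i.castSucc i.succ

/-- The set of inversions of a permutation. -/
def inversions {N : ℕ} (w : Equiv.Perm (Fin (N + 1))) : Finset (Fin (N + 1) × Fin (N + 1)) :=
  Finset.univ.filter fun p => p.1 < p.2 ∧ w p.2 < w p.1

/-- A word `i₁, …, i_ℓ` is reduced for `w` if `w = s_{i₁} ⋯ s_{i_ℓ}` and `ℓ` is the inversion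
number of `w`. -/
def IsReducedWord {N : ℕ} (w : Equiv.Perm (Fin (N + 1))) (l : List (Fin N)) : Prop :=
  (l.map simpleSwap).prod = w ∧ l.length = (inversions w).card

theorem simpleSwap_mul_self {N : ℕ} (i : Fin N) : simpleSwap i * simpleSwap i = 1 := by
  simp [simpleSwap]

theorem simpleSwap_simpleSwap {N : ℕ} (i : Fin N) (a : Fin (N + 1)) :
    simpleSwap i (simpleSwap i a) = a := by
  simp [simpleSwap]

theorem mem_inversions {N : ℕ} {w : Equiv.Perm (Fin (N + 1))} {a b : Fin (N + 1)} :
    (a, b) ∈ inversions w ↔ a < b ∧ w b < w a := by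
  simp [inversions]

theorem simpleSwap_lt {N : ℕ} (i : Fin N) {a b : Fin (N + 1)} (hab : a < b)
    (hne : ¬ (a = i.castSucc ∧ b = i.succ)) : simpleSwap i a < simpleSwap i b := by
  unfold simpleSwap
  rw [Equiv.swap_apply_def, Equiv.swap_apply_def]
  simp only [Fin.ext_iff, Fin.lt_def, Fin.val_castSucc, Fin.val_succ] at *
  split_ifs <;> first | omega | (simp only [Fin.val_castSucc, Fin.val_succ]; omega)

theorem card_inversions_mul {N : ℕ} (w : Equiv.Perm (Fin (N + 1))) (i : Fin N)
    (h : w i.succ < w i.castSucc) :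
    (inversions (w * simpleSwap i)).card + 1 = (inversions w).card := by
  have hmem : (i.castSucc, i.succ) ∈ inversions w := by
    simp [inversions, h]
  rw [← Finset.card_erase_add_one hmem]
  congr 1
  have hs1 : simpleSwap i i.castSucc = i.succ := by simp [simpleSwap]
  have hs2 : simpleSwap i i.succ = i.castSucc := by simp [simpleSwap]
  refine Finset.card_bij' (fun p _ => (simpleSwap i p.1, simpleSwap i p.2))
    (fun p _ => (simpleSwap i p.1, simpleSwap i p.2)) ?_ ?_ ?_ ?_
  · rintro ⟨a, b⟩ hp
    simp only [mem_inversions, Equiv.Perm.mul_apply, Finset.mem_erase, ne_eq,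
      Prod.mk.injEq] at hp ⊢
    have hne : ¬ (a = i.castSucc ∧ b = i.succ) := by
      rintro ⟨rfl, rfl⟩
      rw [hs1, hs2] at hp
      exact lt_asymm h hp.2
    refine ⟨?_, simpleSwap_lt i hp.1 hne, hp.2⟩
    rintro ⟨h1, h2⟩
    have ha : a = i.succ := by rw [← simpleSwap_simpleSwap i a, h1, hs1]
    have hb : b = i.castSucc := by rw [← simpleSwap_simpleSwap i b, h2, hs2]
    subst ha hb
    exact absurd hp.1 (by simp [Fin.lt_def])
  · rintro ⟨a, b⟩ hp
    simp only [mem_inversions, Equiv.Perm.mul_apply, Finset.mem_erase, ne_eq,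
      Prod.mk.injEq, simpleSwap_simpleSwap] at hp ⊢
    exact ⟨simpleSwap_lt i hp.2.1 hp.1, hp.2.2⟩
  · rintro ⟨a, b⟩ _
    simp [simpleSwap_simpleSwap]
  · rintro ⟨a, b⟩ _
    simp [simpleSwap_simpleSwap]

/-- Every permutation has a reduced word. -/
theorem exists_reducedWord {N : ℕ} (w : Equiv.Perm (Fin (N + 1))) :
    ∃ l, IsReducedWord w l := by
  induction hn : (inversions w).card generalizing w with
  | zero =>
    refine ⟨[], ?_, by simp [hn]⟩
    have hmono : StrictMono w := by
      intro a b hab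
      by_contra hlt
      have hlt' : w b < w a :=
        lt_of_le_of_ne (not_lt.1 hlt) (fun h => hab.ne (w.injective h).symm)
      have : (a, b) ∈ inversions w := mem_inversions.2 ⟨hab, hlt'⟩
      rw [Finset.card_eq_zero.1 hn] at this
      simp at this
    have hw : hmono.orderIsoOfSurjective w w.surjective = OrderIso.refl _ :=
      Subsingleton.elim _ _
    refine Equiv.ext fun a => ?_
    simpa using congrArg (fun e : Fin (N + 1) ≃o Fin (N + 1) => e a) hw.symm
  | succ n ih =>
    have : ∃ i : Fin N, w i.succ < w i.castSucc := by
      by_contra hcon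
      push Not at hcon
      have hmono : StrictMono w := Fin.strictMono_iff_lt_succ.2 fun i =>
        lt_of_le_of_ne (hcon i) fun h => by
          have := w.injective h
          simp [Fin.ext_iff] at this
      have : inversions w = ∅ := by
        refine Finset.filter_eq_empty_iff.2 ?_
        rintro ⟨a, b⟩ _ ⟨h1, h2⟩
        exact lt_asymm h2 (hmono h1)
      simp [this] at hn
    obtain ⟨i, hi⟩ := this
    have hc := card_inversions_mul w i hi
    obtain ⟨l, hl1, hl2⟩ := ih (w * simpleSwap i) (by omega)
    refine ⟨l ++ [i], ?_, ?_⟩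
    · simp [hl1, mul_assoc, simpleSwap_mul_self]
    · simp [hl2]; omega

/-- A chosen reduced word of a permutation. -/
noncomputable def reducedWord {N : ℕ} (w : Equiv.Perm (Fin (N + 1))) : List (Fin N) :=
  (exists_reducedWord w).choose

theorem reducedWord_spec {N : ℕ} (w : Equiv.Perm (Fin (N + 1))) :
    IsReducedWord w (reducedWord w) :=
  (exists_reducedWord w).choose_spec

/-- The operator `s̄_i` on arrangements: interchange the values `i` and `i + 1` if `i` lies to the
left of `i + 1`, and do nothing otherwise. -/
def heckeOp {N : ℕ} (i : Fin N) (w : Equiv.Perm (Fin (N + 1))) : Equiv.Perm (Fin (N + 1)) :=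
  if w⁻¹ i.castSucc < w⁻¹ i.succ then simpleSwap i * w else w

/-- `l` is a Hecke word for `w`: applying the operators of `l`, from right to left, to the
identity arrangement gives `w`. -/
def IsHeckeWord {N : ℕ} (w : Equiv.Perm (Fin (N + 1))) (l : List (Fin N)) : Prop :=
  l.foldr heckeOp 1 = w

/-- The permutation `ω̂ ∈ S_{m+k+1}` that fixes the first `m` letters and applies `ω ∈ S_{k+1}` to
the last `k + 1` letters. -/
def shiftPerm (m : ℕ) {k : ℕ} (ω : Equiv.Perm (Fin (k + 1))) : Equiv.Perm (Fin (m + k + 1)) :=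
  (finSumFinEquiv : Fin m ⊕ Fin (k + 1) ≃ Fin (m + (k + 1))).permCongr (Equiv.sumCongr (Equiv.refl (Fin m)) ω)

/-! ### Double Grothendieck polynomials -/

/-- The ring `ℤ[x, y]` with `x = (x_0, …, x_{n-1})` and `y = (y_0, …, y_{n-1})`. -/
abbrev PolyXY (n : ℕ) : Type := MvPolynomial (Fin n ⊕ Fin n) ℤ

/-- The variable `x_i`. -/
noncomputable def xv {n : ℕ} (i : Fin n) : PolyXY n := MvPolynomial.X (Sum.inl i)

/-- The variable `y_i`. -/
noncomputable def yv {n : ℕ} (i : Fin n) : PolyXY n := MvPolynomial.X (Sum.inr i)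

/-- The action of `s_i` on `ℤ[x, y]`, interchanging `x_i` and `x_{i+1}`. -/
noncomputable def swapX {N : ℕ} (i : Fin N) (f : PolyXY (N + 1)) : PolyXY (N + 1) :=
  MvPolynomial.rename (Equiv.swap (Sum.inl i.castSucc) (Sum.inl i.succ)) f

theorem dvd_sub_swapX {N : ℕ} (i : Fin N) (f : PolyXY (N + 1)) :
    xv i.castSucc - xv i.succ ∣ f - swapX i f := by
  induction f using MvPolynomial.induction_on with
  | C a => simp [swapX]
  | add p q hp hq =>
    have : p + q - swapX i (p + q) = (p - swapX i p) + (q - swapX i q) := by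
      simp only [swapX, map_add]; ring
    rw [this]
    exact dvd_add hp hq
  | mul_X p v hp =>
    have hX : xv i.castSucc - xv i.succ ∣
        (MvPolynomial.X v : PolyXY (N + 1)) - swapX i (MvPolynomial.X v) := by
      simp only [swapX, MvPolynomial.rename_X, xv]
      rw [Equiv.swap_apply_def]
      split_ifs with h1 h2
      · rw [h1]
      · rw [h2]; exact ⟨-1, by ring⟩
      · simp
    have : p * MvPolynomial.X v - swapX i (p * MvPolynomial.X v) =
        (p - swapX i p) * MvPolynomial.X v +
          swapX i p * (MvPolynomial.X v - swapX i (MvPolynomial.X v)) := by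
      simp only [swapX, map_mul]; ring
    rw [this]
    exact dvd_add (hp.mul_right _) (hX.mul_left _)

/-- The divided difference operator `δ_i f = (f - s_i f) / (x_i - x_{i+1})`. -/
noncomputable def divDiff {N : ℕ} (i : Fin N) (f : PolyXY (N + 1)) : PolyXY (N + 1) :=
  (dvd_sub_swapX i f).choose

theorem divDiff_spec {N : ℕ} (i : Fin N) (f : PolyXY (N + 1)) :
    f - swapX i f = (xv i.castSucc - xv i.succ) * divDiff i f :=
  (dvd_sub_swapX i f).choose_spec

/-- The operator `π_i f = δ_i f + δ_i (x_{i+1} f)`. -/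
noncomputable def piOp {N : ℕ} (i : Fin N) (f : PolyXY (N + 1)) : PolyXY (N + 1) :=
  divDiff i f + divDiff i (xv i.succ * f)

/-- The operator `π_w = π_{i₁} ∘ ⋯ ∘ π_{i_ℓ}` for a reduced word `s_{i₁} ⋯ s_{i_ℓ}` of `w`. -/
noncomputable def piPerm {N : ℕ} (w : Equiv.Perm (Fin (N + 1))) (f : PolyXY (N + 1)) :
    PolyXY (N + 1) :=
  (reducedWord w).foldr piOp f

/-- The double Grothendieck polynomial `𝔊_w(x, y)` of `w ∈ S_{N+1}`.  With indices starting from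
`0`, the condition `i + j ≤ N + 1` of the product becomes `i + j < N`. -/
noncomputable def doubleGrothendieck {N : ℕ} (w : Equiv.Perm (Fin (N + 1))) : PolyXY (N + 1) :=
  piPerm (w⁻¹ * Fin.revPerm)
    (∏ p ∈ (Finset.univ : Finset (Fin (N + 1) × Fin (N + 1))).filter
        (fun p => p.1.val + p.2.val < N),
      (xv p.1 + yv p.2 + xv p.1 * yv p.2))

/-- The substitution keeping the first `n` variables of each of the two alphabets and setting the
remaining ones to zero. -/
noncomputable def truncate {N : ℕ} (n : ℕ) : PolyXY N →ₐ[ℤ] PolyXY n :=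
  MvPolynomial.aeval (Sum.elim
    (fun i : Fin N => if h : i.val < n then xv ⟨i.val, h⟩ else 0)
    (fun i : Fin N => if h : i.val < n then yv ⟨i.val, h⟩ else 0))

/-- The stable double Grothendieck polynomial `𝒢_ω(x̌, y̌)` in `m + 1` variables `x` and `m + 1`
variables `y`. -/
noncomputable def stableDoubleGrothendieck (m : ℕ) {k : ℕ} (ω : Equiv.Perm (Fin (k + 1))) :
    PolyXY (m + 1) :=
  truncate (m + 1) (doubleGrothendieck (shiftPerm m ω))

/-! ### Tableaux -/

/-- The list of entries of a filling of a Young diagram, rows read from left to right, and the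
bottom row first. -/
def readingWord {α : Type*} (lam : YoungDiagram) (T : {c // c ∈ lam.cells} → α) : List α :=
  (List.range (lam.colLen 0)).reverse.flatMap fun i =>
    (List.finRange (lam.rowLen i)).map fun j =>
      T ⟨(i, j.val), (YoungDiagram.mem_cells _).2 (YoungDiagram.mem_iff_lt_rowLen.2 j.isLt)⟩

/-- A Hecke tableau for `ω ∈ S_{k+1}`: rows and columns are strictly increasing, and the reading
word is a Hecke word for `ω`.  The letter `i : Fin k` stands for `s̄_{i+1}`. -/
@[ext]
structure HeckeTableau {k : ℕ} (ω : Equiv.Perm (Fin (k + 1))) where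
  shape : YoungDiagram
  entry : {c // c ∈ shape.cells} → Fin k
  row_strict : ∀ c d : {c // c ∈ shape.cells},
    c.1.1 = d.1.1 → c.1.2 < d.1.2 → entry c < entry d
  col_strict : ∀ c d : {c // c ∈ shape.cells},
    c.1.2 = d.1.2 → c.1.1 < d.1.1 → entry c < entry d
  hecke_word : IsHeckeWord ω (readingWord shape entry)

theorem finite_subdiagrams (lam : YoungDiagram) : {mu : YoungDiagram | mu ≤ lam}.Finite := by
  refine Set.Finite.of_finite_image (f := YoungDiagram.cells)
    (lam.cells.powerset.finite_toSet.subset ?_) ?_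
  · rintro _ ⟨mu, hmu, rfl⟩
    simpa using YoungDiagram.cells_subset_iff.2 hmu
  · intro a _ b _ h
    exact YoungDiagram.ext h

theorem finite_boxed (k : ℕ) :
    {mu : YoungDiagram | ∀ c ∈ mu.cells, c.1 < k ∧ c.2 < k}.Finite := by
  refine Set.Finite.of_finite_image (f := YoungDiagram.cells)
    ((Finset.range k ×ˢ Finset.range k).powerset.finite_toSet.subset ?_) ?_
  · rintro _ ⟨mu, hmu, rfl⟩
    simp only [Finset.coe_powerset, Set.mem_preimage, Set.mem_powerset_iff, Finset.coe_subset]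
    intro c hc
    have := hmu c hc
    simpa using this
  · intro a _ b _ h
    exact YoungDiagram.ext h

theorem HeckeTableau.boxed {k : ℕ} {ω : Equiv.Perm (Fin (k + 1))} (T : HeckeTableau ω) :
    ∀ c ∈ T.shape.cells, c.1 < k ∧ c.2 < k := by
  have hrow : ∀ i j (h : (i, j) ∈ T.shape.cells), j ≤ (T.entry ⟨(i, j), h⟩).val := by
    intro i j
    induction j with
    | zero => intro _; exact Nat.zero_le _
    | succ j ih =>
      intro h
      have h' : (i, j) ∈ T.shape.cells :=
        T.shape.isLowerSet (show ((i, j) : ℕ × ℕ) ≤ (i, j + 1) from ⟨le_rfl, Nat.le_succ j⟩) h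
      have h1 := ih h'
      have h2 := T.row_strict ⟨(i, j), h'⟩ ⟨(i, j + 1), h⟩ rfl (Nat.lt_succ_self j)
      rw [Fin.lt_def] at h2
      omega
  have hcol : ∀ j i (h : (i, j) ∈ T.shape.cells), i ≤ (T.entry ⟨(i, j), h⟩).val := by
    intro j i
    induction i with
    | zero => intro _; exact Nat.zero_le _
    | succ i ih =>
      intro h
      have h' : (i, j) ∈ T.shape.cells :=
        T.shape.isLowerSet (show ((i, j) : ℕ × ℕ) ≤ (i + 1, j) from ⟨Nat.le_succ i, le_rfl⟩) h
      have h1 := ih h'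
      have h2 := T.col_strict ⟨(i, j), h'⟩ ⟨(i + 1, j), h⟩ rfl (Nat.lt_succ_self i)
      rw [Fin.lt_def] at h2
      omega
  rintro ⟨i, j⟩ h
  exact ⟨(hcol j i h).trans_lt (Fin.isLt _), (hrow i j h).trans_lt (Fin.isLt _)⟩

instance {k : ℕ} (ω : Equiv.Perm (Fin (k + 1))) : Finite (HeckeTableau ω) := by
  have := (finite_boxed k).to_subtype
  let f : HeckeTableau ω →
      Σ mu : {mu : YoungDiagram | ∀ c ∈ mu.cells, c.1 < k ∧ c.2 < k},
        ({c // c ∈ mu.1.cells} → Fin k) :=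
    fun T => ⟨⟨T.shape, T.boxed⟩, T.entry⟩
  refine Finite.of_injective f ?_
  rintro ⟨s, e, _, _, _⟩ ⟨s', e', _, _, _⟩ h
  simp only [f, Sigma.mk.injEq, Subtype.mk.injEq] at h
  obtain ⟨rfl, h⟩ := h
  obtain rfl := eq_of_heq h
  rfl

noncomputable instance {k : ℕ} (ω : Equiv.Perm (Fin (k + 1))) : Fintype (HeckeTableau ω) :=
  Fintype.ofFinite _

/-- A filling of the skew shape `lam / rho` by nonempty subsets of `{0, …, n-1}` is a set-valued
tableau if every entry of a box is less than every entry of each box to its right in its row, and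
at most every entry of each box below it in its column. -/
def IsSetValuedTableau {lam rho : YoungDiagram} {n : ℕ}
    (T : {c // c ∈ lam.cells \ rho.cells} → Finset (Fin n)) : Prop :=
  (∀ c, (T c).Nonempty) ∧
  (∀ c d, c.1.1 = d.1.1 → c.1.2 < d.1.2 → ∀ a ∈ T c, ∀ b ∈ T d, a < b) ∧
  (∀ c d, c.1.2 = d.1.2 → c.1.1 < d.1.1 → ∀ a ∈ T c, ∀ b ∈ T d, a ≤ b)

open scoped Classical in
/-- The symmetric Grothendieck polynomial `G_{lam/rho}` evaluated at `z = (z_0, …, z_{n-1})`: the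
sum over set-valued tableaux of shape `lam / rho` of the product of `z_a` over all entries `a`. -/
noncomputable def symGrothendieck {R : Type*} [CommRing R] (lam rho : YoungDiagram) {n : ℕ}
    (z : Fin n → R) : R :=
  ∑ T ∈ (Finset.univ : Finset ({c // c ∈ lam.cells \ rho.cells} → Finset (Fin n))).filter
      (fun T => IsSetValuedTableau T),
    ∏ c, ∏ a ∈ T c, z a

/-- The finite set of Young diagrams contained in `lam`. -/
noncomputable def subdiagrams (lam : YoungDiagram) : Finset YoungDiagram :=
  (finite_subdiagrams lam).toFinset

theorem mem_subdiagrams {lam mu : YoungDiagram} : mu ∈ subdiagrams lam ↔ mu ≤ lam := by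
  simp [subdiagrams]

/-- `rho ⊆ mu`, and no two boxes of `mu / rho` lie in the same row or in the same column. -/
def IsRookStrip (rho mu : YoungDiagram) : Prop :=
  rho ≤ mu ∧ ∀ c ∈ mu.cells \ rho.cells, ∀ d ∈ mu.cells \ rho.cells,
    c ≠ d → c.1 ≠ d.1 ∧ c.2 ≠ d.2

noncomputable instance (rho mu : YoungDiagram) : Decidable (IsRookStrip rho mu) :=
  Classical.dec _

end Groth

/-!
The proof takes place in the `0`-Hecke algebra, with idempotent generators `u_i`, acting on the
free module on permutations by the operators `s̄_i`.  Put `A(x) = (1 + x u_{k-1}) ⋯ (1 + x u_0)`.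
By the Yang–Baxter equation the elements `A(x)` commute with each other
(`IsHeckeFamily.descProd_comm`) and with their mirror images.

*Double Grothendieck polynomials are coefficients.*  A staircase-shaped product of increasing
products in the `y_j`, followed by one of decreasing products in the `x_i`, equals a product of one
factor `1 + (x_i + y_j + x_i y_j) u_{i+j}` for each pair with `i + j < N`
(`IsHeckeFamily.ascChain_mul_descChain`).  There are as many factors as the longest permutation has
inversions, so its coefficient is the product of all `x_i + y_j + x_i y_j`.  Multiplied on the
right by `1 + x_{i+1} u_i`, the staircase becomes symmetric in `x_i` and `x_{i+1}`; hence `π_i`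
lowers coefficients along right multiplication by `s_i` (`piOp_grothendieckVector`), and all
coefficients are double Grothendieck polynomials (`doubleGrothendieck_eq`).

*Stabilisation.*  On the coefficients of the permutations that fix the first `m` letters, the
generators `u_0, …, u_{m-1}` act as zero.  If moreover all variables after the first `m + 1` vanish,
then the staircases become rectangles: `𝒢_ω` is the coefficient of `ω` in `B(y) A(x)`, where `A(x)`
is the product of all `A(x_i)` and `B` its mirror image (`stableDoubleGrothendieck_eq`).

*Cauchy identity.*  `A(x) = ∑ T, G_{sh T}(x) u_T`, summed over all increasing tableaux `T`, where
`u_T` is the product along the reading word (`cauchy_heckeGen`).  Both sides are multiplied by the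
Vandermonde product.  Then `G_{sh T}` turns into an alternant in its column lengths, by the
bialternant formula (`vandermondeProd_mul_symGrothendieck`), and `A(x)` into the antisymmetrisation
of a product of sums over columns, in which tuples of columns that do not form a tableau cancel
(`IsHeckeFamily.cauchy_alternant`).  Reversing words transposes tableaux, so that also
`B(y) = ∑ T, G_{(sh T)'}(y) u_T` (`cauchy_heckeGen_op`).

*Comparison of coefficients.*  The product `B(y) A(x)` is found without any insertion algorithm.
For auxiliary variables `z`, the concatenation of `z` and `x` gives `A(z) A(x) = A(z, x)`; splitting
the alphabet (`symGrothendieck_append`) expands `G_λ(z, x)` as the sum of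
`G_μ(z) G_{λ/ρ}(x)` over the pairs `ρ ⊆ μ ⊆ λ` for which `μ/ρ` has at most one box in each row and
column.  Since the `G_μ(z)` are linearly independent (`symGrothendieck_linearIndependent`), for
each `μ` the sum of all `u_S A(x)` with `sh S = μ` equals the sum of all `G_{sh T/ρ}(x) u_T`
(`sum_pairs_eq`).  Multiplication by `G_{μ'}(y)` and summation over `μ` gives the theorem.
-/

namespace Groth

/-! ### Products of factors `1 + x u_i` in a `0`-Hecke algebra -/

/-- A family `u 0, u 1, …` satisfying the relations of the generators of a `0`-Hecke algebra,
normalised to be idempotent.  Finitely many generators are encoded by letting the remaining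
members of the family be zero, which is compatible with all relations. -/
structure IsHeckeFamily {A : Type*} [Ring A] (u : ℕ → A) : Prop where
  idem : ∀ i, u i * u i = u i
  comm : ∀ i j, i + 2 ≤ j → Commute (u i) (u j)
  braid : ∀ i, u i * u (i + 1) * u i = u (i + 1) * u i * u (i + 1)

section Products

variable {R A : Type*} [CommRing R] [Ring A] [Algebra R A]

/-- The factor `1 + x u_i`. -/
def hFactor (u : ℕ → A) (x : R) (i : ℕ) : A := 1 + x • u i

/-- The decreasing product `(1 + x u_{d+n-1}) ⋯ (1 + x u_d)`. -/
def descProd (u : ℕ → A) (x : R) : ℕ → ℕ → A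
  | 0, _ => 1
  | n + 1, d => descProd u x n (d + 1) * hFactor u x d

/-- The increasing product `(1 + x u_d) ⋯ (1 + x u_{d+n-1})`. -/
def ascProd (u : ℕ → A) (x : R) : ℕ → ℕ → A
  | 0, _ => 1
  | n + 1, d => hFactor u x d * ascProd u x n (d + 1)

/-- The product of the `n` decreasing products in the variables `x 0, …, x (n - 1)`, all starting
from the top letter `d + n - 2` and ending in the letters `d, d + 1, …, d + n - 1` respectively
(so that the last factor is empty). -/
def descChain (u : ℕ → A) : (ℕ → R) → ℕ → ℕ → A
  | _, 0, _ => 1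
  | x, n + 1, d => descProd u (x 0) n d * descChain u (fun i => x (i + 1)) n (d + 1)

/-- The mirror image of `descChain`, with the variable `y 0` on the right. -/
def ascChain (u : ℕ → A) : (ℕ → R) → ℕ → ℕ → A
  | _, 0, _ => 1
  | y, n + 1, d => ascChain u (fun i => y (i + 1)) n (d + 1) * ascProd u (y 0) n d

/-- The product of the factors `1 + (x_i ⊕ y) u_{d+i}` for `i = 0, …, n - 1`, in this order, where
`x ⊕ y = x + y + x y`. -/
def rowProd (u : ℕ → A) : (ℕ → R) → R → ℕ → ℕ → A
  | _, _, 0, _ => 1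
  | x, y, n + 1, d =>
    hFactor u (x 0 + y + x 0 * y) d * rowProd u (fun i => x (i + 1)) y n (d + 1)

/-- The product of the factors `1 + (x_i ⊕ y_j) u_{d+i+j}` over `i + j < n`, with `j` decreasing
and, for each `j`, with `i` increasing. -/
def triProd (u : ℕ → A) : (ℕ → R) → (ℕ → R) → ℕ → ℕ → A
  | _, _, 0, _ => 1
  | x, y, n + 1, d => triProd u x (fun j => y (j + 1)) n (d + 1) * rowProd u x (y 0) (n + 1) d

@[simp] theorem descProd_zero (u : ℕ → A) (n d : ℕ) : descProd u (0 : R) n d = 1 := by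
  induction n generalizing d with
  | zero => rfl
  | succ n ih => simp [descProd, ih, hFactor]

theorem descProd_op (u : ℕ → A) (x : R) (n d : ℕ) :
    descProd (fun i => MulOpposite.op (u i)) x n d = MulOpposite.op (ascProd u x n d) := by
  induction n generalizing d with
  | zero => rfl
  | succ n ih => simp [descProd, ascProd, ih, hFactor]

variable {u : ℕ → A}

theorem IsHeckeFamily.op (hu : IsHeckeFamily u) :
    IsHeckeFamily fun i => MulOpposite.op (u i) where
  idem i := by rw [← MulOpposite.op_mul, hu.idem]
  comm i j h := by
    have := (hu.comm i j h).eq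
    simp only [Commute, SemiconjBy, ← MulOpposite.op_mul, this]
  braid i := by simp only [← MulOpposite.op_mul, ← mul_assoc, hu.braid]

theorem IsHeckeFamily.commute_descProd (hu : IsHeckeFamily u) (x : R) {i d : ℕ} (n : ℕ)
    (h : i + 2 ≤ d) : Commute (u i) (descProd u x n d) := by
  induction n generalizing d with
  | zero => exact Commute.one_right _
  | succ n ih =>
    exact (ih (by omega)).mul_right
      ((Commute.one_right _).add_right ((hu.comm i d h).smul_right x))

theorem IsHeckeFamily.commute_ascProd (hu : IsHeckeFamily u) (x : R) {i d : ℕ} (n : ℕ)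
    (h : i + 2 ≤ d) : Commute (u i) (ascProd u x n d) := by
  induction n generalizing d with
  | zero => exact Commute.one_right _
  | succ n ih =>
    exact ((Commute.one_right _).add_right ((hu.comm i d h).smul_right x)).mul_right
      (ih (by omega))

theorem IsHeckeFamily.commute_descChain (hu : IsHeckeFamily u) (x : ℕ → R) {i d : ℕ} (n : ℕ)
    (h : i + 2 ≤ d) : Commute (u i) (descChain u x n d) := by
  induction n generalizing d x with
  | zero => exact Commute.one_right _
  | succ n ih => exact (hu.commute_descProd _ n h).mul_right (ih _ (by omega))

theorem commute_hFactor_of {a : A} {i : ℕ} (x : R) (h : Commute (u i) a) :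
    Commute (hFactor u x i) a :=
  (Commute.one_left _).add_left (h.smul_left x)

theorem IsHeckeFamily.hFactor_mul_hFactor (hu : IsHeckeFamily u) (x y : R) (i : ℕ) :
    hFactor u x i * hFactor u y i = hFactor u (x + y + x * y) i := by
  simp only [hFactor, mul_add, add_mul, one_mul, mul_one, smul_mul_assoc, mul_smul_comm, hu.idem]
  module

/-- The Yang–Baxter equation. -/
theorem IsHeckeFamily.yangBaxter (hu : IsHeckeFamily u) (x y : R) (i : ℕ) :
    hFactor u y i * hFactor u (x + y + x * y) (i + 1) * hFactor u x i =
      hFactor u x (i + 1) * hFactor u (x + y + x * y) i * hFactor u y (i + 1) := by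
  simp only [hFactor, mul_add, add_mul, one_mul, mul_one, smul_mul_assoc, mul_smul_comm, hu.idem,
    smul_smul, smul_add, hu.braid]
  module

/-- Decreasing products in the same letters commute. -/
theorem IsHeckeFamily.descProd_comm (hu : IsHeckeFamily u) (x y : R) (n d : ℕ) :
    descProd u x n d * descProd u y n d = descProd u y n d * descProd u x n d := by
  induction n using Nat.strong_induction_on generalizing d with
  | _ n ih =>
  match n with
  | 0 => rfl
  | 1 =>
    simp only [descProd, one_mul]
    rw [hu.hFactor_mul_hFactor, hu.hFactor_mul_hFactor]
    congr 1
    ring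
  | n + 2 =>
    set P := descProd u x (n + 1) (d + 1) * descProd u y n (d + 2) with hP
    set Q := descProd u y (n + 1) (d + 1) * descProd u x n (d + 2) with hQ
    have key : P * hFactor u y (d + 1) = Q * hFactor u x (d + 1) := by
      have := ih (n + 1) (by omega) (d + 1)
      simpa only [hP, hQ, mul_assoc, descProd] using this
    have e1 : ∀ a b : R, descProd u a (n + 2) d * descProd u b (n + 2) d =
        descProd u a (n + 1) (d + 1) * descProd u b n (d + 2) *
          (hFactor u a d * hFactor u b (d + 1) * hFactor u b d) := by
      intro a b
      have hc := (commute_hFactor_of a (hu.commute_descProd b n (le_refl (d + 2)))).eq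
      calc _ = descProd u a (n + 1) (d + 1) * (hFactor u a d * descProd u b n (d + 2)) *
            hFactor u b (d + 1) * hFactor u b d := by
              simp only [descProd, mul_assoc]
        _ = _ := by rw [hc]; simp only [mul_assoc]
    rw [e1, e1, ← hP, ← hQ]
    -- The cubic factor is `(1 + b v) (1 + (a + b + a b) u) + a b ((1 + b v) u v - (1 + b) v u)`.
    have e2 : ∀ a b : R, hFactor u a d * hFactor u b (d + 1) * hFactor u b d =
        hFactor u b (d + 1) * (1 + (a + b + a * b) • u d + (a * b) • (u d * u (d + 1))) -
          (a * b) • (hFactor u b (d + 1) * u (d + 1) * u d) := by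
      intro a b
      simp only [hFactor, mul_add, add_mul, one_mul, mul_one, smul_mul_assoc, mul_smul_comm,
        hu.idem, smul_smul, smul_add, hu.braid, ← mul_assoc]
      module
    rw [e2, e2, mul_sub, mul_sub, ← mul_assoc P, ← mul_assoc Q, key, mul_smul_comm, mul_smul_comm,
      ← mul_assoc P, ← mul_assoc Q, ← mul_assoc P, ← mul_assoc Q, key, mul_comm y x, add_comm y x]

theorem IsHeckeFamily.ascProd_mul_descProd_comm (hu : IsHeckeFamily u) (x y : R) (n d : ℕ) :
    ascProd u y n d * descProd u x n d = descProd u x n d * ascProd u y n d := by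
  induction n using Nat.strong_induction_on generalizing d with
  | _ n ih =>
  match n with
  | 0 => rfl
  | 1 =>
    simp only [descProd, ascProd, one_mul, mul_one]
    rw [hu.hFactor_mul_hFactor, hu.hFactor_mul_hFactor]
    congr 1
    ring
  | n + 2 =>
    have h1 := (commute_hFactor_of y (hu.commute_descProd x n (le_refl (d + 2)))).eq
    have h2 := (commute_hFactor_of x (hu.commute_ascProd y n (le_refl (d + 2)))).eq
    have h3 := ih (n + 1) (by omega) (d + 1)
    calc ascProd u y (n + 2) d * descProd u x (n + 2) d
        = hFactor u y d * (ascProd u y (n + 1) (d + 1) * descProd u x (n + 1) (d + 1)) *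
            hFactor u x d := by simp only [descProd, ascProd, mul_assoc]
      _ = hFactor u y d * descProd u x n (d + 2) *
            (hFactor u x (d + 1) * hFactor u y (d + 1)) *
            (ascProd u y n (d + 2) * hFactor u x d) := by
          rw [h3]; simp only [descProd, ascProd, mul_assoc]
      _ = descProd u x n (d + 2) * (hFactor u y d * hFactor u (x + y + x * y) (d + 1) *
            hFactor u x d) * ascProd u y n (d + 2) := by
          rw [h1, ← h2, hu.hFactor_mul_hFactor]; simp only [mul_assoc]
      _ = descProd u x (n + 2) d * ascProd u y (n + 2) d := by
          rw [hu.yangBaxter]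
          simp only [descProd, ascProd, mul_assoc]
          rw [← mul_assoc (hFactor u x d), hu.hFactor_mul_hFactor]

theorem IsHeckeFamily.ascProd_mul_descChain (hu : IsHeckeFamily u) (x : ℕ → R) (y : R)
    (n d : ℕ) :
    ascProd u y n d * descChain u x (n + 1) d =
      descChain u x n (d + 1) * rowProd u x y n d := by
  induction n generalizing x d with
  | zero => simp [ascProd, descChain, descProd, rowProd]
  | succ n ih =>
    have h1 := hu.ascProd_mul_descProd_comm (x 0) y (n + 1) d
    have h2 := (commute_hFactor_of (x 0 + y + x 0 * y)
      (hu.commute_descChain (fun i => x (i + 1)) n (le_refl (d + 2)))).eq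
    calc ascProd u y (n + 1) d * descChain u x (n + 1 + 1) d
        = (ascProd u y (n + 1) d * descProd u (x 0) (n + 1) d) *
            descChain u (fun i => x (i + 1)) (n + 1) (d + 1) := by
          rw [descChain, mul_assoc]
      _ = descProd u (x 0) n (d + 1) * (hFactor u (x 0) d * hFactor u y d) *
            (ascProd u y n (d + 1) * descChain u (fun i => x (i + 1)) (n + 1) (d + 1)) := by
          rw [h1]; simp only [descProd, ascProd, mul_assoc]
      _ = descProd u (x 0) n (d + 1) *
            (hFactor u (x 0 + y + x 0 * y) d * descChain u (fun i => x (i + 1)) n (d + 2)) *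
            rowProd u (fun i => x (i + 1)) y n (d + 1) := by
          rw [ih, hu.hFactor_mul_hFactor]; simp only [mul_assoc]
      _ = _ := by rw [h2]; simp only [descChain, rowProd, mul_assoc]

/-- Fomin and Kirillov's factorisation of the generating function of the double Grothendieck
polynomials into as many factors `1 + t u_i` as the longest permutation has inversions. -/
theorem IsHeckeFamily.ascChain_mul_descChain (hu : IsHeckeFamily u) (x y : ℕ → R) (n d : ℕ) :
    ascChain u y (n + 1) d * descChain u x (n + 1) d = triProd u x y n d := by
  induction n generalizing y d with
  | zero => simp [ascChain, descChain, ascProd, descProd, triProd]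
  | succ n ih =>
    rw [ascChain, mul_assoc, hu.ascProd_mul_descChain, ← mul_assoc, ih, triProd]

end Products

/-! ### Alternants and ordered products -/

section Alternant

variable {R A : Type*} {n : ℕ} [Ring A]

/-- The antisymmetrisation of a function of `n` variables. -/
def alternant (F : (Fin n → R) → A) (x : Fin n → R) : A :=
  ∑ σ : Equiv.Perm (Fin n), Equiv.Perm.sign σ • F (x ∘ σ)

theorem alternant_add (F G : (Fin n → R) → A) (x : Fin n → R) :
    alternant (fun x => F x + G x) x = alternant F x + alternant G x := by
  simp [alternant, Finset.sum_add_distrib]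

theorem alternant_sum {ι : Type*} (s : Finset ι) (F : ι → (Fin n → R) → A) (x : Fin n → R) :
    alternant (fun x => ∑ i ∈ s, F i x) x = ∑ i ∈ s, alternant (F i) x := by
  simp only [alternant, Finset.smul_sum]
  exact Finset.sum_comm

theorem alternant_eq_zero {F : (Fin n → R) → A} {i j : Fin n} (hij : i ≠ j)
    (h : ∀ x, F (x ∘ Equiv.swap i j) = F x) (x : Fin n → R) : alternant F x = 0 := by
  refine Finset.sum_involution (fun σ _ => σ * Equiv.swap i j) ?_ ?_ ?_ ?_
  · intro σ _
    have : x ∘ (σ * Equiv.swap i j) = (x ∘ σ) ∘ Equiv.swap i j := rfl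
    rw [this, h]
    simp [Equiv.Perm.sign_swap hij]
  · intro σ _ _ hσ
    have : Equiv.swap i j = 1 := by simpa using hσ
    exact hij (Equiv.swap_eq_one_iff.1 this)
  · simp
  · intro σ _
    simp [mul_assoc]

variable [CommRing R] [Algebra R A]

theorem alternant_smul_const (f : (Fin n → R) → R) (a : A) (x : Fin n → R) :
    alternant (fun x => f x • a) x = alternant f x • a := by
  simp only [alternant, Finset.sum_smul, smul_assoc]

/-- The monomial `x_0^{n-1} ⋯ x_{n-1}^0`, twisted by the factors `(1 + x_i)^i`. -/
def weylWeight (x : Fin n → R) : R := ∏ i, x i ^ (n - 1 - i.val) * (1 + x i) ^ i.val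

theorem smul_prod_ofFn (c : Fin n → R) (f : Fin n → A) :
    (∏ i, c i) • (List.ofFn f).prod = (List.ofFn fun i => c i • f i).prod := by
  have := (MultilinearMap.mkPiAlgebraFin R n A).map_smul_univ c f
  simpa using this.symm

theorem prod_ofFn_sum {ι : Type*} [DecidableEq ι] (s : Fin n → Finset ι) (f : Fin n → ι → A) :
    (List.ofFn fun i => ∑ a ∈ s i, f i a).prod =
      ∑ r ∈ Fintype.piFinset s, (List.ofFn fun i => f i (r i)).prod := by
  have := (MultilinearMap.mkPiAlgebraFin ℤ n A).map_sum_finset f s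
  simpa using this

theorem prod_ofFn_eq_zero {f : Fin n → A} (i : Fin n) (h : f i = 0) : (List.ofFn f).prod = 0 := by
  have := (MultilinearMap.mkPiAlgebraFin ℤ n A).map_coord_zero i h
  simpa using this

/-- A telescoping expansion of the difference of two ordered products. -/
theorem prod_ofFn_eq_add_sum {n : ℕ} (p q : Fin n → A) :
    (List.ofFn p).prod = (List.ofFn q).prod +
      ∑ j, (List.ofFn fun i => if i < j then p i else if i = j then p i - q i else q i).prod := by
  induction n with
  | zero => simp
  | succ n ih =>
    rw [Fin.sum_univ_succ]
    simp only [List.ofFn_succ, List.prod_cons, Fin.succ_lt_succ_iff, Fin.succ_inj,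
      Fin.not_lt_zero, if_false, if_true, Fin.succ_ne_zero, Fin.succ_pos, ← Finset.mul_sum]
    rw [ih (fun i => p i.succ) (fun i => q i.succ)]
    noncomm_ring

/-- An ordered product only depends on the product of two adjacent factors. -/
theorem prod_ofFn_congr_adjacent {n : ℕ} {f g : Fin n → A} {i j : Fin n}
    (hij : i.val + 1 = j.val) (h : f i * f j = g i * g j)
    (hne : ∀ l, l ≠ i → l ≠ j → f l = g l) : (List.ofFn f).prod = (List.ofFn g).prod := by
  induction n with
  | zero => exact i.elim0
  | succ n ih =>
    obtain rfl | ⟨j, rfl⟩ := Fin.eq_zero_or_eq_succ j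
    · simp at hij
    obtain rfl | ⟨i, rfl⟩ := Fin.eq_zero_or_eq_succ i
    · cases n with
      | zero => exact j.elim0
      | succ n =>
        obtain rfl : j = 0 := by
          ext
          simpa using hij.symm
        simp only [List.ofFn_succ, List.prod_cons, ← mul_assoc]
        rw [h]
        congr 3
        funext l
        exact hne _ (by simp) (by simp [Fin.ext_iff])
    · simp only [List.ofFn_succ, List.prod_cons]
      rw [hne 0 (Fin.succ_ne_zero _).symm (Fin.succ_ne_zero _).symm]
      congr 1
      refine ih (by simpa using hij) h fun l hi hj => hne _ ?_ ?_
      · simpa using hi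
      · simpa using hj

end Alternant

/-! ### Increasing tableaux as tuples of columns -/

/-- The number of elements of `H` that are less than `i`. -/
def countBelow (H : Finset ℕ) (i : ℕ) : ℕ := (H.filter (· < i)).card

theorem countBelow_mono (H : Finset ℕ) {i j : ℕ} (h : i ≤ j) :
    countBelow H i ≤ countBelow H j :=
  Finset.card_le_card fun a ha => by
    simp only [Finset.mem_filter] at ha ⊢
    exact ⟨ha.1, ha.2.trans_le h⟩

theorem countBelow_eq_card {H : Finset ℕ} {d i : ℕ} (hH : H ⊆ Finset.range d) (h : d ≤ i) :
    countBelow H i = H.card := by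
  unfold countBelow
  rw [Finset.filter_true_of_mem]
  exact fun a ha => (Finset.mem_range.1 (hH ha)).trans_le h

/-- The sets `H 0, H 1, …` are the columns, each listed increasingly downwards, of a filling of a
Young diagram that increases strictly along rows.  In terms of counting functions: if `i` is the
`r`-th smallest entry of a column, then the column to its left has at least `r` entries less than
`i`. -/
def IsColumnTableau {n : ℕ} (H : Fin n → Finset ℕ) : Prop :=
  ∀ j j' : Fin n, j.val + 1 = j'.val → ∀ i, countBelow (H j') (i + 1) ≤ countBelow (H j) i

open scoped Classical in
/-- The column tuples of the increasing tableaux with at most `n` columns and letters less than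
`d`. -/
noncomputable def columnTableaux (n d : ℕ) : Finset (Fin n → Finset ℕ) :=
  (Fintype.piFinset fun _ => (Finset.range d).powerset).filter IsColumnTableau

theorem mem_columnTableaux {n d : ℕ} {H : Fin n → Finset ℕ} :
    H ∈ columnTableaux n d ↔ (∀ j, H j ⊆ Finset.range d) ∧ IsColumnTableau H := by
  simp [columnTableaux, Fintype.mem_piFinset]

theorem columnTableaux_zero (n : ℕ) : columnTableaux n 0 = {fun _ => ∅} := by
  ext H
  rw [mem_columnTableaux, Finset.mem_singleton]
  constructor
  · rintro ⟨h, -⟩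
    funext j
    simpa using h j
  · rintro rfl
    simp [IsColumnTableau, countBelow]

theorem card_le_of_columnTableau {n d : ℕ} {H : Fin n → Finset ℕ} (hH : H ∈ columnTableaux n d)
    {j j' : Fin n} (h : j.val + 1 = j'.val) : (H j').card ≤ (H j).card := by
  rw [mem_columnTableaux] at hH
  rw [← countBelow_eq_card (hH.1 j') (Nat.le_succ d), ← countBelow_eq_card (hH.1 j) le_rfl]
  exact hH.2 j j' h d

/-- The restriction of a tuple of columns to letters less than `d`. -/
def restrictColumns {n : ℕ} (d : ℕ) (K : Fin n → Finset ℕ) (j : Fin n) : Finset ℕ :=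
  (K j).filter (· < d)

theorem countBelow_filter (H : Finset ℕ) (d i : ℕ) :
    countBelow (H.filter (· < d)) i = countBelow H (min i d) := by
  simp only [countBelow, Finset.filter_filter]
  congr 1
  ext a
  simp only [Finset.mem_filter, lt_min_iff]
  tauto

theorem restrictColumns_mem {n d : ℕ} {K : Fin n → Finset ℕ} (hK : K ∈ columnTableaux n (d + 1)) :
    restrictColumns d K ∈ columnTableaux n d := by
  rw [mem_columnTableaux] at hK ⊢
  refine ⟨fun j a ha => ?_, fun j j' h i => ?_⟩
  · simp only [restrictColumns, Finset.mem_filter] at ha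
    simpa using ha.2
  · simp only [restrictColumns, countBelow_filter]
    exact (countBelow_mono _ (by omega)).trans (hK.2 j j' h (min i d))

/-- The letter `d` can be added at the bottom of the column `j` of a tableau with letters less than
`d` if and only if the column to the left is longer. -/
def Extendable {n : ℕ} (H : Fin n → Finset ℕ) (j' : Fin n) : Prop :=
  ∀ j : Fin n, j.val + 1 = j'.val → (H j').card < (H j).card

open scoped Classical in
/-- The possible columns, in position `j`, of the extensions by the letter `d` of the tableau with
columns `H`. -/
noncomputable def columnExtensions {n : ℕ} (d : ℕ) (H : Fin n → Finset ℕ) (j : Fin n) :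
    Finset (Finset ℕ) :=
  if Extendable H j then {H j, insert d (H j)} else {H j}

/-- The tableaux that restrict to a given one arise by adding the letter `d`, independently, to
any of the columns that it can be added to. -/
theorem filter_columnTableaux_succ {n d : ℕ} {H : Fin n → Finset ℕ}
    (hH : H ∈ columnTableaux n d) :
    (columnTableaux n (d + 1)).filter (fun K => restrictColumns d K = H) =
      Fintype.piFinset (columnExtensions d H) := by
  have hd : ∀ j, d ∉ H j := fun j hj => by
    simpa using (mem_columnTableaux.1 hH).1 j hj
  have hsub := (mem_columnTableaux.1 hH).1
  ext K
  simp only [Finset.mem_filter, Fintype.mem_piFinset]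
  constructor
  · rintro ⟨hK, hKH⟩ j
    have hKj : (K j).filter (· < d) = H j := congrFun hKH j
    have hsub' := (mem_columnTableaux.1 hK).1 j
    by_cases hdj : d ∈ K j
    · have hins : K j = insert d (H j) := by
        rw [← hKj]
        ext a
        have := @hsub' a
        simp only [Finset.mem_range, Finset.mem_insert, Finset.mem_filter] at this ⊢
        constructor
        · intro ha
          have := this ha
          rcases Nat.lt_or_ge a d with h | h
          · exact Or.inr ⟨ha, h⟩
          · exact Or.inl (by omega)
        · rintro (rfl | h)
          · exact hdj
          · exact h.1
      have hext : Extendable H j := by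
        intro i hij
        have h1 := (mem_columnTableaux.1 hK).2 i j hij d
        rw [countBelow_eq_card hsub' le_rfl, hins, Finset.card_insert_of_notMem (hd j)] at h1
        have h2 : countBelow (K i) d = (H i).card := by
          rw [← congrFun hKH i]; rfl
        omega
      simp [columnExtensions, hext, hins]
    · have heq : K j = H j := by
        rw [← hKj]
        ext a
        have := @hsub' a
        simp only [Finset.mem_range, Finset.mem_filter] at this ⊢
        refine ⟨fun ha => ⟨ha, ?_⟩, fun h => h.1⟩
        have h1 := this ha
        have h2 : a ≠ d := fun h => hdj (h ▸ ha)
        omega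
      unfold columnExtensions
      split_ifs <;> simp [heq]
  · intro hK
    have hcase : ∀ j, K j = H j ∨ (K j = insert d (H j) ∧ Extendable H j) := by
      intro j
      have := hK j
      unfold columnExtensions at this
      split_ifs at this with h
      · simp only [Finset.mem_insert, Finset.mem_singleton] at this
        tauto
      · simp only [Finset.mem_singleton] at this
        exact Or.inl this
    have hrestr : restrictColumns d K = H := by
      funext j
      have h0 : (H j).filter (· < d) = H j :=
        Finset.filter_true_of_mem fun a ha => Finset.mem_range.1 (hsub j ha)
      rcases hcase j with h | ⟨h, -⟩
      · simp [restrictColumns, h, h0]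
      · simp [restrictColumns, h, h0, Finset.filter_insert]
    have hsubK : ∀ j, K j ⊆ Finset.range (d + 1) := by
      intro j a ha
      rcases hcase j with h | ⟨h, -⟩
      · rw [h] at ha
        have := Finset.mem_range.1 (hsub j ha)
        simp only [Finset.mem_range]; omega
      · rw [h, Finset.mem_insert] at ha
        rcases ha with rfl | ha
        · simp
        · have := Finset.mem_range.1 (hsub j ha)
          simp only [Finset.mem_range]; omega
    refine ⟨mem_columnTableaux.2 ⟨hsubK, fun j j' hjj i => ?_⟩, hrestr⟩
    have hcb : ∀ j i, i ≤ d → countBelow (K j) i = countBelow (H j) i := by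
      intro j i hi
      rw [← congrFun hrestr j, restrictColumns, countBelow_filter, min_eq_left hi]
    rcases Nat.lt_or_ge i d with hi | hi
    · rw [hcb _ _ hi, hcb _ _ hi.le]
      exact (mem_columnTableaux.1 hH).2 j j' hjj i
    · rw [countBelow_eq_card (hsubK j') (by omega)]
      refine le_trans ?_ (countBelow_mono (K j) hi)
      rw [hcb j d le_rfl, countBelow_eq_card (hsub j) le_rfl]
      rcases hcase j' with h | ⟨h, hext⟩
      · rw [h]; exact card_le_of_columnTableau hH hjj
      · rw [h, Finset.card_insert_of_notMem (hd j')]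
        exact hext j hjj

theorem sum_columnTableaux_succ {M : Type*} [AddCommMonoid M] (n d : ℕ)
    (f : (Fin n → Finset ℕ) → M) :
    ∑ K ∈ columnTableaux n (d + 1), f K =
      ∑ H ∈ columnTableaux n d, ∑ K ∈ Fintype.piFinset (columnExtensions d H), f K := by
  rw [← Finset.sum_fiberwise_of_maps_to (g := restrictColumns d)
    fun K hK => restrictColumns_mem hK]
  exact Finset.sum_congr rfl fun H hH => by rw [filter_columnTableaux_succ hH]

/-- The letters of a column at the left of which there is no room for the letter `d` are less than
`d - 1`, so that the corresponding generators commute with `u d`. -/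
theorem add_two_le_of_not_extendable {n d : ℕ} {H : Fin n → Finset ℕ}
    (hH : H ∈ columnTableaux n d) {j j' : Fin n} (hjj : j.val + 1 = j'.val)
    (h : (H j).card ≤ (H j').card) : ∀ i ∈ H j, i + 2 ≤ d := by
  intro i hi
  obtain ⟨hsub, htab⟩ := mem_columnTableaux.1 hH
  have hid := Finset.mem_range.1 (hsub j hi)
  have h1 := htab j j' hjj (d - 1)
  rw [countBelow_eq_card (hsub j') (by omega)] at h1
  have h2 : (H j).filter (· < d - 1) = H j :=
    Finset.eq_of_subset_of_card_le (Finset.filter_subset _ _) (h.trans h1)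
  rw [← h2, Finset.mem_filter] at hi
  omega

/-! ### The Cauchy identity for increasing tableaux -/

section Cauchy

variable {R A : Type*} [CommRing R] [Ring A] [Algebra R A]

/-- The product of the generators `u i` over the letters `i < d` of a column, in decreasing
order. -/
def columnProd (u : ℕ → A) (H : Finset ℕ) : ℕ → A
  | 0 => 1
  | d + 1 => (if d ∈ H then u d else 1) * columnProd u H d

theorem columnProd_congr (u : ℕ → A) {H K : Finset ℕ} {d : ℕ}
    (h : ∀ i < d, i ∈ H ↔ i ∈ K) : columnProd u H d = columnProd u K d := by
  induction d with
  | zero => rfl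
  | succ d ih =>
    have hd : (d ∈ H) = (d ∈ K) := propext (h d (Nat.lt_succ_self d))
    rw [columnProd, columnProd, ih fun i hi => h i (hi.trans (Nat.lt_succ_self d))]
    simp only [hd]

theorem commute_columnProd {u : ℕ → A} {a : A} {H : Finset ℕ} (h : ∀ i ∈ H, Commute (u i) a)
    (d : ℕ) : Commute (columnProd u H d) a := by
  induction d with
  | zero => exact Commute.one_left _
  | succ d ih =>
    refine Commute.mul_left ?_ ih
    split_ifs with hd
    · exact h d hd
    · exact Commute.one_left _

/-- The contribution of a column whose letters less than `d` form the set `H`, while the `e` larger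
letters are unrestricted. -/
def columnTerm (u : ℕ → A) (e d : ℕ) (H : Finset ℕ) (x : R) : A :=
  x ^ H.card • (descProd u x e d * columnProd u H d)

theorem columnTerm_insert (u : ℕ → A) (e d : ℕ) {H : Finset ℕ} (hH : H ⊆ Finset.range d) (x : R) :
    columnTerm u (e + 1) d H x =
      columnTerm u e (d + 1) H x + columnTerm u e (d + 1) (insert d H) x := by
  have hd : d ∉ H := fun h => by simpa using hH h
  have h1 : columnProd u (insert d H) (d + 1) = u d * columnProd u H d := by
    rw [columnProd, if_pos (Finset.mem_insert_self _ _)]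
    congr 1
    refine columnProd_congr u fun i hi => ?_
    simp [hi.ne]
  have h2 : columnProd u H (d + 1) = columnProd u H d := by
    rw [columnProd, if_neg hd, one_mul]
  simp only [columnTerm, h1, h2, Finset.card_insert_of_notMem hd, descProd, hFactor, mul_add,
    mul_one, add_mul, smul_add, mul_smul_comm, smul_mul_assoc, smul_smul, pow_succ, mul_assoc]

variable {u : ℕ → A} {n : ℕ}

/-- The reason why tuples of columns violating the tableau condition cancel in the Cauchy identity:
when the letter `d` in the right one of two adjacent columns is a violation, the sum over all
larger letters in the two columns is, up to the twist by `1 + b`, symmetric in the two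
variables. -/
theorem IsHeckeFamily.columnTerm_mul_columnTerm (hu : IsHeckeFamily u) {H K : Finset ℕ} {e d : ℕ}
    (hK : K ⊆ Finset.range d) (hlt : ∀ i ∈ H, i + 2 ≤ d) (hcard : K.card = H.card)
    (r s : ℕ) (a b : R) :
    ((a ^ (r + 1) * (1 + a) ^ s) • columnTerm u (e + 1) d H a) *
        ((b ^ r * (1 + b) ^ (s + 1)) • columnTerm u e (d + 1) (insert d K) b) =
      ((a * b) ^ (r + H.card + 1) * ((1 + a) * (1 + b)) ^ s) •
        (descProd u a (e + 1) d * descProd u b (e + 1) d * u d *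
          (columnProd u H d * columnProd u K d)) := by
  have hd : d ∉ K := fun h => by simpa using hK h
  have h1 : columnProd u (insert d K) (d + 1) = u d * columnProd u K d := by
    rw [columnProd, if_pos (Finset.mem_insert_self _ _)]
    congr 1
    refine columnProd_congr u fun i hi => ?_
    simp [hi.ne]
  have h2 : descProd u b (e + 1) d * u d = (1 + b) • (descProd u b e (d + 1) * u d) := by
    simp only [descProd, hFactor, mul_assoc, add_mul, one_mul, smul_mul_assoc, hu.idem, add_smul,
      one_smul, mul_add, mul_smul_comm]
  have h3 : columnProd u H d * (descProd u b e (d + 1) * u d) =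
      descProd u b e (d + 1) * u d * columnProd u H d :=
    (commute_columnProd (fun i hi => (hu.commute_descProd b e
      (by have := hlt i hi; omega)).mul_right (hu.comm i d (hlt i hi))) d).eq
  have h4 : descProd u a (e + 1) d * columnProd u H d *
      (descProd u b e (d + 1) * (u d * columnProd u K d)) =
      descProd u a (e + 1) d * (descProd u b e (d + 1) * u d) *
        (columnProd u H d * columnProd u K d) := by
    rw [mul_assoc, ← mul_assoc (descProd u b e (d + 1)), ← mul_assoc (columnProd u H d), h3]
    simp only [mul_assoc]
  rw [mul_assoc (descProd u a (e + 1) d), h2]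
  simp only [columnTerm, h1, Finset.card_insert_of_notMem hd, hcard, smul_mul_assoc,
    mul_smul_comm, smul_smul, h4]
  congr 1
  rw [mul_pow (1 + a)]
  ring

/-- Under antisymmetrisation, the unrestricted sum over all ways to add the letter `d` to the
columns of tableaux may be replaced by the sum over those ways that give tableaux again. -/
theorem IsHeckeFamily.alternant_step (hu : IsHeckeFamily u) (e d : ℕ) (x : Fin n → R) :
    alternant (fun x => weylWeight x • ∑ H ∈ columnTableaux n d,
        (List.ofFn fun i => columnTerm u (e + 1) d (H i) (x i)).prod) x =
      alternant (fun x => weylWeight x • ∑ H ∈ columnTableaux n (d + 1),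
        (List.ofFn fun i => columnTerm u e (d + 1) (H i) (x i)).prod) x := by
  classical
  set q : (Fin n → Finset ℕ) → Fin n → R → A := fun H i t =>
    ∑ K ∈ columnExtensions d H i, columnTerm u e (d + 1) K t with hq
  have hgood : ∀ H ∈ columnTableaux n d, ∀ i, Extendable H i → ∀ t : R,
      columnTerm u (e + 1) d (H i) t = q H i t := by
    intro H hH i hi t
    have hd : d ∉ H i := fun h => by simpa using (mem_columnTableaux.1 hH).1 i h
    have hne : H i ≠ insert d (H i) := fun h => hd (h ▸ Finset.mem_insert_self _ _)
    rw [columnTerm_insert u e d ((mem_columnTableaux.1 hH).1 i)]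
    simp [hq, columnExtensions, hi, Finset.sum_pair hne]
  have hbad : ∀ H ∈ columnTableaux n d, ∀ i, ¬ Extendable H i → ∀ t : R,
      columnTerm u (e + 1) d (H i) t - q H i t =
        columnTerm u e (d + 1) (insert d (H i)) t := by
    intro H hH i hi t
    rw [columnTerm_insert u e d ((mem_columnTableaux.1 hH).1 i)]
    simp [hq, columnExtensions, hi]
  have hexp : ∀ x : Fin n → R, weylWeight x • ∑ H ∈ columnTableaux n d,
        (List.ofFn fun i => columnTerm u (e + 1) d (H i) (x i)).prod =
      weylWeight x • ∑ H ∈ columnTableaux n (d + 1),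
        (List.ofFn fun i => columnTerm u e (d + 1) (H i) (x i)).prod +
      ∑ H ∈ columnTableaux n d, ∑ j, weylWeight x • (List.ofFn fun i =>
        if i < j then columnTerm u (e + 1) d (H i) (x i)
        else if i = j then columnTerm u (e + 1) d (H i) (x i) - q H i (x i)
        else q H i (x i)).prod := by
    intro x
    rw [sum_columnTableaux_succ]
    simp only [← Finset.smul_sum, ← smul_add, ← Finset.sum_add_distrib]
    congr 1
    refine Finset.sum_congr rfl fun H _ => ?_
    rw [prod_ofFn_eq_add_sum _ (fun i => q H i (x i)), hq, prod_ofFn_sum]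
  simp only [hexp]
  rw [alternant_add, add_eq_left, alternant_sum]
  refine Finset.sum_eq_zero fun H hH => ?_
  rw [alternant_sum]
  refine Finset.sum_eq_zero fun j _ => ?_
  by_cases hj : Extendable H j
  · -- The factor in position `j` vanishes.
    refine Finset.sum_eq_zero fun σ _ => ?_
    beta_reduce
    unfold weylWeight
    rw [smul_prod_ofFn, prod_ofFn_eq_zero j, smul_zero]
    simp [hgood H hH j hj]
  · -- The factor in position `j` consists of columns violating the tableau condition; exchanging
    -- the variables of this column and the one to its left does not change the product.
    have hj' := hj
    unfold Extendable at hj'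
    push Not at hj'
    obtain ⟨i, hij, hcard⟩ := hj'
    have hne : i ≠ j := by
      rintro rfl
      omega
    refine alternant_eq_zero hne (fun x => ?_) x
    unfold weylWeight
    rw [smul_prod_ofFn, smul_prod_ofFn]
    have hlt : i < j := by
      rw [Fin.lt_def]; omega
    refine prod_ofFn_congr_adjacent hij ?_ fun l hl hl' => ?_
    · have hr : n - 1 - i.val = (n - 1 - j.val) + 1 := by omega
      have hs : j.val = i.val + 1 := hij.symm
      simp only [hlt, if_true, lt_irrefl, if_false, Function.comp, Equiv.swap_apply_left,
        Equiv.swap_apply_right, hbad H hH j hj]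
      have key := fun a b : R => hu.columnTerm_mul_columnTerm (e := e)
        ((mem_columnTableaux.1 hH).1 j) (add_two_le_of_not_extendable hH hij hcard)
        (le_antisymm (card_le_of_columnTableau hH hij) hcard) (n - 1 - j.val) i.val a b
      rw [← hs, ← hr] at key
      rw [key, key, hu.descProd_comm, mul_comm (x i), mul_comm (1 + x i)]
    · simp [Function.comp, Equiv.swap_apply_of_ne_of_ne hl hl']

/-- The Cauchy identity for the products of the generators over increasing tableaux, in alternant
form. -/
theorem IsHeckeFamily.cauchy_alternant (hu : IsHeckeFamily u) (k : ℕ) (x : Fin n → R) :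
    alternant weylWeight x • (List.ofFn fun i => descProd u (x i) k 0).prod =
      ∑ H ∈ columnTableaux n k,
        alternant (fun x => weylWeight x * ∏ i, x i ^ (H i).card) x •
          (List.ofFn fun i => columnProd u (H i) k).prod := by
  have hstep : ∀ d ≤ k, alternant (fun x => weylWeight x • ∑ H ∈ columnTableaux n 0,
        (List.ofFn fun i => columnTerm u k 0 (H i) (x i)).prod) x =
      alternant (fun x => weylWeight x • ∑ H ∈ columnTableaux n d,
        (List.ofFn fun i => columnTerm u (k - d) d (H i) (x i)).prod) x := by
    intro d
    induction d with
    | zero => intro _; rfl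
    | succ d ih =>
      intro hd
      rw [ih (by omega), show k - d = (k - (d + 1)) + 1 by omega]
      exact hu.alternant_step _ _ x
  have h := hstep k le_rfl
  rw [columnTableaux_zero] at h
  simp only [Finset.sum_singleton, columnTerm, Finset.card_empty, pow_zero, columnProd,
    mul_one, Nat.sub_self, descProd, one_mul, ← smul_prod_ofFn, Finset.smul_sum, smul_smul,
    Finset.prod_const_one] at h
  rw [alternant_sum] at h
  simp only [alternant_smul_const] at h
  rw [← h]
  have hperm : ∀ σ : Equiv.Perm (Fin n),
      (List.ofFn fun i => descProd u ((x ∘ σ) i) k 0).prod =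
        (List.ofFn fun i => descProd u (x i) k 0).prod := by
    intro σ
    have hc : ∀ a b : R, Commute (descProd u a k 0) (descProd u b k 0) :=
      fun a b => hu.descProd_comm a b k 0
    refine List.Perm.prod_eq' ?_ ?_
    · exact Equiv.Perm.ofFn_comp_perm σ fun i => descProd u (x i) k 0
    · rw [List.pairwise_ofFn]
      exact fun i j _ => hc _ _
  simp only [alternant, Finset.sum_smul, hperm, smul_assoc]

end Cauchy

/-! ### Set-valued tableaux: splitting the alphabet -/

section SetValued

variable {R : Type*} [CommRing R]

/-- The monotonicity conditions of a set-valued tableau for a filling, by possibly empty sets, of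
an arbitrary set of boxes. -/
def IsSemistrict {B : Finset (ℕ × ℕ)} {n : ℕ} (T : {c // c ∈ B} → Finset (Fin n)) : Prop :=
  (∀ c d, c.1.1 = d.1.1 → c.1.2 < d.1.2 → ∀ a ∈ T c, ∀ b ∈ T d, a < b) ∧
  (∀ c d, c.1.2 = d.1.2 → c.1.1 < d.1.1 → ∀ a ∈ T c, ∀ b ∈ T d, a ≤ b)

/-- The fillings of the boxes of `B` by sets that are nonempty exactly on `lam / rho` and form a
set-valued tableau there. -/
def IsSupportedTableau {B : Finset (ℕ × ℕ)} {n : ℕ} (lam rho : YoungDiagram)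
    (T : {c // c ∈ B} → Finset (Fin n)) : Prop :=
  (∀ c, (T c).Nonempty ↔ c.1 ∈ lam.cells \ rho.cells) ∧ IsSemistrict T

open scoped Classical in
/-- Symmetric Grothendieck polynomials of different shapes as sums over fillings of the same set of
boxes. -/
theorem symGrothendieck_eq_sum {B : Finset (ℕ × ℕ)} {lam rho : YoungDiagram} (h : lam.cells ⊆ B)
    {n : ℕ} (z : Fin n → R) :
    symGrothendieck lam rho z =
      ∑ T ∈ (Finset.univ : Finset ({c // c ∈ B} → Finset (Fin n))).filter
        (fun T => IsSupportedTableau lam rho T), ∏ c, ∏ a ∈ T c, z a := by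
  have hS : ∀ c ∈ lam.cells \ rho.cells, c ∈ B := fun c hc => h (Finset.mem_sdiff.1 hc).1
  unfold symGrothendieck
  refine Finset.sum_bij'
    (fun T _ c => if hc : c.1 ∈ lam.cells \ rho.cells then T ⟨c.1, hc⟩ else ∅)
    (fun T _ c => T ⟨c.1, hS c.1 c.2⟩) ?_ ?_ ?_ ?_ ?_
  · intro T hT
    obtain ⟨h1, h2, h3⟩ := (Finset.mem_filter.1 hT).2
    refine Finset.mem_filter.2 ⟨Finset.mem_univ _, fun c => ?_, fun c d hr hl a ha b hb => ?_,
      fun c d hr hl a ha b hb => ?_⟩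
    · beta_reduce
      split_ifs with hc
      · simpa only [hc, iff_true] using h1 _
      · simp [hc]
    · beta_reduce at ha hb
      split_ifs at ha hb with hc hd
      · exact h2 _ _ hr hl a ha b hb
      all_goals simp at ha hb
    · beta_reduce at ha hb
      split_ifs at ha hb with hc hd
      · exact h3 _ _ hr hl a ha b hb
      all_goals simp at ha hb
  · intro T hT
    obtain ⟨h1, h2, h3⟩ := (Finset.mem_filter.1 hT).2
    exact Finset.mem_filter.2 ⟨Finset.mem_univ _, fun c => (h1 _).2 c.2,
      fun c d => h2 ⟨c.1, hS c.1 c.2⟩ ⟨d.1, hS d.1 d.2⟩,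
      fun c d => h3 ⟨c.1, hS c.1 c.2⟩ ⟨d.1, hS d.1 d.2⟩⟩
  · intro T _
    funext c
    simp only [c.2, dif_pos]
  · intro T hT
    obtain ⟨h1, -⟩ := (Finset.mem_filter.1 hT).2
    funext c
    split_ifs with hc
    · rfl
    · exact (Finset.not_nonempty_iff_eq_empty.1 fun hne => hc ((h1 c).1 hne)).symm
  · intro T _
    refine Fintype.prod_of_injective (fun c => ⟨c.1, hS c.1 c.2⟩) ?_ _ _ ?_ ?_
    · intro c d hcd
      exact Subtype.ext (congrArg (fun e => e.1) hcd)
    · intro c hc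
      have hc' : c.1 ∉ lam.cells \ rho.cells := fun h => hc ⟨⟨c.1, h⟩, rfl⟩
      simp only [hc', dif_neg, not_false_eq_true, Finset.prod_empty]
    · intro c
      simp only [c.2, dif_pos]

/-- The letters of `s` among the first `p` ones. -/
def lowPart {p n : ℕ} (s : Finset (Fin (p + n))) : Finset (Fin p) :=
  Finset.univ.filter fun a => Fin.castAdd n a ∈ s

/-- The letters of `s` among the last `n` ones. -/
def highPart {p n : ℕ} (s : Finset (Fin (p + n))) : Finset (Fin n) :=
  Finset.univ.filter fun a => Fin.natAdd p a ∈ s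

@[simp] theorem mem_lowPart {p n : ℕ} {s : Finset (Fin (p + n))} {a : Fin p} :
    a ∈ lowPart s ↔ Fin.castAdd n a ∈ s := by simp [lowPart]

@[simp] theorem mem_highPart {p n : ℕ} {s : Finset (Fin (p + n))} {a : Fin n} :
    a ∈ highPart s ↔ Fin.natAdd p a ∈ s := by simp [highPart]

theorem castAdd_lt_natAdd_of {p n : ℕ} (a : Fin p) (b : Fin n) :
    Fin.castAdd n a < Fin.natAdd p b := by
  rw [Fin.lt_def]
  simp only [Fin.val_castAdd, Fin.val_natAdd]
  omega

/-- The subset of `Fin (p + n)` with given parts. -/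
def joinParts {p n : ℕ} (s : Finset (Fin p)) (t : Finset (Fin n)) : Finset (Fin (p + n)) :=
  s.map (Fin.castAddEmb n) ∪ t.map (Fin.natAddEmb p)

@[simp] theorem castAdd_mem_joinParts {p n : ℕ} {s : Finset (Fin p)} {t : Finset (Fin n)}
    {a : Fin p} : Fin.castAdd n a ∈ joinParts s t ↔ a ∈ s := by
  simp [joinParts, fun b : Fin n => (castAdd_lt_natAdd_of a b).ne']

@[simp] theorem natAdd_mem_joinParts {p n : ℕ} {s : Finset (Fin p)} {t : Finset (Fin n)}
    {a : Fin n} : Fin.natAdd p a ∈ joinParts s t ↔ a ∈ t := by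
  simp [joinParts, fun b : Fin p => (castAdd_lt_natAdd_of b a).ne]

@[simp] theorem lowPart_joinParts {p n : ℕ} (s : Finset (Fin p)) (t : Finset (Fin n)) :
    lowPart (joinParts s t) = s := by ext; simp

@[simp] theorem highPart_joinParts {p n : ℕ} (s : Finset (Fin p)) (t : Finset (Fin n)) :
    highPart (joinParts s t) = t := by ext; simp

theorem joinParts_lowPart_highPart {p n : ℕ} (s : Finset (Fin (p + n))) :
    joinParts (lowPart s) (highPart s) = s := by
  ext a
  refine Fin.addCases (fun b => ?_) (fun b => ?_) a <;> simp

theorem prod_append_joinParts {p n : ℕ} (y : Fin p → R) (x : Fin n → R) (s : Finset (Fin p))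
    (t : Finset (Fin n)) :
    ∏ a ∈ joinParts s t, Fin.append y x a = (∏ a ∈ s, y a) * ∏ a ∈ t, x a := by
  rw [joinParts, Finset.prod_union, Finset.prod_map, Finset.prod_map]
  · simp
  · rw [Finset.disjoint_left]
    intro c hc hc'
    obtain ⟨a, -, rfl⟩ := Finset.mem_map.1 hc
    obtain ⟨b, -, hb⟩ := Finset.mem_map.1 hc'
    exact (castAdd_lt_natAdd_of a b).ne' hb

/-- In a filling of a Young diagram without empty boxes the letters increase weakly in the
south-east direction. -/
theorem IsSemistrict.le_of_le {lam : YoungDiagram} {n : ℕ}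
    {T : {c // c ∈ lam.cells} → Finset (Fin n)} (hT : IsSemistrict T)
    (hne : ∀ c, (T c).Nonempty) {c d : {c // c ∈ lam.cells}} (hcd : c.1 ≤ d.1)
    (hne' : c ≠ d) {a b : Fin n} (ha : a ∈ T c) (hb : b ∈ T d) : a ≤ b := by
  obtain ⟨⟨i, j⟩, hc⟩ := c
  obtain ⟨⟨i', j'⟩, hd⟩ := d
  obtain ⟨hi, hj⟩ : i ≤ i' ∧ j ≤ j' := hcd
  have he : (i, j') ∈ lam.cells :=
    lam.isLowerSet (show ((i, j') : ℕ × ℕ) ≤ (i', j') from ⟨hi, le_rfl⟩) hd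
  rcases hi.eq_or_lt with rfl | hi
  · have : j < j' := lt_of_le_of_ne hj fun h => hne' (by subst h; rfl)
    exact (hT.1 ⟨(i, j), hc⟩ ⟨(i, j'), hd⟩ rfl this a ha b hb).le
  · rcases hj.eq_or_lt with rfl | hj
    · exact hT.2 ⟨(i, j), hc⟩ ⟨(i', j), hd⟩ rfl hi a ha b hb
    · obtain ⟨e, he'⟩ := hne ⟨(i, j'), he⟩
      exact (hT.1 ⟨(i, j), hc⟩ ⟨(i, j'), he⟩ rfl hj a ha e he').le.trans
        (hT.2 ⟨(i, j'), he⟩ ⟨(i', j'), hd⟩ rfl hi e he' b hb)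

/-- The Young diagram of the boxes of `lam` satisfying a predicate that is inherited by smaller
boxes. -/
def filterDiagram (lam : YoungDiagram) (P : {c // c ∈ lam.cells} → Prop) [DecidablePred P]
    (hP : ∀ c d : {c // c ∈ lam.cells}, c.1 ≤ d.1 → P d → P c) : YoungDiagram where
  cells := (Finset.univ.filter P).map (Function.Embedding.subtype _)
  isLowerSet := by
    intro d c hcd hd
    simp only [Finset.coe_map, Function.Embedding.subtype_apply, Finset.coe_filter,
      Finset.mem_univ, true_and, Set.mem_image, Set.mem_ofPred_eq, Subtype.exists,
      exists_and_right, exists_eq_right] at hd ⊢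
    obtain ⟨hd, hPd⟩ := hd
    have hc := lam.isLowerSet hcd hd
    exact ⟨hc, hP ⟨c, hc⟩ ⟨d, hd⟩ hcd hPd⟩

theorem mem_filterDiagram {lam : YoungDiagram} {P : {c // c ∈ lam.cells} → Prop} [DecidablePred P]
    {hP : ∀ c d : {c // c ∈ lam.cells}, c.1 ≤ d.1 → P d → P c} (c : {c // c ∈ lam.cells}) :
    c.1 ∈ (filterDiagram lam P hP).cells ↔ P c := by
  simp [filterDiagram]

theorem filterDiagram_le {lam : YoungDiagram} {P : {c // c ∈ lam.cells} → Prop} [DecidablePred P]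
    {hP : ∀ c d : {c // c ∈ lam.cells}, c.1 ≤ d.1 → P d → P c} :
    filterDiagram lam P hP ≤ lam := by
  intro c hc
  rw [← YoungDiagram.mem_cells] at hc
  simp only [filterDiagram, Finset.mem_map, Function.Embedding.subtype_apply, Subtype.exists,
    exists_and_right, exists_eq_right] at hc
  exact hc.1

/-- Joining a tableau of shape `mu` in the small letters with a tableau of shape `lam / rho` in the
large letters gives a tableau of shape `lam` if `mu / rho` is a rook strip. -/
theorem isSupportedTableau_join {lam mu rho : YoungDiagram} (hrook : IsRookStrip rho mu)
    {p n : ℕ} {S : {c // c ∈ lam.cells} → Finset (Fin p)}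
    {T : {c // c ∈ lam.cells} → Finset (Fin n)} (hS : IsSupportedTableau mu ⊥ S)
    (hT : IsSupportedTableau lam rho T) :
    IsSupportedTableau lam ⊥ fun c => joinParts (S c) (T c) := by
  have hmem : ∀ c d : {c // c ∈ lam.cells}, c.1 ≤ d.1 → (T c).Nonempty → (S d).Nonempty →
      c.1 ∈ mu.cells \ rho.cells ∧ d.1 ∈ mu.cells \ rho.cells := by
    intro c d hcd hTc hSd
    have h1 := Finset.mem_sdiff.1 ((hT.1 c).1 hTc)
    have h2 := Finset.mem_sdiff.1 ((hS.1 d).1 hSd)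
    exact ⟨Finset.mem_sdiff.2 ⟨mu.isLowerSet hcd h2.1, h1.2⟩,
      Finset.mem_sdiff.2 ⟨h2.1, fun h => h1.2 (rho.isLowerSet hcd h)⟩⟩
  refine ⟨fun c => ?_, fun c d hr hl a ha b hb => ?_, fun c d hr hl a ha b hb => ?_⟩
  · simp only [YoungDiagram.cells_bot, Finset.sdiff_empty, c.2, iff_true]
    by_cases hc : c.1 ∈ rho.cells
    · have : c.1 ∈ mu.cells \ (⊥ : YoungDiagram).cells := by simpa using hrook.1 hc
      obtain ⟨a, ha⟩ := (hS.1 c).2 this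
      exact ⟨Fin.castAdd n a, by simpa using ha⟩
    · obtain ⟨a, ha⟩ := (hT.1 c).2 (Finset.mem_sdiff.2 ⟨c.2, hc⟩)
      exact ⟨Fin.natAdd p a, by simpa using ha⟩
  · have hne : c.1 ≠ d.1 := fun h => by rw [h] at hl; exact lt_irrefl _ hl
    revert ha hb
    refine Fin.addCases (fun a => ?_) (fun a => ?_) a <;>
      refine Fin.addCases (fun b => ?_) (fun b => ?_) b <;>
      simp only [castAdd_mem_joinParts, natAdd_mem_joinParts] <;> intro ha hb
    · exact hS.2.1 c d hr hl a ha b hb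
    · exact castAdd_lt_natAdd_of _ _
    · obtain ⟨h1, h2⟩ := hmem c d ⟨hr.le, hl.le⟩ ⟨a, ha⟩ ⟨b, hb⟩
      exact absurd hr (hrook.2 _ h1 _ h2 hne).1
    · exact Nat.add_lt_add_left (hT.2.1 c d hr hl a ha b hb) p
  · have hne : c.1 ≠ d.1 := fun h => by rw [h] at hl; exact lt_irrefl _ hl
    revert ha hb
    refine Fin.addCases (fun a => ?_) (fun a => ?_) a <;>
      refine Fin.addCases (fun b => ?_) (fun b => ?_) b <;>
      simp only [castAdd_mem_joinParts, natAdd_mem_joinParts] <;> intro ha hb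
    · exact hS.2.2 c d hr hl a ha b hb
    · exact (castAdd_lt_natAdd_of _ _).le
    · obtain ⟨h1, h2⟩ := hmem c d ⟨hl.le, hr.le⟩ ⟨a, ha⟩ ⟨b, hb⟩
      exact absurd hr (hrook.2 _ h1 _ h2 hne).2
    · exact Nat.add_le_add_left (hT.2.2 c d hr hl a ha b hb) p

/-- Every tableau of shape `lam` arises by joining two tableaux, the boxes of the small and of the
large letters overlapping in a rook strip. -/
theorem exists_of_isSupportedTableau {lam : YoungDiagram} {p n : ℕ}
    {T : {c // c ∈ lam.cells} → Finset (Fin (p + n))} (hT : IsSupportedTableau lam ⊥ T) :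
    ∃ mu rho : YoungDiagram, mu ≤ lam ∧ IsRookStrip rho mu ∧
      IsSupportedTableau mu ⊥ (fun c => lowPart (T c)) ∧
      IsSupportedTableau lam rho (fun c => highPart (T c)) := by
  classical
  -- `mu` consists of the boxes with a small letter, `rho` of those without a large letter.
  have hne : ∀ c, (T c).Nonempty := fun c => (hT.1 c).2 (by simp [c.2])
  have hmu : ∀ c d : {c // c ∈ lam.cells}, c.1 ≤ d.1 → (lowPart (T d)).Nonempty →
      (lowPart (T c)).Nonempty := by
    rintro c d hcd hd
    by_cases h : c = d
    · rwa [h]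
    obtain ⟨b, hb⟩ := hd
    obtain ⟨a, ha⟩ := hne c
    rw [mem_lowPart] at hb
    have hab := hT.2.le_of_le hne hcd h ha hb
    revert ha hab
    refine Fin.addCases (fun a ha _ => ⟨a, by simpa using ha⟩) (fun a _ hab => ?_) a
    exact absurd hab (not_le.2 (castAdd_lt_natAdd_of _ _))
  have hrho : ∀ c d : {c // c ∈ lam.cells}, c.1 ≤ d.1 → highPart (T d) = ∅ →
      highPart (T c) = ∅ := by
    rintro c d hcd hd
    by_cases h : c = d
    · rwa [h]
    by_contra hc
    obtain ⟨a, ha⟩ := Finset.nonempty_iff_ne_empty.2 hc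
    obtain ⟨b, hb⟩ := hne d
    rw [mem_highPart] at ha
    have hab := hT.2.le_of_le hne hcd h ha hb
    revert hb hab
    refine Fin.addCases (fun b _ hab => ?_) (fun b hb _ => ?_) b
    · exact absurd hab (not_le.2 (castAdd_lt_natAdd_of _ _))
    · have : b ∈ highPart (T d) := by simpa using hb
      simp [hd] at this
  set mu := filterDiagram lam (fun c => (lowPart (T c)).Nonempty) hmu with hmu_def
  set rho := filterDiagram lam (fun c => highPart (T c) = ∅) hrho with hrho_def
  have hmu_le : mu ≤ lam := filterDiagram_le
  have hrho_le : rho ≤ lam := filterDiagram_le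
  have hmix : ∀ c ∈ mu.cells \ rho.cells, ∃ hc : c ∈ lam.cells,
      (∃ a, Fin.castAdd n a ∈ T ⟨c, hc⟩) ∧ ∃ b, Fin.natAdd p b ∈ T ⟨c, hc⟩ := by
    intro c hc
    obtain ⟨h1, h2⟩ := Finset.mem_sdiff.1 hc
    have hcl : c ∈ lam.cells := hmu_le h1
    obtain ⟨a, ha⟩ := (mem_filterDiagram ⟨c, hcl⟩).1 h1
    have h3 := mt (mem_filterDiagram (hP := hrho) ⟨c, hcl⟩).2 h2
    obtain ⟨b, hb⟩ := Finset.nonempty_iff_ne_empty.2 h3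
    exact ⟨hcl, ⟨a, by simpa using ha⟩, b, by simpa using hb⟩
  have hanti : ∀ c ∈ mu.cells \ rho.cells, ∀ d ∈ mu.cells \ rho.cells, c ≤ d → c = d := by
    intro c hc d hd hcd
    by_contra hne'
    obtain ⟨hc', -, a, ha⟩ := hmix c hc
    obtain ⟨hd', ⟨b, hb⟩, -⟩ := hmix d hd
    have := hT.2.le_of_le hne (c := ⟨c, hc'⟩) (d := ⟨d, hd'⟩) hcd
      (fun h => hne' (congrArg Subtype.val h)) ha hb
    exact absurd this (not_le.2 (castAdd_lt_natAdd_of _ _))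
  refine ⟨mu, rho, hmu_le, ⟨?_, ?_⟩, ⟨?_, ?_, ?_⟩, ⟨?_, ?_, ?_⟩⟩
  · intro c hc
    have hcl : c ∈ lam.cells := hrho_le hc
    have h1 := (mem_filterDiagram (hP := hrho) ⟨c, hcl⟩).1 hc
    refine (mem_filterDiagram (hP := hmu) ⟨c, hcl⟩).2 ?_
    obtain ⟨a, ha⟩ := hne ⟨c, hcl⟩
    revert ha
    refine Fin.addCases (fun a ha => ⟨a, by simpa using ha⟩) (fun a ha => ?_) a
    have : a ∈ highPart (T ⟨c, hcl⟩) := by simpa using ha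
    simp [h1] at this
  · intro c hc d hd hcd
    constructor
    · intro h
      rcases le_total c.2 d.2 with h' | h'
      · exact hcd (hanti c hc d hd ⟨h.le, h'⟩)
      · exact hcd (hanti d hd c hc ⟨h.ge, h'⟩).symm
    · intro h
      rcases le_total c.1 d.1 with h' | h'
      · exact hcd (hanti c hc d hd ⟨h', h.le⟩)
      · exact hcd (hanti d hd c hc ⟨h', h.ge⟩).symm
  · intro c
    simpa using (mem_filterDiagram (hP := hmu) c).symm
  · intro c d hr hl a ha b hb
    exact hT.2.1 c d hr hl _ (mem_lowPart.1 ha) _ (mem_lowPart.1 hb)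
  · intro c d hr hl a ha b hb
    exact hT.2.2 c d hr hl _ (mem_lowPart.1 ha) _ (mem_lowPart.1 hb)
  · intro c
    rw [Finset.mem_sdiff, mem_filterDiagram (hP := hrho) c, Finset.nonempty_iff_ne_empty]
    simp [c.2]
  · intro c d hr hl a ha b hb
    exact Nat.lt_of_add_lt_add_left (hT.2.1 c d hr hl _ (mem_highPart.1 ha) _ (mem_highPart.1 hb))
  · intro c d hr hl a ha b hb
    exact Nat.le_of_add_le_add_left (hT.2.2 c d hr hl _ (mem_highPart.1 ha) _ (mem_highPart.1 hb))

theorem eq_of_isSupportedTableau_bot {B : Finset (ℕ × ℕ)} {mu mu' : YoungDiagram} {n : ℕ}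
    {T : {c // c ∈ B} → Finset (Fin n)} (h : mu.cells ⊆ B) (h' : mu'.cells ⊆ B)
    (hT : IsSupportedTableau mu ⊥ T) (hT' : IsSupportedTableau mu' ⊥ T) : mu = mu' := by
  have key : ∀ c (hc : c ∈ B), c ∈ mu.cells ↔ c ∈ mu'.cells := fun c hc => by
    simpa using (hT.1 ⟨c, hc⟩).symm.trans (hT'.1 ⟨c, hc⟩)
  ext c
  exact ⟨fun hc => (key c (h hc)).1 hc, fun hc => (key c (h' hc)).2 hc⟩

theorem eq_of_isSupportedTableau {lam rho rho' : YoungDiagram} {n : ℕ}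
    {T : {c // c ∈ lam.cells} → Finset (Fin n)} (h : rho ≤ lam) (h' : rho' ≤ lam)
    (hT : IsSupportedTableau lam rho T) (hT' : IsSupportedTableau lam rho' T) : rho = rho' := by
  have key : ∀ c (hc : c ∈ lam.cells), c ∈ rho.cells ↔ c ∈ rho'.cells := fun c hc => by
    have := (hT.1 ⟨c, hc⟩).symm.trans (hT'.1 ⟨c, hc⟩)
    simp only [Finset.mem_sdiff, hc, true_and] at this
    exact not_iff_not.1 this
  ext c
  exact ⟨fun hc => (key c (h hc)).1 hc, fun hc => (key c (h' hc)).2 hc⟩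

/-- Splitting the alphabet: the coproduct formula for symmetric Grothendieck polynomials. -/
theorem symGrothendieck_append (lam : YoungDiagram) {p n : ℕ} (y : Fin p → R) (x : Fin n → R) :
    symGrothendieck lam ⊥ (Fin.append y x) =
      ∑ mu ∈ subdiagrams lam, ∑ rho ∈ (subdiagrams mu).filter (fun rho => IsRookStrip rho mu),
        symGrothendieck mu ⊥ y * symGrothendieck lam rho x := by
  classical
  have hle : ∀ {mu rho}, mu ∈ subdiagrams lam → rho ∈ subdiagrams mu → rho ≤ lam := fun h h' =>
    (mem_subdiagrams.1 h').trans (mem_subdiagrams.1 h)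
  have hR : ∀ mu ∈ subdiagrams lam,
      ∑ rho ∈ (subdiagrams mu).filter (fun rho => IsRookStrip rho mu),
        symGrothendieck mu ⊥ y * symGrothendieck lam rho x =
      ∑ rho ∈ (subdiagrams mu).filter (fun rho => IsRookStrip rho mu),
        ∑ q ∈ (Finset.univ : Finset ({c // c ∈ lam.cells} → Finset (Fin p))).filter
            (fun S => IsSupportedTableau mu ⊥ S) ×ˢ
          (Finset.univ : Finset ({c // c ∈ lam.cells} → Finset (Fin n))).filter
            (fun S => IsSupportedTableau lam rho S),
        (∏ c, ∏ a ∈ q.1 c, y a) * ∏ c, ∏ a ∈ q.2 c, x a := by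
    intro mu hmu
    refine Finset.sum_congr rfl fun rho hrho => ?_
    rw [symGrothendieck_eq_sum (YoungDiagram.cells_subset_iff.2 (mem_subdiagrams.1 hmu)),
      symGrothendieck_eq_sum (le_refl lam.cells), Finset.sum_mul_sum, Finset.sum_product]
  rw [Finset.sum_congr rfl hR, Finset.sum_sigma', Finset.sum_sigma',
    symGrothendieck_eq_sum (le_refl lam.cells)]
  symm
  refine Finset.sum_bij (fun q _ c => joinParts (q.2.1 c) (q.2.2 c)) ?_ ?_ ?_ ?_
  · rintro ⟨⟨mu, rho⟩, S, T⟩ hq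
    simp only [Finset.mem_sigma, Finset.mem_filter, Finset.mem_product, Finset.mem_univ,
      true_and] at hq
    refine Finset.mem_filter.2 ⟨Finset.mem_univ _, ?_⟩
    exact isSupportedTableau_join hq.1.2.2 hq.2.1 hq.2.2
  · rintro ⟨⟨mu, rho⟩, S, T⟩ hq ⟨⟨mu', rho'⟩, S', T'⟩ hq' heq
    simp only [Finset.mem_sigma, Finset.mem_filter, Finset.mem_product, Finset.mem_univ,
      true_and] at hq hq'
    obtain rfl : S = S' := funext fun c => by
      simpa using congrArg lowPart (congrFun heq c)
    obtain rfl : T = T' := funext fun c => by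
      simpa using congrArg highPart (congrFun heq c)
    obtain rfl := eq_of_isSupportedTableau_bot
      (YoungDiagram.cells_subset_iff.2 (mem_subdiagrams.1 hq.1.1))
      (YoungDiagram.cells_subset_iff.2 (mem_subdiagrams.1 hq'.1.1)) hq.2.1 hq'.2.1
    obtain rfl := eq_of_isSupportedTableau (hle hq.1.1 hq.1.2.1) (hle hq'.1.1 hq'.1.2.1)
      hq.2.2 hq'.2.2
    rfl
  · intro T hT
    obtain ⟨mu, rho, hmu, hrook, h1, h2⟩ := exists_of_isSupportedTableau (Finset.mem_filter.1 hT).2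
    refine ⟨⟨⟨mu, rho⟩, fun c => lowPart (T c), fun c => highPart (T c)⟩, ?_, ?_⟩
    · simp only [Finset.mem_sigma, Finset.mem_filter, Finset.mem_product, Finset.mem_univ,
        true_and]
      exact ⟨⟨mem_subdiagrams.2 hmu, mem_subdiagrams.2 hrook.1, hrook⟩, h1, h2⟩
    · funext c
      exact joinParts_lowPart_highPart _
  · rintro ⟨⟨mu, rho⟩, S, T⟩ _
    simp only [prod_append_joinParts, Finset.prod_mul_distrib]

/-- A skew symmetric Grothendieck polynomial in one variable is a power of the variable or zero,
according to whether the skew shape has at most one box in each row. -/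
theorem symGrothendieck_one_variable (lam rho : YoungDiagram) (t : R)
    [Decidable (∀ c ∈ lam.cells \ rho.cells, ∀ d ∈ lam.cells \ rho.cells, c.1 = d.1 → c = d)] :
    symGrothendieck lam rho (fun _ : Fin 1 => t) =
      if ∀ c ∈ lam.cells \ rho.cells, ∀ d ∈ lam.cells \ rho.cells, c.1 = d.1 → c = d then
        t ^ (lam.cells \ rho.cells).card else 0 := by
  classical
  have huniq : ∀ T : {c // c ∈ lam.cells \ rho.cells} → Finset (Fin 1), IsSetValuedTableau T →
      T = fun _ => {0} := fun T hT => funext fun c => by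
    obtain ⟨a, ha⟩ := hT.1 c
    rw [Subsingleton.elim a 0] at ha
    exact Finset.eq_singleton_iff_unique_mem.2 ⟨ha, fun b _ => Subsingleton.elim _ _⟩
  unfold symGrothendieck
  split_ifs with h
  · rw [Finset.sum_eq_single_of_mem (fun _ => {0})]
    · simp
    · refine Finset.mem_filter.2 ⟨Finset.mem_univ _, fun _ => by simp, fun c d hr hl => ?_,
        fun _ _ _ _ a _ b _ => (Subsingleton.elim a b).le⟩
      have := h c.1 c.2 d.1 d.2 hr
      rw [this] at hl
      exact absurd hl (lt_irrefl _)
    · exact fun T hT hne => absurd (huniq T (Finset.mem_filter.1 hT).2) hne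
  · rw [Finset.filter_eq_empty_iff.2, Finset.sum_empty]
    intro T _ hT
    apply h
    intro c hc d hd hr
    by_contra hne
    obtain ⟨a, ha⟩ := hT.1 ⟨c, hc⟩
    obtain ⟨b, hb⟩ := hT.1 ⟨d, hd⟩
    have hne2 : c.2 ≠ d.2 := fun h2 => hne (Prod.ext hr h2)
    rcases hne2.lt_or_gt with hl | hl
    · exact absurd (hT.2.1 ⟨c, hc⟩ ⟨d, hd⟩ hr hl a ha b hb) (by simp [Subsingleton.elim a b])
    · exact absurd (hT.2.1 ⟨d, hd⟩ ⟨c, hc⟩ hr.symm hl b hb a ha)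
        (by simp [Subsingleton.elim a b])

/-- A symmetric Grothendieck polynomial in fewer variables than its shape has columns vanishes. -/
theorem symGrothendieck_eq_zero {lam : YoungDiagram} {n : ℕ} (h : (0, n) ∈ lam) (x : Fin n → R) :
    symGrothendieck lam ⊥ x = 0 := by
  classical
  unfold symGrothendieck
  rw [Finset.filter_eq_empty_iff.2, Finset.sum_empty]
  intro T _ hT
  have hmem : ∀ j : Fin (n + 1), ((0, j.val) : ℕ × ℕ) ∈ lam.cells \ (⊥ : YoungDiagram).cells := by
    intro j
    simp only [YoungDiagram.cells_bot, Finset.sdiff_empty]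
    exact lam.isLowerSet (show ((0, j.val) : ℕ × ℕ) ≤ (0, n) from ⟨le_rfl, Nat.lt_succ_iff.1 j.2⟩) h
  choose f hf using fun j => hT.1 ⟨_, hmem j⟩
  have hmono : StrictMono f := fun i j hij =>
    hT.2.1 ⟨_, hmem i⟩ ⟨_, hmem j⟩ rfl hij _ (hf i) _ (hf j)
  have := Fintype.card_le_of_injective f hmono.injective
  simp at this

theorem symGrothendieck_bot {n : ℕ} (x : Fin n → R) : symGrothendieck ⊥ ⊥ x = 1 := by
  classical
  have : IsEmpty {c // c ∈ (⊥ : YoungDiagram).cells \ (⊥ : YoungDiagram).cells} :=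
    ⟨fun c => by simpa using c.2⟩
  unfold symGrothendieck
  rw [Finset.sum_eq_single_of_mem (fun _ => ∅)]
  · simp
  · refine Finset.mem_filter.2 ⟨Finset.mem_univ _, fun c => isEmptyElim c, fun c => isEmptyElim c,
      fun c => isEmptyElim c⟩
  · intro T _ hT
    exact absurd (Subsingleton.elim _ _) hT

theorem map_symGrothendieck {S : Type*} [CommRing S] (φ : R →+* S) (lam rho : YoungDiagram)
    {n : ℕ} (x : Fin n → R) :
    φ (symGrothendieck lam rho x) = symGrothendieck lam rho (fun i => φ (x i)) := by
  simp only [symGrothendieck, map_sum, map_prod]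

end SetValued

/-! ### The bialternant formula -/

section Columns

/-- The Young diagram whose first `n` columns have the prescribed lengths. -/
def ofColumns (f : ℕ → ℕ) (hf : Antitone f) (n : ℕ) : YoungDiagram where
  cells := (Finset.range (f 0) ×ˢ Finset.range n).filter fun c => c.1 < f c.2
  isLowerSet := by
    rintro ⟨i, j⟩ ⟨i', j'⟩ ⟨hi, hj⟩ h
    simp only [Finset.coe_filter, Finset.mem_product, Finset.mem_range,
      Set.mem_ofPred_eq] at h ⊢
    have := hf hj
    exact ⟨⟨lt_of_le_of_lt hi h.1.1, lt_of_le_of_lt hj h.1.2⟩, by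
      have h1 : i' ≤ i := hi
      have h2 : f j ≤ f j' := hf hj
      omega⟩

theorem colLen_ofColumns (f : ℕ → ℕ) (hf : Antitone f) (n : ℕ) (hn : f n = 0) (j : ℕ) :
    (ofColumns f hf n).colLen j = f j := by
  refine eq_of_forall_lt_iff fun i => ?_
  rw [← YoungDiagram.mem_iff_lt_colLen, ← YoungDiagram.mem_cells]
  simp only [ofColumns, Finset.mem_filter, Finset.mem_product, Finset.mem_range]
  refine ⟨fun h => h.2, fun h => ⟨⟨h.trans_le (hf (Nat.zero_le j)), ?_⟩, h⟩⟩
  by_contra hj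
  have := hf (not_lt.1 hj)
  omega

theorem le_iff_colLen {mu lam : YoungDiagram} : mu ≤ lam ↔ ∀ j, mu.colLen j ≤ lam.colLen j := by
  constructor
  · intro h j
    refine le_of_forall_lt fun i hi => ?_
    exact YoungDiagram.mem_iff_lt_colLen.1 (h (YoungDiagram.mem_iff_lt_colLen.2 hi))
  · rintro h ⟨i, j⟩ hc
    exact YoungDiagram.mem_iff_lt_colLen.2 ((YoungDiagram.mem_iff_lt_colLen.1 hc).trans_le (h j))

theorem eq_of_colLen_eq {mu lam : YoungDiagram} (h : ∀ j, mu.colLen j = lam.colLen j) :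
    mu = lam :=
  le_antisymm (le_iff_colLen.2 fun j => (h j).le) (le_iff_colLen.2 fun j => (h j).ge)

theorem colLen_eq_zero_of_le {lam : YoungDiagram} {n j : ℕ} (h : lam.colLen n = 0) (hj : n ≤ j) :
    lam.colLen j = 0 :=
  Nat.le_zero.1 (h ▸ lam.colLen_anti n j hj)

theorem mem_sdiff_cells {lam rho : YoungDiagram} {c : ℕ × ℕ} :
    c ∈ lam.cells \ rho.cells ↔ c.1 < lam.colLen c.2 ∧ rho.colLen c.2 ≤ c.1 := by
  rw [Finset.mem_sdiff, YoungDiagram.mem_cells, YoungDiagram.mem_cells, ← not_lt]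
  obtain ⟨i, j⟩ := c
  rw [YoungDiagram.mem_iff_lt_colLen, YoungDiagram.mem_iff_lt_colLen]

theorem card_sdiff_cells (lam rho : YoungDiagram) {n : ℕ} (hn : lam.colLen n = 0) :
    (lam.cells \ rho.cells).card = ∑ j : Fin n, (lam.colLen j - rho.colLen j) := by
  have hmaps : Set.MapsTo Prod.snd ((lam.cells \ rho.cells : Finset (ℕ × ℕ)) : Set (ℕ × ℕ))
      (Finset.range n : Finset ℕ) := by
    rintro c hc
    have h1 := (mem_sdiff_cells.1 (Finset.mem_coe.1 hc)).1
    rw [Finset.mem_coe, Finset.mem_range]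
    by_contra hj
    have := colLen_eq_zero_of_le hn (not_lt.1 hj)
    omega
  rw [Finset.card_eq_sum_card_fiberwise hmaps,
    Fin.sum_univ_eq_sum_range (fun j => lam.colLen j - rho.colLen j)]
  refine Finset.sum_congr rfl fun j _ => ?_
  have : (lam.cells \ rho.cells).filter (fun c => c.2 = j) =
      Finset.Ico (rho.colLen j) (lam.colLen j) ×ˢ {j} := by
    ext ⟨i, j'⟩
    rw [Finset.mem_filter, mem_sdiff_cells, Finset.mem_product, Finset.mem_Ico,
      Finset.mem_singleton]
    constructor
    · rintro ⟨⟨h1, h2⟩, rfl⟩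
      exact ⟨⟨h2, h1⟩, rfl⟩
    · rintro ⟨⟨h1, h2⟩, rfl⟩
      exact ⟨⟨h2, h1⟩, rfl⟩
  rw [this, Finset.card_product, Nat.card_Ico, Finset.card_singleton, mul_one]

/-- `lam / rho` has at most one box in each row if and only if the columns interlace. -/
theorem row_injective_iff {lam rho : YoungDiagram} :
    (∀ c ∈ lam.cells \ rho.cells, ∀ d ∈ lam.cells \ rho.cells, c.1 = d.1 → c = d) ↔
      ∀ j, lam.colLen (j + 1) ≤ rho.colLen j := by
  constructor
  · intro h j
    by_contra hlt
    push Not at hlt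
    have h1 : ((rho.colLen j, j) : ℕ × ℕ) ∈ lam.cells \ rho.cells :=
      mem_sdiff_cells.2 ⟨hlt.trans_le (lam.colLen_anti _ _ (Nat.le_succ j)), le_rfl⟩
    have h2 : ((rho.colLen j, j + 1) : ℕ × ℕ) ∈ lam.cells \ rho.cells :=
      mem_sdiff_cells.2 ⟨hlt, rho.colLen_anti _ _ (Nat.le_succ j)⟩
    simpa using h _ h1 _ h2 rfl
  · have key : (∀ j, lam.colLen (j + 1) ≤ rho.colLen j) → ∀ i j j', j < j' →
        (i, j) ∈ lam.cells \ rho.cells → (i, j') ∈ lam.cells \ rho.cells → False := by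
      intro h i j j' hj h1 h2
      have h3 := (mem_sdiff_cells.1 h1).2
      have h4 := (mem_sdiff_cells.1 h2).1
      have h5 := h j
      have h6 := lam.colLen_anti (j + 1) j' hj
      simp only at h3 h4
      omega
    rintro h ⟨i, j⟩ hc ⟨i', j'⟩ hd (rfl : i = i')
    rcases lt_trichotomy j j' with hj | rfl | hj
    · exact (key h i j j' hj hc hd).elim
    · rfl
    · exact (key h i j' j hj hd hc).elim

/-- If `lam / rho` has at most one box in each row, then `mu / rho` is a rook strip as soon as it
has at most one box in each column. -/
theorem isRookStrip_iff {lam mu rho : YoungDiagram} (hmu : mu ≤ lam)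
    (h : ∀ j, lam.colLen (j + 1) ≤ rho.colLen j) :
    IsRookStrip rho mu ↔
      ∀ j, rho.colLen j ≤ mu.colLen j ∧ mu.colLen j ≤ rho.colLen j + 1 := by
  constructor
  · rintro ⟨h1, h2⟩ j
    refine ⟨le_iff_colLen.1 h1 j, ?_⟩
    by_contra hlt
    push Not at hlt
    have h3 : ((rho.colLen j, j) : ℕ × ℕ) ∈ mu.cells \ rho.cells :=
      mem_sdiff_cells.2 ⟨by simp only; omega, le_rfl⟩
    have h4 : ((rho.colLen j + 1, j) : ℕ × ℕ) ∈ mu.cells \ rho.cells :=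
      mem_sdiff_cells.2 ⟨hlt, Nat.le_succ _⟩
    exact (h2 _ h3 _ h4 (by simp)).2 rfl
  · intro h1
    refine ⟨le_iff_colLen.2 fun j => (h1 j).1, fun c hc d hd hcd => ⟨fun hr => hcd ?_,
      fun hr => hcd ?_⟩⟩
    · have hsub : mu.cells \ rho.cells ⊆ lam.cells \ rho.cells :=
        Finset.sdiff_subset_sdiff (YoungDiagram.cells_subset_iff.2 hmu) le_rfl
      exact row_injective_iff.2 h c (hsub hc) d (hsub hd) hr
    · have h2 := mem_sdiff_cells.1 hc
      have h3 := mem_sdiff_cells.1 hd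
      have h4 := h1 c.2
      rw [← hr] at h3
      exact Prod.ext (by omega) hr

end Columns

section Bialternant

variable {R : Type*} [CommRing R]

/-- The Vandermonde product, with the larger index subtracted. -/
def vandermondeProd {n : ℕ} (x : Fin n → R) : R :=
  ∏ i, ∏ j, if i < j then x i - x j else 1

theorem vandermondeProd_succ {n : ℕ} (x : Fin (n + 1) → R) :
    vandermondeProd x =
      vandermondeProd (fun i : Fin n => x i.castSucc) *
        ∏ i : Fin n, (x i.castSucc - x (Fin.last n)) := by
  simp only [vandermondeProd, Fin.prod_univ_castSucc, Fin.castSucc_lt_castSucc_iff,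
    Fin.castSucc_lt_last, if_true, Finset.prod_mul_distrib]
  have : ∀ i : Fin n, ¬ Fin.last n < i.castSucc := fun i => not_lt.2 (Fin.le_last _)
  simp [this]

theorem vandermondeProd_ne_zero [IsDomain R] {n : ℕ} {x : Fin n → R}
    (hx : Function.Injective x) : vandermondeProd x ≠ 0 := by
  refine Finset.prod_ne_zero_iff.2 fun i _ => Finset.prod_ne_zero_iff.2 fun j _ => ?_
  split_ifs with h
  · exact sub_ne_zero.2 fun hij => h.ne (hx hij)
  · exact one_ne_zero

/-- The alternant with exponents `c_j + n - 1 - j`, twisted by powers of `1 + x_i`. -/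
def columnAlternant {n : ℕ} (c : ℕ → ℕ) (x : Fin n → R) : R :=
  (Matrix.of fun i j : Fin n =>
    x i ^ (c j + (n - 1 - j.val)) * (1 + x i) ^ j.val).det

theorem alternant_eq_columnAlternant {n : ℕ} (c : ℕ → ℕ) (x : Fin n → R) :
    alternant (fun x => weylWeight x * ∏ i, x i ^ c i) x = columnAlternant c x := by
  simp only [alternant, columnAlternant, Matrix.det_apply, Matrix.of_apply, weylWeight,
    Function.comp, ← Finset.prod_mul_distrib]
  refine Finset.sum_congr rfl fun σ _ => ?_
  congr 1
  refine Finset.prod_congr rfl fun i _ => ?_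
  rw [pow_add]
  ring

/-- A determinant whose adjacent columns combine to multiples of `z - t` reduces to a smaller
one. -/
theorem det_reduce {n : ℕ} (P : Fin (n + 1) → R → R) (E : Fin n → R → R) (a : R) (b : Fin n → R)
    (x : Fin (n + 1) → R)
    (h : ∀ j z, (z - x (Fin.last n)) * E j z = a * P j.castSucc z - b j * P j.succ z) :
    a ^ n * (Matrix.of fun i j => P j (x i)).det =
      P (Fin.last n) (x (Fin.last n)) * ((∏ i : Fin n, (x i.castSucc - x (Fin.last n))) *
        (Matrix.of fun i j : Fin n => E j (x i.castSucc)).det) := by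
  -- The column operations, as a lower bidiagonal matrix.
  let L : Matrix (Fin (n + 1)) (Fin (n + 1)) R := Matrix.of fun l j =>
    Fin.lastCases (if l = Fin.last n then 1 else 0)
      (fun j' => (if l = j'.castSucc then a else 0) - if l = j'.succ then b j' else 0) j
  have hL : L.det = a ^ n := by
    rw [Matrix.det_of_isLowerTriangular, Fin.prod_univ_castSucc]
    · simp [L, Fin.ext_iff]
    · intro l j hlj
      have hlj : l < j := hlj
      revert hlj
      refine Fin.lastCases (fun hlj => ?_) (fun j' hlj => ?_) j
      · simp [L, hlj.ne]
      · have h1 : l ≠ j'.succ := by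
          intro h; rw [h, Fin.lt_def] at hlj; simp at hlj
        simp [L, hlj.ne, h1]
  have hML1 : ∀ i (j : Fin n), ((Matrix.of fun i j => P j (x i)) * L) i j.castSucc =
      (x i - x (Fin.last n)) * E j (x i) := by
    intro i j
    rw [h, Matrix.mul_apply]
    simp [L, mul_sub, Finset.sum_sub_distrib]
    ring
  have hML2 : ∀ i, ((Matrix.of fun i j => P j (x i)) * L) i (Fin.last n) =
      P (Fin.last n) (x i) := by
    intro i
    rw [Matrix.mul_apply]
    simp [L]
  rw [← hL, mul_comm, ← Matrix.det_mul, Matrix.det_succ_row _ (Fin.last n),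
    Fin.sum_univ_castSucc]
  simp only [hML1, hML2, sub_self, zero_mul, mul_zero, Finset.sum_const_zero, zero_add,
    Fin.val_last, ← two_mul, pow_mul, neg_one_sq, one_pow, one_mul]
  congr 1
  rw [← Matrix.det_mul_column]
  congr 1
  ext i j
  simp [Matrix.submatrix_apply, hML1]

/-- The column lengths `(b, e)` of `mu` and `rho`, in a column of `lam` of length `c` followed by
one of length `c'`, for which `lam / rho` has at most one box in each row and `mu / rho` at most
one box in each column. -/
def stripPairs (c' c : ℕ) : Finset (ℕ × ℕ) :=
  (Finset.range (c - c' + 1)).image (fun i => (c' + i, c' + i)) ∪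
    (Finset.range (c - c')).image (fun i => (c' + i + 1, c' + i))

theorem mem_stripPairs {c' c : ℕ} (h : c' ≤ c) {q : ℕ × ℕ} :
    q ∈ stripPairs c' c ↔ c' ≤ q.2 ∧ q.2 ≤ q.1 ∧ q.1 ≤ q.2 + 1 ∧ q.1 ≤ c := by
  obtain ⟨b, e⟩ := q
  simp only [stripPairs, Finset.mem_union, Finset.mem_image, Finset.mem_range, Prod.mk.injEq]
  constructor
  · rintro (⟨i, hi, rfl, rfl⟩ | ⟨i, hi, rfl, rfl⟩) <;> omega
  · rintro ⟨h1, h2, h3, h4⟩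
    rcases Nat.lt_or_ge e b with hb | hb
    · exact Or.inr ⟨e - c', by omega, by omega, by omega⟩
    · exact Or.inl ⟨e - c', by omega, by omega, by omega⟩

/-- The sum over the possible column lengths in one column is a combination of two adjacent columns
of the alternant, divided by `z - t`. -/
theorem sum_stripPairs {c' c : ℕ} (h : c' ≤ c) (z t : R) :
    (z - t) * ∑ q ∈ stripPairs c' c, t ^ (c - q.2) * z ^ q.1 =
      (1 + t) * z ^ (c + 1) - t ^ (c - c' + 1) * (z ^ c' * (1 + z)) := by
  obtain ⟨r, rfl⟩ := Nat.exists_eq_add_of_le h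
  unfold stripPairs
  rw [Finset.sum_union, Finset.sum_image, Finset.sum_image]
  · have e1 : ∑ i ∈ Finset.range (c' + r - c' + 1), t ^ (c' + r - (c' + i)) * z ^ (c' + i) =
        z ^ c' * ∑ i ∈ Finset.range (r + 1), z ^ i * t ^ (r + 1 - 1 - i) := by
      rw [Finset.mul_sum, Nat.add_sub_cancel_left]
      refine Finset.sum_congr rfl fun i _ => ?_
      rw [Nat.add_sub_add_left, Nat.add_sub_cancel, pow_add]
      ring
    have e2 : ∑ i ∈ Finset.range (c' + r - c'), t ^ (c' + r - (c' + i)) * z ^ (c' + i + 1) =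
        z ^ (c' + 1) * t * ∑ i ∈ Finset.range r, z ^ i * t ^ (r - 1 - i) := by
      rw [Finset.mul_sum, Nat.add_sub_cancel_left]
      refine Finset.sum_congr rfl fun i hi => ?_
      have : r - i = (r - 1 - i) + 1 := by
        have := Finset.mem_range.1 hi
        omega
      rw [Nat.add_sub_add_left, this, pow_succ, pow_add, pow_add]
      ring
    simp only
    rw [e1, e2, Nat.add_sub_cancel_left]
    have g1 := geom_sum₂_mul z t (r + 1)
    have g2 := geom_sum₂_mul z t r
    linear_combination z ^ c' * g1 + z ^ (c' + 1) * t * g2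
  · intro i _ j _ hij
    simpa using hij
  · intro i _ j _ hij
    simpa using hij
  · rw [Finset.disjoint_left]
    rintro ⟨b, e⟩ h1 h2
    simp only [Finset.mem_image, Finset.mem_range, Prod.mk.injEq] at h1 h2
    obtain ⟨i, -, rfl, h1⟩ := h1
    obtain ⟨j, -, h2, h3⟩ := h2
    omega

/-- Multilinearity of the determinant in its columns. -/
theorem det_sum_columns {n : ℕ} {ι : Type*} [DecidableEq ι] (s : Fin n → Finset ι)
    (g : Fin n → ι → Fin n → R) :
    (Matrix.of fun i j => ∑ a ∈ s j, g j a i).det =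
      ∑ r ∈ Fintype.piFinset s, (Matrix.of fun i j => g j (r j) i).det := by
  have h := (Matrix.detRowAlternating (n := Fin n) (R := R)).toMultilinearMap.map_sum_finset g s
  have h2 : ∀ M : Fin n → Fin n → R,
      (Matrix.detRowAlternating (n := Fin n) (R := R)).toMultilinearMap M =
        (Matrix.of fun i j => M j i).det := fun M => by
    rw [← Matrix.det_transpose]
    rfl
  rw [h2] at h
  simp only [h2, Finset.sum_apply] at h
  exact h

/-- The sum over the pairs `rho ⊆ mu` of the coproduct formula with one variable in the second
alphabet, in terms of column lengths. -/
theorem sum_one_variable {lam : YoungDiagram} {n : ℕ} (hlam : lam.colLen (n + 1) = 0) (t : R)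
    (f : YoungDiagram → R) (F : (Fin n → ℕ) → R)
    (hf : ∀ mu : YoungDiagram, mu.colLen n = 0 → f mu = F fun j => mu.colLen j)
    (hf0 : ∀ mu : YoungDiagram, mu.colLen n ≠ 0 → f mu = 0) :
    ∑ mu ∈ subdiagrams lam, ∑ rho ∈ (subdiagrams mu).filter (fun rho => IsRookStrip rho mu),
        f mu * symGrothendieck lam rho (fun _ : Fin 1 => t) =
      t ^ lam.colLen n * ∑ r ∈ Fintype.piFinset
        (fun j : Fin n => stripPairs (lam.colLen (j + 1)) (lam.colLen j)),
        (∏ j : Fin n, t ^ (lam.colLen j - (r j).2)) * F fun j => (r j).1 := by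
  classical
  have hanti : ∀ j, lam.colLen (j + 1) ≤ lam.colLen j := fun j =>
    lam.colLen_anti _ _ (Nat.le_succ j)
  rw [Finset.sum_sigma']
  -- The pairs with nonzero contribution.
  set good : (Σ _ : YoungDiagram, YoungDiagram) → Prop := fun p =>
    p.1.colLen n = 0 ∧ ∀ j, lam.colLen (j + 1) ≤ p.2.colLen j with hgood
  have hne : ∀ p ∈ (subdiagrams lam).sigma
      fun mu => (subdiagrams mu).filter (fun rho => IsRookStrip rho mu),
      f p.1 * symGrothendieck lam p.2 (fun _ : Fin 1 => t) ≠ 0 → good p := by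
    rintro ⟨mu, rho⟩ _ hp
    refine ⟨by_contra fun h => hp (by rw [hf0 mu h, zero_mul]), ?_⟩
    dsimp only at hp ⊢
    rw [← row_injective_iff]
    by_contra h
    apply hp
    rw [symGrothendieck_one_variable, if_neg h, mul_zero]
  rw [← Finset.sum_filter_of_ne hne, Finset.mul_sum]
  have hspec : ∀ mu rho : YoungDiagram, (⟨mu, rho⟩ : Σ _ : YoungDiagram, YoungDiagram) ∈
      ((subdiagrams lam).sigma
        fun mu => (subdiagrams mu).filter (fun rho => IsRookStrip rho mu)).filter good ↔
      mu.colLen n = 0 ∧ ∀ j, mu.colLen j ≤ lam.colLen j ∧ lam.colLen (j + 1) ≤ rho.colLen j ∧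
        rho.colLen j ≤ mu.colLen j ∧ mu.colLen j ≤ rho.colLen j + 1 := by
    intro mu rho
    simp only [Finset.mem_filter, Finset.mem_sigma, mem_subdiagrams, hgood]
    constructor
    · rintro ⟨⟨h1, h2, h3⟩, h4, h5⟩
      rw [isRookStrip_iff h1 h5] at h3
      exact ⟨h4, fun j => ⟨le_iff_colLen.1 h1 j, h5 j, h3 j⟩⟩
    · rintro ⟨h1, h2⟩
      have h3 : mu ≤ lam := le_iff_colLen.2 fun j => (h2 j).1
      have h4 := (isRookStrip_iff h3 fun j => (h2 j).2.1).2 fun j => (h2 j).2.2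
      exact ⟨⟨h3, h4.1, h4⟩, h1, fun j => (h2 j).2.1⟩
  refine Finset.sum_bij (fun p _ (j : Fin n) => (p.1.colLen j, p.2.colLen j)) ?_ ?_ ?_ ?_
  · rintro ⟨mu, rho⟩ hp
    obtain ⟨-, h⟩ := (hspec mu rho).1 hp
    refine Fintype.mem_piFinset.2 fun j => (mem_stripPairs (hanti j)).2 ?_
    have := h j
    exact ⟨this.2.1, this.2.2.1, this.2.2.2, this.1⟩
  · rintro ⟨mu, rho⟩ hp ⟨mu', rho'⟩ hp' heq
    obtain ⟨h1, h⟩ := (hspec mu rho).1 hp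
    obtain ⟨h1', h'⟩ := (hspec mu' rho').1 hp'
    have hj : ∀ j, mu.colLen j = mu'.colLen j ∧ rho.colLen j = rho'.colLen j := by
      intro j
      rcases Nat.lt_or_ge j n with hj | hj
      · simpa using congrFun heq ⟨j, hj⟩
      · have e1 := colLen_eq_zero_of_le h1 hj
        have e2 := colLen_eq_zero_of_le h1' hj
        have e3 := (h j).2.2.1
        have e4 := (h' j).2.2.1
        omega
    obtain rfl := eq_of_colLen_eq fun j => (hj j).1
    obtain rfl := eq_of_colLen_eq fun j => (hj j).2
    rfl
  · intro r hr
    have hr0 : ∀ j : Fin n, r j ∈ stripPairs (lam.colLen (j + 1)) (lam.colLen j) :=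
      Fintype.mem_piFinset.1 hr
    have hr' := fun j : Fin n => (mem_stripPairs (hanti j.val)).1 (hr0 j)
    let b : ℕ → ℕ := fun j => if h : j < n then (r ⟨j, h⟩).1 else 0
    let e : ℕ → ℕ := fun j => if h : j < n then (r ⟨j, h⟩).2 else 0
    have hb : ∀ j, b j ≤ lam.colLen j ∧ lam.colLen (j + 1) ≤ e j ∧ e j ≤ b j ∧
        b j ≤ e j + 1 := by
      intro j
      by_cases hj : j < n
      · have := hr' ⟨j, hj⟩
        simp only [b, e, hj, dif_pos]
        exact ⟨this.2.2.2, this.1, this.2.1, this.2.2.1⟩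
      · have := colLen_eq_zero_of_le hlam (show n + 1 ≤ j + 1 by omega)
        simp only [b, e, hj, dif_neg, not_false_eq_true]
        omega
    have hbanti : Antitone b := antitone_nat_of_succ_le fun j => by
      have := hb j; have := hb (j + 1); omega
    have heanti : Antitone e := antitone_nat_of_succ_le fun j => by
      have := hb j; have := hb (j + 1); omega
    have hbn : b n = 0 := by simp [b]
    have hen : e n = 0 := by simp [e]
    refine ⟨⟨ofColumns b hbanti n, ofColumns e heanti n⟩, ?_, ?_⟩
    · rw [hspec]
      simp only [colLen_ofColumns b hbanti n hbn, colLen_ofColumns e heanti n hen]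
      exact ⟨hbn, hb⟩
    · funext j
      simp [colLen_ofColumns b hbanti n hbn, colLen_ofColumns e heanti n hen, b, e]
  · rintro ⟨mu, rho⟩ hp
    obtain ⟨h1, h⟩ := (hspec mu rho).1 hp
    have hrn : rho.colLen n = 0 := by have := (h n).2.2.1; omega
    dsimp only
    rw [hf mu h1, symGrothendieck_one_variable, if_pos (row_injective_iff.2 fun j => (h j).2.1),
      card_sdiff_cells lam rho hlam, Fin.sum_univ_castSucc, pow_add, Finset.prod_pow_eq_pow_sum]
    simp only [Fin.val_castSucc, Fin.val_last, hrn, Nat.sub_zero]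
    ring

/-- The bialternant formula for symmetric Grothendieck polynomials, by induction on the number of
variables: the splitting of the alphabet at the last variable corresponds to the expansion of the
determinant after suitable column operations. -/
theorem vandermondeProd_mul_symGrothendieck [IsDomain R] {n : ℕ} (x : Fin n → R)
    (hx : ∀ i, 1 + x i ≠ 0) {lam : YoungDiagram} (hlam : lam.colLen n = 0) :
    vandermondeProd x * symGrothendieck lam ⊥ x = columnAlternant lam.colLen x := by
  induction n generalizing lam with
  | zero =>
    obtain rfl : lam = ⊥ := by
      ext ⟨i, j⟩
      rw [YoungDiagram.mem_cells, YoungDiagram.mem_iff_lt_colLen,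
        colLen_eq_zero_of_le hlam (Nat.zero_le j)]
      simp
    simp [symGrothendieck_bot, vandermondeProd, columnAlternant]
  | succ n ih =>
    set t := x (Fin.last n) with ht
    set y : Fin n → R := fun i => x i.castSucc with hy
    have hxy : x = Fin.append y (fun _ : Fin 1 => t) := by
      funext i
      refine Fin.lastCases ?_ (fun i => ?_) i
      · exact (Fin.append_right y (fun _ : Fin 1 => t) 0).symm
      · exact (Fin.append_left y (fun _ : Fin 1 => t) i).symm
    set E : Fin n → R → R := fun j z =>
      ∑ q ∈ stripPairs (lam.colLen (j + 1)) (lam.colLen j),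
        t ^ (lam.colLen j - q.2) * (z ^ (q.1 + (n - 1 - j)) * (1 + z) ^ j.val) with hE
    have hbranch : vandermondeProd y * symGrothendieck lam ⊥ x =
        t ^ lam.colLen n * (Matrix.of fun i j : Fin n => E j (y i)).det := by
      conv_lhs => rw [hxy, symGrothendieck_append]
      simp only [Finset.mul_sum, ← mul_assoc]
      rw [sum_one_variable hlam t (fun mu => vandermondeProd y * symGrothendieck mu ⊥ y)
        (fun c => (Matrix.of fun i j : Fin n =>
          y i ^ (c j + (n - 1 - j.val)) * (1 + y i) ^ j.val).det) ?_ ?_]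
      · simp only [hE]
        rw [det_sum_columns (fun j : Fin n => stripPairs (lam.colLen (j + 1)) (lam.colLen j))
          fun j q i => t ^ (lam.colLen j - q.2) * (y i ^ (q.1 + (n - 1 - j)) * (1 + y i) ^ j.val)]
        congr 1
        refine Finset.sum_congr rfl fun r _ => ?_
        rw [← Matrix.det_mul_row]
        rfl
      · exact fun mu hmu => ih y (fun i => hx _) hmu
      · intro mu hmu
        rw [symGrothendieck_eq_zero, mul_zero]
        exact YoungDiagram.mem_iff_lt_colLen.2 (Nat.pos_of_ne_zero hmu)
    have hred := det_reduce
      (fun j z => z ^ (lam.colLen j + (n - j.val)) * (1 + z) ^ j.val) E (1 + t)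
      (fun j => t ^ (lam.colLen j - lam.colLen (j + 1) + 1)) x ?_
    · refine mul_left_cancel₀ (pow_ne_zero n (hx (Fin.last n))) ?_
      rw [columnAlternant]
      simp only [Nat.add_sub_cancel, ← ht]
      rw [hred, vandermondeProd_succ, mul_right_comm (vandermondeProd _), hbranch]
      simp only [Fin.val_last, Nat.sub_self, add_zero, ← ht, hy]
      ring
    · intro j z
      have hs := sum_stripPairs (lam.colLen_anti _ _ (Nat.le_succ j.val)) z t
      have hEz : E j z = z ^ (n - 1 - j.val) * (1 + z) ^ j.val *
          ∑ q ∈ stripPairs (lam.colLen (j + 1)) (lam.colLen j),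
            t ^ (lam.colLen j - q.2) * z ^ q.1 := by
        simp only [hE, Finset.mul_sum]
        refine Finset.sum_congr rfl fun q _ => ?_
        rw [pow_add]
        ring
      have hn1 : n - j.val = (n - 1 - j.val) + 1 := by omega
      have hn2 : n - (j.val + 1) = n - 1 - j.val := by omega
      rw [← ht, hEz]
      simp only [Fin.val_castSucc, Fin.val_succ, hn1, hn2]
      rw [pow_add z, pow_succ z, pow_add z, pow_succ (1 + z)]
      rw [pow_succ z] at hs
      linear_combination (z ^ (n - 1 - j.val) * (1 + z) ^ j.val) * hs

end Bialternant

/-! ### Linear independence of the alternants -/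

section Independence

variable {R : Type*} [CommRing R]

theorem eq_one_of_strictAnti {p : ℕ} {a m : Fin p → ℕ} (ha : StrictAnti a) (hm : StrictAnti m)
    {σ : Equiv.Perm (Fin p)} (h : ∀ i, m (σ i) = a i) : σ = 1 := by
  have hmono : StrictMono σ := fun i j hij => by
    have h1 := ha hij
    rw [← h, ← h] at h1
    exact hm.lt_iff_gt.1 h1
  have hw : hmono.orderIsoOfSurjective σ σ.surjective = OrderIso.refl _ := Subsingleton.elim _ _
  refine Equiv.ext fun i => ?_
  exact congrArg (fun e : Fin p ≃o Fin p => e i) hw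

/-- The coefficient of an alternant at a monomial, with decreasing exponents, of at most its lowest
degree.  There the factors `1 + X i` do not contribute. -/
theorem coeff_det_alternant {p : ℕ} {a m : Fin p → ℕ} (ha : StrictAnti a) (hm : StrictAnti m)
    (hsum : ∑ i, m i ≤ ∑ i, a i) :
    MvPolynomial.coeff (Finsupp.equivFunOnFinite.symm m)
      (Matrix.of fun i j : Fin p =>
        (MvPolynomial.X i : MvPolynomial (Fin p) R) ^ a j * (1 + MvPolynomial.X i) ^ j.val).det =
      if a = m then 1 else 0 := by
  classical
  have hterm : ∀ σ : Equiv.Perm (Fin p),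
      MvPolynomial.coeff (Finsupp.equivFunOnFinite.symm m)
        (∏ j, (MvPolynomial.X (σ j) : MvPolynomial (Fin p) R) ^ a j *
          (1 + MvPolynomial.X (σ j)) ^ j.val) = if σ = 1 ∧ a = m then 1 else 0 := by
    intro σ
    have h1 : ∏ j, (MvPolynomial.X (σ j) : MvPolynomial (Fin p) R) ^ a j =
        MvPolynomial.monomial (Finsupp.equivFunOnFinite.symm fun i => a (σ⁻¹ i)) 1 := by
      rw [MvPolynomial.monomial_eq, Finsupp.prod_fintype _ _ (by simp)]
      simp only [map_one, one_mul, Finsupp.equivFunOnFinite_symm_apply_apply]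
      rw [← Equiv.prod_comp σ fun i => (MvPolynomial.X i : MvPolynomial (Fin p) R) ^ a (σ⁻¹ i)]
      simp
    rw [Finset.prod_mul_distrib, h1, MvPolynomial.coeff_monomial_mul']
    have hle : Finsupp.equivFunOnFinite.symm (fun i => a (σ⁻¹ i)) ≤
        Finsupp.equivFunOnFinite.symm m ↔ σ = 1 ∧ a = m := by
      constructor
      · intro h
        have h2 : ∀ i, a (σ⁻¹ i) ≤ m i := fun i => by
          simpa using h i
        have h3 : ∑ i, a (σ⁻¹ i) = ∑ i, a i := Equiv.sum_comp σ⁻¹ a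
        have h4 : ∀ i, a (σ⁻¹ i) = m i := fun i =>
          (Finset.sum_eq_sum_iff_of_le fun i _ => h2 i).1
            (le_antisymm (Finset.sum_le_sum fun i _ => h2 i) (h3 ▸ hsum)) i (Finset.mem_univ i)
        have h5 : ∀ i, m (σ i) = a i := fun i => by rw [← h4]; simp
        have h6 := eq_one_of_strictAnti ha hm h5
        refine ⟨h6, funext fun i => ?_⟩
        rw [← h5, h6]; rfl
      · rintro ⟨rfl, rfl⟩
        exact le_of_eq (by simp)
    by_cases hc : σ = 1 ∧ a = m
    · rw [if_pos (hle.2 hc), if_pos hc]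
      obtain ⟨rfl, rfl⟩ := hc
      simp only [inv_one, Equiv.Perm.one_apply, tsub_self, one_mul]
      rw [← MvPolynomial.constantCoeff_eq]
      simp
    · rw [if_neg (mt hle.1 hc), if_neg hc]
  rw [Matrix.det_apply, MvPolynomial.coeff_sum]
  simp only [Matrix.of_apply, MvPolynomial.coeff_smul, hterm]
  rw [Finset.sum_eq_single 1]
  · simp
  · intro σ _ hσ
    simp [hσ]
  · simp

theorem one_add_X_ne_zero {σ : Type*} [Nontrivial R] (i : σ) :
    (1 + MvPolynomial.X i : MvPolynomial σ R) ≠ 0 := fun h => by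
  have := congrArg MvPolynomial.constantCoeff h
  simp at this

theorem strictAnti_colLen_add (mu : YoungDiagram) (p : ℕ) :
    StrictAnti fun j : Fin p => mu.colLen j + (p - 1 - j.val) := fun i j hij => by
  have h1 := mu.colLen_anti i j (Fin.le_def.1 hij.le)
  have h2 := Fin.lt_def.1 hij
  have h3 := j.2
  simp only
  omega

/-- The symmetric Grothendieck polynomials of the partitions with at most `p` columns are linearly
independent over the coefficient ring. -/
theorem symGrothendieck_linearIndependent [IsDomain R] {p : ℕ} (s : Finset YoungDiagram)
    (hs : ∀ mu ∈ s, mu.colLen p = 0) (h : YoungDiagram → R)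
    (heq : ∑ mu ∈ s, symGrothendieck mu ⊥ (MvPolynomial.X : Fin p → MvPolynomial (Fin p) R) *
      MvPolynomial.C (h mu) = 0) : ∀ mu ∈ s, h mu = 0 := by
  classical
  have heq' : ∑ mu ∈ s, MvPolynomial.C (h mu) *
      columnAlternant mu.colLen (MvPolynomial.X : Fin p → MvPolynomial (Fin p) R) = 0 := by
    rw [← mul_zero (vandermondeProd (MvPolynomial.X : Fin p → MvPolynomial (Fin p) R)), ← heq,
      Finset.mul_sum]
    refine Finset.sum_congr rfl fun mu hmu => ?_
    rw [← vandermondeProd_mul_symGrothendieck _ one_add_X_ne_zero (hs mu hmu)]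
    ring
  by_contra hcon
  push Not at hcon
  obtain ⟨mu₀, hmu₀, hne₀⟩ := hcon
  -- A diagram of minimal size with nonzero coefficient.
  obtain ⟨mu, hmu, hmin⟩ := Finset.exists_min_image (s.filter fun mu => h mu ≠ 0)
    (fun mu => ∑ j : Fin p, mu.colLen j) ⟨mu₀, Finset.mem_filter.2 ⟨hmu₀, hne₀⟩⟩
  obtain ⟨hmus, hmune⟩ := Finset.mem_filter.1 hmu
  have hc := congrArg (MvPolynomial.coeff
    (Finsupp.equivFunOnFinite.symm fun j : Fin p => mu.colLen j + (p - 1 - j.val))) heq'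
  rw [MvPolynomial.coeff_sum, MvPolynomial.coeff_zero] at hc
  rw [Finset.sum_eq_single_of_mem mu hmus] at hc
  · rw [MvPolynomial.coeff_C_mul, columnAlternant, coeff_det_alternant
      (strictAnti_colLen_add mu p) (strictAnti_colLen_add mu p) le_rfl, if_pos rfl, mul_one] at hc
    exact hmune hc
  · intro nu hnu hne
    rw [MvPolynomial.coeff_C_mul]
    by_cases hnu0 : h nu = 0
    · rw [hnu0, zero_mul]
    · rw [columnAlternant, coeff_det_alternant (strictAnti_colLen_add nu p)
        (strictAnti_colLen_add mu p), if_neg, mul_zero]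
      · intro hcol
        refine hne (eq_of_colLen_eq fun j => ?_)
        rcases Nat.lt_or_ge j p with hj | hj
        · simpa using congrFun hcol ⟨j, hj⟩
        · rw [colLen_eq_zero_of_le (hs nu hnu) hj, colLen_eq_zero_of_le (hs mu hmus) hj]
      · rw [Finset.sum_add_distrib, Finset.sum_add_distrib]
        exact Nat.add_le_add_right (hmin nu (Finset.mem_filter.2 ⟨hnu, hnu0⟩)) _

end Independence

/-! ### Reading words of increasing tableaux -/

section Rectangles

variable {A : Type*} [Monoid A]

/-- The product of a rectangular array with `L` rows and `n` columns, read row by row from left to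
right, the bottom row first. -/
def rowReading (v : ℕ → ℕ → A) (L n : ℕ) : A :=
  ((List.range L).reverse.map fun i => ((List.range n).map fun j => v i j).prod).prod

/-- The product of a rectangular array with `L` rows and `n` columns, read column by column from
bottom to top, the left column first. -/
def columnReading (v : ℕ → ℕ → A) (L n : ℕ) : A :=
  ((List.range n).map fun j => ((List.range L).reverse.map fun i => v i j).prod).prod

theorem rowReading_succ (v : ℕ → ℕ → A) (L n : ℕ) :
    rowReading v (L + 1) n = ((List.range n).map fun j => v L j).prod * rowReading v L n := by
  simp [rowReading, List.range_succ]

theorem columnReading_succ (v : ℕ → ℕ → A) (L n : ℕ) :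
    columnReading v L (n + 1) =
      columnReading v L n * ((List.range L).reverse.map fun i => v i n).prod := by
  simp [columnReading, List.range_succ]

/-- The two readings of an array agree if entries in strictly south-east position to each other
commute. -/
theorem rowReading_eq_columnReading {v : ℕ → ℕ → A}
    (h : ∀ i j i' j', i < i' → j < j' → Commute (v i j) (v i' j')) (L n : ℕ) :
    rowReading v L n = columnReading v L n := by
  induction n with
  | zero => simp [rowReading, columnReading]
  | succ n ih =>
    rw [columnReading_succ, ← ih]
    clear ih
    induction L with
    | zero => simp [rowReading]
    | succ L ih =>
      have hc : Commute (v L n) (rowReading v L n) := by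
        refine Commute.symm (Commute.list_prod_left _ _ fun a ha => ?_)
        obtain ⟨i, hi, rfl⟩ := List.mem_map.1 ha
        refine Commute.list_prod_left _ _ fun b hb => ?_
        obtain ⟨j, hj, rfl⟩ := List.mem_map.1 hb
        exact h i j L n (by simpa using hi) (by simpa using hj)
      rw [rowReading_succ, rowReading_succ, ih, List.prod_range_succ]
      simp only [List.range_succ, List.reverse_append, List.reverse_singleton,
        List.singleton_append, List.map_cons, List.prod_cons]
      rw [mul_assoc, ← mul_assoc (v L n), hc.eq]
      simp only [mul_assoc]

/-- Reading in a reversed multiplication is reading of the transposed array. -/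
theorem columnReading_op (v : ℕ → ℕ → A) (L n : ℕ) :
    columnReading (fun i j => MulOpposite.op (v i j)) L n =
      MulOpposite.op (rowReading (fun i j => v j i) n L) := by
  simp only [columnReading, rowReading, MulOpposite.op_list_prod, List.map_map, List.map_reverse,
    Function.comp_def, List.reverse_reverse]

end Rectangles

/-- A filling of a Young diagram by letters `0, …, k - 1` with strictly increasing rows and
columns. -/
structure IncTableau (k : ℕ) where
  shape : YoungDiagram
  entry : {c // c ∈ shape.cells} → Fin k
  row_strict : ∀ c d : {c // c ∈ shape.cells},
    c.1.1 = d.1.1 → c.1.2 < d.1.2 → entry c < entry d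
  col_strict : ∀ c d : {c // c ∈ shape.cells},
    c.1.2 = d.1.2 → c.1.1 < d.1.1 → entry c < entry d

namespace IncTableau

variable {k : ℕ} (T : IncTableau k)

/-- The reading word of an increasing tableau. -/
def word : List (Fin k) := readingWord T.shape T.entry

/-- An increasing tableau is a Hecke tableau for the permutation that its reading word yields. -/
def toHeckeTableau : HeckeTableau (T.word.foldr heckeOp 1) where
  shape := T.shape
  entry := T.entry
  row_strict := T.row_strict
  col_strict := T.col_strict
  hecke_word := rfl

theorem boxed : ∀ c ∈ T.shape.cells, c.1 < k ∧ c.2 < k := T.toHeckeTableau.boxed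

/-- The transposed tableau. -/
def transpose : IncTableau k where
  shape := T.shape.transpose
  entry c := T.entry ⟨c.1.swap, YoungDiagram.mem_transpose.1 c.2⟩
  row_strict _ _ h1 h2 := T.col_strict _ _ h1 h2
  col_strict _ _ h1 h2 := T.row_strict _ _ h1 h2

theorem shape_transpose : T.transpose.shape = T.shape.transpose := rfl

/-- The entry of a box as a natural number, with junk value `0` outside the shape. -/
def val (i j : ℕ) : ℕ := if h : (i, j) ∈ T.shape.cells then (T.entry ⟨(i, j), h⟩).val else 0

theorem ext_val {S T : IncTableau k} (h : S.shape = T.shape)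
    (hv : ∀ i j, (i, j) ∈ S.shape.cells → S.val i j = T.val i j) : S = T := by
  obtain ⟨s, e, h1, h2⟩ := S
  obtain ⟨s', e', h1', h2'⟩ := T
  obtain rfl : s = s' := h
  obtain rfl : e = e' := by
    funext ⟨⟨i, j⟩, hc⟩
    have := hv i j hc
    have hc' : (i, j) ∈ s.cells := hc
    simp only [val] at this
    rw [dif_pos hc', dif_pos hc'] at this
    exact Fin.ext this
  rfl

theorem mem_cells_transpose {i j : ℕ} :
    (i, j) ∈ T.transpose.shape.cells ↔ (j, i) ∈ T.shape.cells :=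
  YoungDiagram.mem_transpose

theorem val_transpose (i j : ℕ) : T.transpose.val i j = T.val j i := by
  by_cases h : (j, i) ∈ T.shape.cells
  · rw [val, val, dif_pos h, dif_pos (T.mem_cells_transpose.2 h)]
    rfl
  · rw [val, val, dif_neg h, dif_neg (mt T.mem_cells_transpose.1 h)]

theorem transpose_transpose : T.transpose.transpose = T :=
  ext_val (by simp [shape_transpose]) fun i j _ => by rw [val_transpose, val_transpose]

theorem mem_cells_iff {i j : ℕ} : (i, j) ∈ T.shape.cells ↔ i < T.shape.colLen j := by
  rw [YoungDiagram.mem_cells, YoungDiagram.mem_iff_lt_colLen]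

theorem val_lt {i j : ℕ} (h : i < T.shape.colLen j) : T.val i j < k := by
  rw [val, dif_pos (T.mem_cells_iff.2 h)]
  exact Fin.isLt _

theorem val_col_strict {i i' j : ℕ} (h : i < i') (h' : i' < T.shape.colLen j) :
    T.val i j < T.val i' j := by
  rw [val, val, dif_pos (T.mem_cells_iff.2 h'), dif_pos (T.mem_cells_iff.2 (h.trans h'))]
  exact T.col_strict _ _ rfl h

theorem val_row_strict {i j j' : ℕ} (h : j < j') (h' : i < T.shape.colLen j') :
    T.val i j < T.val i j' := by
  rw [val, val, dif_pos (T.mem_cells_iff.2 h'),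
    dif_pos (T.mem_cells_iff.2 (h'.trans_le (T.shape.colLen_anti _ _ h.le)))]
  exact T.row_strict _ _ rfl h

theorem val_injOn (j : ℕ) : Set.InjOn (fun i => T.val i j) {i | i < T.shape.colLen j} := by
  intro i hi i' hi' h
  simp only [Set.mem_ofPred_eq] at hi hi' h
  rcases lt_trichotomy i i' with hlt | rfl | hlt
  · exact absurd h (T.val_col_strict hlt hi').ne
  · rfl
  · exact absurd h (T.val_col_strict hlt hi).ne'

/-- The set of entries of the column `j`. -/
def column (j : ℕ) : Finset ℕ := (Finset.range (T.shape.colLen j)).image fun i => T.val i j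

theorem card_column (j : ℕ) : (T.column j).card = T.shape.colLen j := by
  rw [column, Finset.card_image_of_injOn, Finset.card_range]
  intro i hi i' hi'
  exact T.val_injOn j (by simpa using hi) (by simpa using hi')

theorem column_subset (j : ℕ) : T.column j ⊆ Finset.range k := by
  intro a ha
  obtain ⟨i, hi, rfl⟩ := Finset.mem_image.1 ha
  exact Finset.mem_range.2 (T.val_lt (Finset.mem_range.1 hi))

theorem countBelow_column (j a : ℕ) :
    countBelow (T.column j) a =
      ((Finset.range (T.shape.colLen j)).filter fun i => T.val i j < a).card := by
  rw [countBelow, column, Finset.filter_image, Finset.card_image_of_injOn]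
  intro i hi i' hi'
  simp only [Finset.coe_filter, Finset.mem_range, Set.mem_ofPred_eq] at hi hi'
  exact T.val_injOn j hi.1 hi'.1

/-- The entries of a column are determined by the set that they form. -/
theorem countBelow_column_val {i j : ℕ} (h : i < T.shape.colLen j) :
    countBelow (T.column j) (T.val i j) = i := by
  rw [countBelow_column]
  have : (Finset.range (T.shape.colLen j)).filter (fun i' => T.val i' j < T.val i j) =
      Finset.range i := by
    ext i'
    simp only [Finset.mem_filter, Finset.mem_range]
    constructor
    · rintro ⟨h1, h2⟩
      by_contra hle
      rcases (not_lt.1 hle).eq_or_lt with rfl | hlt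
      · exact lt_irrefl _ h2
      · exact lt_asymm h2 (T.val_col_strict hlt h1)
    · intro h1
      exact ⟨h1.trans h, T.val_col_strict h1 h⟩
  rw [this, Finset.card_range]

theorem columns_mem {n : ℕ} : (fun j : Fin n => T.column j) ∈ columnTableaux n k := by
  refine mem_columnTableaux.2 ⟨fun j => T.column_subset j, fun j j' hjj a => ?_⟩
  have hlt : j.val < j'.val := by omega
  simp only [countBelow_column]
  refine Finset.card_le_card fun i hi => ?_
  simp only [Finset.mem_filter, Finset.mem_range] at hi ⊢
  exact ⟨hi.1.trans_le (T.shape.colLen_anti _ _ hlt.le),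
    (T.val_row_strict hlt hi.1).trans_le (Nat.lt_succ_iff.1 hi.2)⟩

theorem eq_of_column_eq {S T : IncTableau k} (h : ∀ j, S.column j = T.column j) : S = T := by
  have hlen : ∀ j, S.shape.colLen j = T.shape.colLen j := fun j => by
    rw [← card_column, ← card_column, h]
  refine ext_val (eq_of_colLen_eq hlen) fun i j hij => ?_
  have hi := S.mem_cells_iff.1 hij
  have hi' := hi
  rw [hlen] at hi'
  have h1 := S.countBelow_column_val hi
  have h2 := T.countBelow_column_val hi'
  rw [h] at h1
  have hS : S.val i j ∈ T.column j := h j ▸ Finset.mem_image.2 ⟨i, by simpa using hi, rfl⟩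
  obtain ⟨i', hi'', h3⟩ := Finset.mem_image.1 hS
  rw [← h3, T.countBelow_column_val (Finset.mem_range.1 hi'')] at h1
  rw [← h3, h1]

theorem countBelow_eq_count (H : Finset ℕ) (a : ℕ) : countBelow H a = Nat.count (· ∈ H) a := by
  rw [Nat.count_eq_card_filter_range, countBelow]
  congr 1
  ext b
  simp [and_comm]

/-- Every column tuple comes from an increasing tableau. -/
theorem exists_of_mem_columnTableaux {n : ℕ} {H : Fin n → Finset ℕ}
    (hH : H ∈ columnTableaux n k) :
    ∃ T : IncTableau k, T.shape.colLen n = 0 ∧ ∀ j : Fin n, T.column j = H j := by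
  obtain ⟨hsub, htab⟩ := mem_columnTableaux.1 hH
  -- The columns, and their lengths, continued by empty columns.
  let f : ℕ → ℕ := fun j => if h : j < n then (H ⟨j, h⟩).card else 0
  let K : ℕ → Finset ℕ := fun j => if h : j < n then H ⟨j, h⟩ else ∅
  have hf : Antitone f := antitone_nat_of_succ_le fun j => by
    by_cases h : j + 1 < n
    · have h' : j < n := by omega
      simp only [f, h, h', dif_pos]
      exact card_le_of_columnTableau hH rfl
    · simp [f, h]
  have hfn : f n = 0 := by simp [f]
  have hfK : ∀ j, (K j).card = f j := fun j => by
    by_cases h : j < n <;> simp [f, K, h]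
  have hcol := colLen_ofColumns f hf n hfn
  have hfin : ∀ j (hf : (Set.ofPred (· ∈ K j)).Finite), hf.toFinset.card = (K j).card := by
    intro j hf
    congr 1
    ext a
    simp
  have hfin' : ∀ j, (Set.ofPred (· ∈ K j)).Finite := fun j => (K j).finite_toSet
  have hmem : ∀ i j, i < f j → Nat.nth (· ∈ K j) i ∈ K j := fun i j h =>
    Nat.nth_mem_of_lt_card (hfin' j) (by rw [hfin, hfK]; exact h)
  have hcount : ∀ i j, i < f j → countBelow (K j) (Nat.nth (· ∈ K j) i) = i := fun i j h => by
    rw [countBelow_eq_count]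
    exact Nat.count_nth fun hf => by rw [hfin, hfK]; exact h
  have hltk : ∀ j, ∀ a ∈ K j, a < k := fun j a ha => by
    by_cases h : j < n
    · simp only [K, h, dif_pos] at ha
      exact Finset.mem_range.1 (hsub _ ha)
    · simp [K, h] at ha
  have hKtab : ∀ j i, countBelow (K (j + 1)) (i + 1) ≤ countBelow (K j) i := by
    intro j i
    by_cases h : j + 1 < n
    · have h' : j < n := by omega
      simp only [K, h, h', dif_pos]
      exact htab _ _ rfl i
    · simp [K, h, countBelow]
  have hrow1 : ∀ i j, i < f (j + 1) → Nat.nth (· ∈ K j) i < Nat.nth (· ∈ K (j + 1)) i := by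
    intro i j h
    by_contra hle
    have h1 := hKtab j (Nat.nth (· ∈ K (j + 1)) i)
    have h2 := countBelow_mono (K j) (not_lt.1 hle)
    rw [hcount i j (h.trans_le (hf (Nat.le_succ j)))] at h2
    have h3 : i + 1 ≤ countBelow (K (j + 1)) (Nat.nth (· ∈ K (j + 1)) i + 1) := by
      rw [countBelow_eq_count, Nat.count_succ, if_pos (hmem i (j + 1) h), ← countBelow_eq_count,
        hcount i (j + 1) h]
    omega
  have hrow : ∀ i j j', j < j' → i < f j' → Nat.nth (· ∈ K j) i < Nat.nth (· ∈ K j') i := by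
    intro i j j' hjj
    induction j', hjj using Nat.le_induction with
    | base => exact hrow1 i j
    | succ j' _ ih =>
      intro h
      exact (ih (h.trans_le (hf (Nat.le_succ j')))).trans (hrow1 i j' h)
  have hc : ∀ c ∈ (ofColumns f hf n).cells, c.1 < f c.2 := fun c hc => by
    rw [← hcol, ← YoungDiagram.mem_iff_lt_colLen]
    exact hc
  -- The entry in row `i` of the column `j` is the `i`-th smallest element of `K j`.
  let T : IncTableau k :=
    { shape := ofColumns f hf n
      entry := fun c => ⟨Nat.nth (· ∈ K c.1.2) c.1.1, hltk _ _ (hmem _ _ (hc c.1 c.2))⟩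
      row_strict := by
        rintro ⟨⟨i, j⟩, hij⟩ ⟨⟨i', j'⟩, hij'⟩ (rfl : i = i') h2
        exact hrow i j j' h2 (hc _ hij')
      col_strict := by
        rintro ⟨⟨i, j⟩, hij⟩ ⟨⟨i', j'⟩, hij'⟩ (rfl : j = j') h2
        exact Nat.nth_lt_nth' h2 fun hf => by
          rw [hfin, hfK]
          exact hc _ hij' }
  refine ⟨T, by rw [← hfn, ← hcol], fun j => ?_⟩
  have hKj : K j = H j := by simp [K]
  rw [← hKj]
  have hval : ∀ i < f j, T.val i j = Nat.nth (· ∈ K j) i := by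
    intro i hi
    rw [val, dif_pos (T.mem_cells_iff.2 (by
      rw [show T.shape = ofColumns f hf n from rfl, hcol]; exact hi))]
  refine Finset.eq_of_subset_of_card_le ?_ ?_
  · intro a ha
    obtain ⟨i, hi, rfl⟩ := Finset.mem_image.1 ha
    have hi' : i < f j := by
      rw [← hcol]; exact Finset.mem_range.1 hi
    rw [hval i hi']
    exact hmem i j hi'
  · rw [card_column, hfK, ← hcol]

instance : Finite (IncTableau k) := by
  refine Finite.of_injective
    (fun T : IncTableau k => (⟨_, T.toHeckeTableau⟩ : Σ ω : Equiv.Perm (Fin (k + 1)),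
      HeckeTableau ω)) ?_
  intro S T h
  have h1 : S.shape = T.shape := congrArg (fun p => p.2.shape) h
  have h2 : ∀ p q : (Σ ω : Equiv.Perm (Fin (k + 1)), HeckeTableau ω), p = q → ∀ i j,
      (if h : (i, j) ∈ p.2.shape.cells then (p.2.entry ⟨(i, j), h⟩).val else 0) =
      if h : (i, j) ∈ q.2.shape.cells then (q.2.entry ⟨(i, j), h⟩).val else 0 := by
    rintro p q rfl i j
    rfl
  exact ext_val h1 fun i j _ => h2 _ _ h i j

noncomputable instance : Fintype (IncTableau k) := Fintype.ofFinite _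

variable {A : Type*} [Monoid A]

/-- The product of the generators along the reading word. -/
def wordProd (u : ℕ → A) : A := (T.word.map fun a => u a.val).prod

/-- The array of generators of a tableau, padded by ones. -/
def array (u : ℕ → A) (i j : ℕ) : A := if (i, j) ∈ T.shape.cells then u (T.val i j) else 1

theorem wordProd_eq_rowReading (u : ℕ → A) {n : ℕ} (hn : T.shape.colLen n = 0) :
    T.wordProd u = rowReading (T.array u) (T.shape.colLen 0) n := by
  have hrow : ∀ i, T.shape.rowLen i ≤ n := fun i => by
    by_contra hlt
    have := YoungDiagram.mem_iff_lt_colLen.1 (YoungDiagram.mem_iff_lt_rowLen.2 (not_le.1 hlt))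
    omega
  rw [wordProd, word, readingWord, List.map_flatMap, List.flatMap_def, List.prod_flatten,
    List.map_map, rowReading]
  congr 1
  refine List.map_congr_left fun i _ => ?_
  simp only [Function.comp]
  obtain ⟨r, hr⟩ := Nat.exists_eq_add_of_le (hrow i)
  rw [hr, List.range_add, List.map_append, List.prod_append]
  have h1 : (((List.range r).map fun x => T.shape.rowLen i + x).map
      fun j => T.array u i j).prod = 1 := by
    refine List.prod_eq_one fun a ha => ?_
    obtain ⟨j, hj, rfl⟩ := List.mem_map.1 ha
    obtain ⟨x, -, rfl⟩ := List.mem_map.1 hj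
    rw [array, if_neg]
    rw [YoungDiagram.mem_cells, YoungDiagram.mem_iff_lt_rowLen]
    omega
  rw [h1, mul_one, ← List.map_coe_finRange_eq_range, List.map_map, List.map_map]
  congr 1
  refine List.map_congr_left fun j _ => ?_
  have hmem : (i, j.val) ∈ T.shape.cells :=
    (YoungDiagram.mem_cells _).2 (YoungDiagram.mem_iff_lt_rowLen.2 j.isLt)
  simp only [Function.comp, array, val, if_pos hmem, dif_pos hmem]

theorem array_transpose (u : ℕ → A) (i j : ℕ) : T.transpose.array u i j = T.array u j i := by
  simp only [array, mem_cells_transpose, val_transpose]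

end IncTableau

section Cauchy

variable {A : Type*} [Ring A]

theorem columnProd_of_subset (u : ℕ → A) {H : Finset ℕ} {a k : ℕ} (h : H ⊆ Finset.range a)
    (hak : a ≤ k) : columnProd u H k = columnProd u H a := by
  induction k, hak using Nat.le_induction with
  | base => rfl
  | succ k hk ih =>
    have : k ∉ H := fun hkH => by
      have := Finset.mem_range.1 (h hkH)
      omega
    rw [columnProd, if_neg this, one_mul, ih]

theorem columnProd_insert (u : ℕ → A) {H : Finset ℕ} {a k : ℕ} (h : H ⊆ Finset.range a)
    (hak : a < k) : columnProd u (insert a H) k = u a * columnProd u H k := by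
  have hsub : insert a H ⊆ Finset.range (a + 1) := by
    intro b hb
    rcases Finset.mem_insert.1 hb with rfl | hb
    · simp
    · have := Finset.mem_range.1 (h hb)
      simp only [Finset.mem_range]; omega
  rw [columnProd_of_subset u hsub hak, columnProd, if_pos (Finset.mem_insert_self _ _),
    columnProd_of_subset u h hak.le]
  congr 1
  exact columnProd_congr u fun i hi => by simp [hi.ne]

theorem IncTableau.columnProd_column {k : ℕ} (T : IncTableau k) (u : ℕ → A) (j : ℕ) {L : ℕ}
    (hL : T.shape.colLen j ≤ L) :
    columnProd u (T.column j) k = ((List.range L).reverse.map fun i => T.array u i j).prod := by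
  have key : ∀ l ≤ T.shape.colLen j,
      columnProd u ((Finset.range l).image fun i => T.val i j) k =
        ((List.range l).reverse.map fun i => T.array u i j).prod := by
    intro l
    induction l with
    | zero =>
      intro _
      rw [columnProd_of_subset u (a := 0) (by simp) (Nat.zero_le k)]
      simp [columnProd]
    | succ l ih =>
      intro hl
      have hsub : ((Finset.range l).image fun i => T.val i j) ⊆ Finset.range (T.val l j) := by
        intro a ha
        obtain ⟨i, hi, rfl⟩ := Finset.mem_image.1 ha
        exact Finset.mem_range.2 (T.val_col_strict (Finset.mem_range.1 hi) hl)
      rw [Finset.range_add_one, Finset.image_insert, columnProd_insert u hsub (T.val_lt hl),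
        ih (by omega), List.range_succ, List.reverse_append, List.reverse_singleton,
        List.singleton_append, List.map_cons, List.prod_cons, IncTableau.array,
        if_pos (T.mem_cells_iff.2 hl)]
  rw [IncTableau.column, key _ le_rfl]
  obtain ⟨r, rfl⟩ := Nat.exists_eq_add_of_le hL
  rw [List.range_add, List.reverse_append, List.map_append, List.prod_append]
  have h1 : (((List.range r).map fun x => T.shape.colLen j + x).reverse.map
      fun i => T.array u i j).prod = 1 := by
    refine List.prod_eq_one fun a ha => ?_
    obtain ⟨i, hi, rfl⟩ := List.mem_map.1 ha
    obtain ⟨x, -, rfl⟩ := List.mem_map.1 (List.mem_reverse.1 hi)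
    rw [IncTableau.array, if_neg]
    rw [T.mem_cells_iff]
    omega
  rw [h1, one_mul]

theorem IncTableau.prod_columnProd {k : ℕ} (T : IncTableau k) (u : ℕ → A) {L : ℕ}
    (hL : T.shape.colLen 0 ≤ L) (n : ℕ) :
    (List.ofFn fun j : Fin n => columnProd u (T.column j) k).prod =
      columnReading (T.array u) L n := by
  rw [columnReading, List.ofFn_eq_map, ← List.map_coe_finRange_eq_range (n := n), List.map_map]
  congr 1
  refine List.map_congr_left fun j _ => ?_
  exact T.columnProd_column u j ((T.shape.colLen_anti 0 j (Nat.zero_le _)).trans hL)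

theorem IncTableau.commute_array {k : ℕ} (T : IncTableau k) {u : ℕ → A} (hu : IsHeckeFamily u)
    {i j i' j' : ℕ} (hi : i < i') (hj : j < j') :
    Commute (T.array u i j) (T.array u i' j') := by
  unfold IncTableau.array
  by_cases h' : (i', j') ∈ T.shape.cells
  · by_cases h : (i, j) ∈ T.shape.cells
    · rw [if_pos h, if_pos h']
      rw [T.mem_cells_iff] at h'
      have h1 := T.val_row_strict hj (hi.trans h')
      have h2 := T.val_col_strict hi h'
      exact hu.comm _ _ (by omega)
    · rw [if_neg h]; exact Commute.one_left _
  · rw [if_neg h']; exact Commute.one_right _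

/-- The row and column reading words of an increasing tableau yield the same product. -/
theorem IncTableau.wordProd_eq {k : ℕ} (T : IncTableau k) {u : ℕ → A} (hu : IsHeckeFamily u)
    {n : ℕ} (hn : T.shape.colLen n = 0) :
    T.wordProd u = (List.ofFn fun j : Fin n => columnProd u (T.column j) k).prod := by
  rw [T.prod_columnProd u le_rfl, T.wordProd_eq_rowReading u hn,
    rowReading_eq_columnReading fun i j i' j' hi hj => T.commute_array hu hi hj]

/-- Transposing a tableau reverses its word, up to commutations. -/
theorem IncTableau.wordProd_op {k : ℕ} (T : IncTableau k) {u : ℕ → A} (hu : IsHeckeFamily u) :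
    T.wordProd (fun i => MulOpposite.op (u i)) = MulOpposite.op (T.transpose.wordProd u) := by
  have h0 : T.shape.colLen (T.shape.rowLen 0) = 0 := by
    by_contra h
    have := YoungDiagram.mem_iff_lt_rowLen.1
      (YoungDiagram.mem_iff_lt_colLen.2 (Nat.pos_of_ne_zero h))
    exact lt_irrefl _ this
  have h1 : T.transpose.shape.colLen (T.shape.colLen 0) = 0 := by
    by_contra h
    have h2 := YoungDiagram.mem_transpose.1
      (YoungDiagram.mem_iff_lt_colLen.2 (Nat.pos_of_ne_zero h))
    exact lt_irrefl _ (YoungDiagram.mem_iff_lt_colLen.1 h2)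
  have h2 : T.transpose.shape.colLen 0 = T.shape.rowLen 0 := YoungDiagram.colLen_transpose _ _
  rw [T.wordProd_eq hu.op h0, T.prod_columnProd _ le_rfl, T.transpose.wordProd_eq_rowReading u h1,
    h2]
  have h3 : T.array (fun i => MulOpposite.op (u i)) =
      fun i j => MulOpposite.op (T.array u i j) := by
    funext i j
    unfold IncTableau.array
    split_ifs <;> rfl
  rw [h3, columnReading_op]
  congr 2
  funext i j
  exact (T.array_transpose u i j).symm

variable {R : Type*} [CommRing R] [IsDomain R] [Algebra R A] {u : ℕ → A} {n : ℕ}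

/-- The Cauchy identity: the commuting decreasing products in the variables `x_i` multiply to the
sum, over all increasing tableaux, of the symmetric Grothendieck polynomial of the shape times the
product along the reading word. -/
theorem IsHeckeFamily.cauchy (hu : IsHeckeFamily u) (k : ℕ) {x : Fin n → R}
    (hx : ∀ i, 1 + x i ≠ 0) :
    vandermondeProd x • (List.ofFn fun i => descProd u (x i) k 0).prod =
      vandermondeProd x • ∑ T : IncTableau k, symGrothendieck T.shape ⊥ x • T.wordProd u := by
  classical
  have hV : alternant weylWeight x = vandermondeProd x := by
    have h1 : (⊥ : YoungDiagram).colLen = fun _ => 0 := funext fun j => by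
      by_contra h
      exact YoungDiagram.notMem_bot _ (YoungDiagram.mem_iff_lt_colLen.2 (Nat.pos_of_ne_zero h))
    have h2 := vandermondeProd_mul_symGrothendieck x hx (lam := ⊥) (by rw [h1])
    rw [symGrothendieck_bot, mul_one, ← alternant_eq_columnAlternant, h1] at h2
    rw [h2]
    simp
  rw [← hV, hu.cauchy_alternant, hV, Finset.smul_sum]
  have hzero : ∀ T ∈ (Finset.univ : Finset (IncTableau k)),
      vandermondeProd x • symGrothendieck T.shape ⊥ x • T.wordProd u ≠ 0 →
        T.shape.colLen n = 0 := by
    intro T _ hT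
    by_contra h
    apply hT
    rw [symGrothendieck_eq_zero (YoungDiagram.mem_iff_lt_colLen.2 (Nat.pos_of_ne_zero h)),
      zero_smul, smul_zero]
  rw [← Finset.sum_filter_of_ne hzero]
  symm
  refine Finset.sum_bij (fun T _ (j : Fin n) => T.column j) (fun T _ => T.columns_mem) ?_ ?_ ?_
  · intro S hS T hT h
    refine IncTableau.eq_of_column_eq fun j => ?_
    rcases Nat.lt_or_ge j n with hj | hj
    · exact congrFun h ⟨j, hj⟩
    · have h1 := colLen_eq_zero_of_le (Finset.mem_filter.1 hS).2 hj
      have h2 := colLen_eq_zero_of_le (Finset.mem_filter.1 hT).2 hj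
      rw [IncTableau.column, IncTableau.column, h1, h2]
      rfl
  · intro H hH
    obtain ⟨T, hT, h⟩ := IncTableau.exists_of_mem_columnTableaux hH
    exact ⟨T, Finset.mem_filter.2 ⟨Finset.mem_univ _, hT⟩, funext h⟩
  · intro T hT
    have hn := (Finset.mem_filter.1 hT).2
    rw [T.wordProd_eq hu hn, smul_smul, vandermondeProd_mul_symGrothendieck x hx hn,
      ← alternant_eq_columnAlternant]
    simp only [IncTableau.card_column]

end Cauchy

/-! ### The `0`-Hecke action on permutations -/

section HeckeOp

variable {N : ℕ}

theorem simpleSwap_inv (i : Fin N) : (simpleSwap i)⁻¹ = simpleSwap i := by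
  simp [simpleSwap]

theorem simpleSwap_castSucc (i : Fin N) : simpleSwap i i.castSucc = i.succ := by
  simp [simpleSwap]

theorem simpleSwap_succ (i : Fin N) : simpleSwap i i.succ = i.castSucc := by
  simp [simpleSwap]

theorem simpleSwap_of_ne {i : Fin N} {a : Fin (N + 1)} (h1 : a ≠ i.castSucc) (h2 : a ≠ i.succ) :
    simpleSwap i a = a := Equiv.swap_apply_of_ne_of_ne h1 h2

theorem inv_simpleSwap_mul (i : Fin N) (w : Equiv.Perm (Fin (N + 1))) (a : Fin (N + 1)) :
    (simpleSwap i * w)⁻¹ a = w⁻¹ (simpleSwap i a) := by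
  rw [mul_inv_rev, simpleSwap_inv, Equiv.Perm.mul_apply]

theorem heckeOp_of_lt {i : Fin N} {w : Equiv.Perm (Fin (N + 1))}
    (h : w⁻¹ i.castSucc < w⁻¹ i.succ) : heckeOp i w = simpleSwap i * w := if_pos h

theorem heckeOp_of_gt {i : Fin N} {w : Equiv.Perm (Fin (N + 1))}
    (h : w⁻¹ i.succ < w⁻¹ i.castSucc) : heckeOp i w = w := if_neg h.le.not_gt

theorem inv_castSucc_ne_inv_succ (i : Fin N) (w : Equiv.Perm (Fin (N + 1))) :
    w⁻¹ i.castSucc ≠ w⁻¹ i.succ := fun h => by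
  have := w⁻¹.injective h
  simp [Fin.ext_iff] at this

theorem heckeOp_heckeOp (i : Fin N) (w : Equiv.Perm (Fin (N + 1))) :
    heckeOp i (heckeOp i w) = heckeOp i w := by
  rcases (inv_castSucc_ne_inv_succ i w).lt_or_gt with h | h
  · rw [heckeOp_of_lt h]
    refine heckeOp_of_gt ?_
    rwa [inv_simpleSwap_mul, inv_simpleSwap_mul, simpleSwap_succ, simpleSwap_castSucc]
  · rw [heckeOp_of_gt h, heckeOp_of_gt h]

theorem simpleSwap_comm {i j : Fin N} (h : i.val + 2 ≤ j.val) :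
    simpleSwap i * simpleSwap j = simpleSwap j * simpleSwap i := by
  refine Equiv.Perm.Disjoint.commute fun a => ?_
  by_cases h1 : a = i.castSucc ∨ a = i.succ
  · refine Or.inr (simpleSwap_of_ne ?_ ?_) <;> rcases h1 with rfl | rfl <;>
      simp only [ne_eq, Fin.ext_iff, Fin.val_castSucc, Fin.val_succ] <;> omega
  · push Not at h1
    exact Or.inl (simpleSwap_of_ne h1.1 h1.2)

theorem heckeOp_comm {i j : Fin N} (h : i.val + 2 ≤ j.val) (w : Equiv.Perm (Fin (N + 1))) :
    heckeOp i (heckeOp j w) = heckeOp j (heckeOp i w) := by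
  have h1 : simpleSwap j i.castSucc = i.castSucc := simpleSwap_of_ne
    (by simp only [ne_eq, Fin.ext_iff, Fin.val_castSucc]; omega)
    (by simp only [ne_eq, Fin.ext_iff, Fin.val_castSucc, Fin.val_succ]; omega)
  have h2 : simpleSwap j i.succ = i.succ := simpleSwap_of_ne
    (by simp only [ne_eq, Fin.ext_iff, Fin.val_castSucc, Fin.val_succ]; omega)
    (by simp only [ne_eq, Fin.ext_iff, Fin.val_succ]; omega)
  have h3 : simpleSwap i j.castSucc = j.castSucc := simpleSwap_of_ne
    (by simp only [ne_eq, Fin.ext_iff, Fin.val_castSucc]; omega)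
    (by simp only [ne_eq, Fin.ext_iff, Fin.val_castSucc, Fin.val_succ]; omega)
  have h4 : simpleSwap i j.succ = j.succ := simpleSwap_of_ne
    (by simp only [ne_eq, Fin.ext_iff, Fin.val_castSucc, Fin.val_succ]; omega)
    (by simp only [ne_eq, Fin.ext_iff, Fin.val_succ]; omega)
  unfold heckeOp
  split_ifs <;> simp_all only [inv_simpleSwap_mul, ← mul_assoc, simpleSwap_comm h]
  tauto

theorem simpleSwap_braid {i j : Fin N} (h : i.val + 1 = j.val) :
    simpleSwap i * simpleSwap j * simpleSwap i = simpleSwap j * simpleSwap i * simpleSwap j := by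
  have hij : i.succ = j.castSucc := by
    simp only [Fin.ext_iff, Fin.val_castSucc, Fin.val_succ]; omega
  have h1 : i.castSucc ≠ j.castSucc := by
    simp only [ne_eq, Fin.ext_iff, Fin.val_castSucc]; omega
  have h2 : i.castSucc ≠ j.succ := by
    simp only [ne_eq, Fin.ext_iff, Fin.val_castSucc, Fin.val_succ]; omega
  have h3 : j.castSucc ≠ j.succ := by
    simp [Fin.ext_iff]
  unfold simpleSwap
  have e1 := Equiv.swap_mul_swap_mul_swap h3.symm h2.symm
  have e2 := Equiv.swap_mul_swap_mul_swap h1 h2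
  rw [hij, e2, Equiv.swap_comm i.castSucc j.castSucc, Equiv.swap_comm j.castSucc j.succ, e1,
    Equiv.swap_comm]

theorem heckeOp_braid {i j : Fin N} (h : i.val + 1 = j.val) (w : Equiv.Perm (Fin (N + 1))) :
    heckeOp i (heckeOp j (heckeOp i w)) = heckeOp j (heckeOp i (heckeOp j w)) := by
  have hij : i.succ = j.castSucc := by
    simp only [Fin.ext_iff, Fin.val_castSucc, Fin.val_succ]; omega
  have h1 : simpleSwap j i.castSucc = i.castSucc := simpleSwap_of_ne
    (by simp only [ne_eq, Fin.ext_iff, Fin.val_castSucc]; omega)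
    (by simp only [ne_eq, Fin.ext_iff, Fin.val_castSucc, Fin.val_succ]; omega)
  have h2 : simpleSwap i j.succ = j.succ := simpleSwap_of_ne
    (by simp only [ne_eq, Fin.ext_iff, Fin.val_castSucc, Fin.val_succ]; omega)
    (by simp only [ne_eq, Fin.ext_iff, Fin.val_succ]; omega)
  have h3 := simpleSwap_castSucc i
  have h4 := simpleSwap_succ i
  have h5 := simpleSwap_castSucc j
  have h6 := simpleSwap_succ j
  have hb : simpleSwap i * (simpleSwap j * (simpleSwap i * w)) =
      simpleSwap j * (simpleSwap i * (simpleSwap j * w)) := by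
    simp only [← mul_assoc, simpleSwap_braid h]
  rw [hij] at h3 h4
  have ne1 := inv_castSucc_ne_inv_succ i w
  have ne2 := inv_castSucc_ne_inv_succ j w
  rw [hij] at ne1
  set a := w⁻¹ i.castSucc with ha
  set b := w⁻¹ j.castSucc with hb'
  set c := w⁻¹ j.succ with hc
  rcases ne1.lt_or_gt with hab | hab <;> rcases ne2.lt_or_gt with hbc | hbc
  · have hac := hab.trans hbc
    simp only [heckeOp, hij, inv_simpleSwap_mul, ← ha, ← hb', ← hc, hab, hbc, hac, h1, h2, h3, h4,
      h5, h6, if_true, hb]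
  · rcases lt_or_ge a c with hac | hac <;>
    simp only [heckeOp, hij, inv_simpleSwap_mul, ← ha, ← hb', ← hc, hab, hbc.not_gt, hac,
      hac.not_gt, h1, h2, h3, h4, h5, if_true, if_false, hab.not_gt]
  · rcases lt_or_ge a c with hac | hac <;>
    simp only [heckeOp, hij, inv_simpleSwap_mul, ← ha, ← hb', ← hc, hab.not_gt, hbc, hac,
      hac.not_gt, h1, h2, h4, h5, h6, if_true, if_false, hbc.not_gt]
  · have hca := hbc.trans hab
    simp only [heckeOp, hij, ← ha, ← hb', ← hc, hab.not_gt, hbc.not_gt, if_false]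

/-- The right-hand analogue of `heckeOp`: interchange the letters in the positions `i` and `i + 1`
if they are in increasing order. -/
def heckeOpRight (i : Fin N) (w : Equiv.Perm (Fin (N + 1))) : Equiv.Perm (Fin (N + 1)) :=
  if w i.castSucc < w i.succ then w * simpleSwap i else w

theorem heckeOpRight_one (i : Fin N) : heckeOpRight i 1 = heckeOp i 1 := by
  simp [heckeOpRight, heckeOp]

/-- Operators on values commute with operators on positions. -/
theorem heckeOp_heckeOpRight (i j : Fin N) (w : Equiv.Perm (Fin (N + 1))) :
    heckeOp i (heckeOpRight j w) = heckeOpRight j (heckeOp i w) := by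
  by_cases hp : w j.castSucc = i.castSucc ∧ w j.succ = i.succ
  · -- Here the left and the right operator both interchange the same two letters.
    have e1 : w⁻¹ i.castSucc = j.castSucc := by rw [← hp.1]; simp
    have e2 : w⁻¹ i.succ = j.succ := by rw [← hp.2]; simp
    have hsw : w * simpleSwap j = simpleSwap i * w := by
      have := Equiv.mul_swap_eq_swap_mul w j.castSucc j.succ
      rwa [hp.1, hp.2] at this
    have hlt : j.castSucc < j.succ := by simp [Fin.lt_def]
    have hlt' : i.castSucc < i.succ := by simp [Fin.lt_def]
    have h1 : heckeOpRight j w = simpleSwap i * w := by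
      rw [heckeOpRight, hp.1, hp.2, if_pos hlt', hsw]
    have h2 : heckeOp i w = simpleSwap i * w := heckeOp_of_lt (by rw [e1, e2]; exact hlt)
    rw [h1, h2, ← h2, heckeOp_heckeOp, h2, heckeOpRight, if_neg]
    simp only [Equiv.Perm.mul_apply, hp.1, hp.2, simpleSwap_castSucc, simpleSwap_succ]
    exact hlt'.le.not_gt
  by_cases hq : w j.castSucc = i.succ ∧ w j.succ = i.castSucc
  · have e1 : w⁻¹ i.castSucc = j.succ := by rw [← hq.2]; simp
    have e2 : w⁻¹ i.succ = j.castSucc := by rw [← hq.1]; simp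
    have hlt : j.castSucc < j.succ := by simp [Fin.lt_def]
    have hlt' : i.castSucc < i.succ := by simp [Fin.lt_def]
    have h1 : heckeOpRight j w = w := by
      rw [heckeOpRight, hq.1, hq.2, if_neg hlt'.le.not_gt]
    have h2 : heckeOp i w = w := heckeOp_of_gt (by rw [e1, e2]; exact hlt)
    rw [h1, h2, h1]
  · have hL : simpleSwap i (w j.castSucc) < simpleSwap i (w j.succ) ↔
        w j.castSucc < w j.succ := by
      constructor
      · intro h
        have := simpleSwap_lt i h (fun hh => hq ?_)
        · rwa [simpleSwap_simpleSwap, simpleSwap_simpleSwap] at this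
        · have e1 := congrArg (simpleSwap i) hh.1
          have e2 := congrArg (simpleSwap i) hh.2
          rw [simpleSwap_simpleSwap, simpleSwap_castSucc] at e1
          rw [simpleSwap_simpleSwap, simpleSwap_succ] at e2
          exact ⟨e1, e2⟩
      · exact fun h => simpleSwap_lt i h hp
    have hinv : ∀ a b, w⁻¹ a = b ↔ w b = a := fun a b => by
      rw [Equiv.Perm.inv_eq_iff_eq]; exact eq_comm
    have hR : simpleSwap j (w⁻¹ i.castSucc) < simpleSwap j (w⁻¹ i.succ) ↔
        w⁻¹ i.castSucc < w⁻¹ i.succ := by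
      constructor
      · intro h
        have := simpleSwap_lt j h (fun hh => hq ?_)
        · rwa [simpleSwap_simpleSwap, simpleSwap_simpleSwap] at this
        · have e1 := congrArg (simpleSwap j) hh.1
          have e2 := congrArg (simpleSwap j) hh.2
          rw [simpleSwap_simpleSwap, simpleSwap_castSucc, hinv] at e1
          rw [simpleSwap_simpleSwap, simpleSwap_succ, hinv] at e2
          exact ⟨e2, e1⟩
      · exact fun h => simpleSwap_lt j h fun hh => hp ⟨(hinv _ _).1 hh.1, (hinv _ _).1 hh.2⟩
    have hinv2 : ∀ a, (w * simpleSwap j)⁻¹ a = simpleSwap j (w⁻¹ a) := fun a => by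
      rw [mul_inv_rev, simpleSwap_inv, Equiv.Perm.mul_apply]
    unfold heckeOp heckeOpRight
    by_cases c1 : w j.castSucc < w j.succ <;> by_cases c2 : w⁻¹ i.castSucc < w⁻¹ i.succ <;>
      simp only [c1, c2, if_true, if_false, hinv2, hR, Equiv.Perm.mul_apply, hL, mul_assoc]

theorem card_inversions_inv (w : Equiv.Perm (Fin (N + 1))) :
    (inversions w⁻¹).card = (inversions w).card := by
  refine Finset.card_bij' (fun p _ => (w⁻¹ p.2, w⁻¹ p.1)) (fun p _ => (w p.2, w p.1)) ?_ ?_ ?_ ?_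
  · rintro ⟨a, b⟩ hp
    rw [mem_inversions] at hp ⊢
    simpa using hp.symm
  · rintro ⟨a, b⟩ hp
    rw [mem_inversions] at hp ⊢
    simpa using hp.symm
  · rintro ⟨a, b⟩ _
    simp
  · rintro ⟨a, b⟩ _
    simp

theorem card_inversions_simpleSwap_mul_of_gt {i : Fin N} {w : Equiv.Perm (Fin (N + 1))}
    (h : w⁻¹ i.succ < w⁻¹ i.castSucc) :
    (inversions (simpleSwap i * w)).card + 1 = (inversions w).card := by
  have := card_inversions_mul w⁻¹ i h
  rwa [card_inversions_inv w, ← card_inversions_inv, mul_inv_rev, inv_inv, simpleSwap_inv] at this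

theorem card_inversions_simpleSwap_mul_of_lt {i : Fin N} {w : Equiv.Perm (Fin (N + 1))}
    (h : w⁻¹ i.castSucc < w⁻¹ i.succ) :
    (inversions (simpleSwap i * w)).card = (inversions w).card + 1 := by
  rw [← card_inversions_simpleSwap_mul_of_gt (i := i) (w := simpleSwap i * w), ← mul_assoc,
    simpleSwap_mul_self, one_mul]
  rwa [inv_simpleSwap_mul, inv_simpleSwap_mul, simpleSwap_succ, simpleSwap_castSucc]

theorem card_inversions_simpleSwap_mul_le (i : Fin N) (w : Equiv.Perm (Fin (N + 1))) :
    (inversions (simpleSwap i * w)).card ≤ (inversions w).card + 1 := by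
  rcases (inv_castSucc_ne_inv_succ i w).lt_or_gt with h | h
  · rw [card_inversions_simpleSwap_mul_of_lt h]
  · have := card_inversions_simpleSwap_mul_of_gt h
    omega

theorem card_inversions_heckeOp_le (i : Fin N) (w : Equiv.Perm (Fin (N + 1))) :
    (inversions (heckeOp i w)).card ≤ (inversions w).card + 1 := by
  unfold heckeOp
  split_ifs
  · exact card_inversions_simpleSwap_mul_le i w
  · exact Nat.le_succ _

theorem card_inversions_one : (inversions (1 : Equiv.Perm (Fin (N + 1)))).card = 0 := by
  rw [Finset.card_eq_zero, Finset.eq_empty_iff_forall_notMem]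
  rintro ⟨a, b⟩ hp
  rw [mem_inversions] at hp
  exact lt_asymm hp.1 hp.2

theorem card_inversions_prod_le (l : List (Fin N)) :
    (inversions (l.map simpleSwap).prod).card ≤ l.length := by
  induction l with
  | nil => simp [card_inversions_one]
  | cons i l ih =>
    rw [List.map_cons, List.prod_cons, List.length_cons]
    exact (card_inversions_simpleSwap_mul_le i _).trans (Nat.succ_le_succ ih)

theorem card_inversions_revPerm :
    (inversions (Fin.revPerm : Equiv.Perm (Fin (N + 1)))).card = ∑ b ∈ Finset.range (N + 1), b := by
  have h1 : inversions (Fin.revPerm : Equiv.Perm (Fin (N + 1))) =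
      Finset.univ.filter fun p => p.1 < p.2 := by
    ext ⟨a, b⟩
    simp [mem_inversions]
  rw [h1, Finset.card_filter, ← Finset.univ_product_univ, Finset.sum_product_right,
    ← Fin.sum_univ_eq_sum_range]
  refine Finset.sum_congr rfl fun b _ => ?_
  rw [← Finset.card_filter]
  have : Finset.univ.filter (fun a => a < b) = Finset.Iio b := by ext; simp
  rw [this, Fin.card_Iio]

/-- The longest permutation is the only one that every operator `heckeOp i` fixes. -/
theorem eq_revPerm_of_heckeOp_eq {w : Equiv.Perm (Fin (N + 1))} (h : ∀ i, heckeOp i w = w) :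
    w = Fin.revPerm := by
  have hanti : StrictAnti (w⁻¹ : Equiv.Perm (Fin (N + 1))) :=
      Fin.strictAnti_iff_succ_lt.2 fun i => by
    rcases (inv_castSucc_ne_inv_succ i w).lt_or_gt with hlt | hgt
    · have h1 := h i
      rw [heckeOp_of_lt hlt] at h1
      have h2 : simpleSwap i = 1 := by simpa using h1
      have h3 := simpleSwap_castSucc i
      rw [h2] at h3
      simp [Fin.ext_iff] at h3
    · exact hgt
  have hmono : StrictMono (w⁻¹ * Fin.revPerm : Equiv.Perm (Fin (N + 1))) := fun a b hab => by
    rw [Equiv.Perm.mul_apply, Equiv.Perm.mul_apply]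
    exact hanti (by simpa using hab)
  have hw : hmono.orderIsoOfSurjective _ (Equiv.surjective _) = OrderIso.refl _ :=
    Subsingleton.elim _ _
  have h1 : w⁻¹ * Fin.revPerm = 1 :=
    Equiv.ext fun a => congrArg (fun e : Fin (N + 1) ≃o Fin (N + 1) => e a) hw
  rw [inv_mul_eq_one] at h1
  exact h1

end HeckeOp

/-! ### The word of the longest permutation -/

section LongWord

variable {A : Type*} [Ring A]

/-- The product `u_d ⋯ u_{d+n-1}`. -/
def rowWord (u : ℕ → A) : ℕ → ℕ → A
  | 0, _ => 1
  | n + 1, d => u d * rowWord u n (d + 1)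

/-- The product of the generators along the factors of `triProd`. -/
def triWord (u : ℕ → A) : ℕ → ℕ → A
  | 0, _ => 1
  | n + 1, d => triWord u n (d + 1) * rowWord u (n + 1) d

theorem rowWord_succ (u : ℕ → A) (n d : ℕ) :
    rowWord u (n + 1) d = rowWord u n d * u (d + n) := by
  induction n generalizing d with
  | zero => simp [rowWord]
  | succ n ih =>
    rw [rowWord, ih, ← mul_assoc, ← rowWord, Nat.add_right_comm d 1 n, Nat.add_assoc]

variable {u : ℕ → A}

theorem IsHeckeFamily.commute_rowWord (hu : IsHeckeFamily u) {i d : ℕ} (n : ℕ) (h : i + 2 ≤ d) :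
    Commute (u i) (rowWord u n d) := by
  induction n generalizing d with
  | zero => exact Commute.one_right _
  | succ n ih => exact (hu.comm i d h).mul_right (ih (by omega))

theorem IsHeckeFamily.commute_triWord (hu : IsHeckeFamily u) {i d : ℕ} (n : ℕ) (h : i + 2 ≤ d) :
    Commute (u i) (triWord u n d) := by
  induction n generalizing d with
  | zero => exact Commute.one_right _
  | succ n ih => exact (ih (by omega)).mul_right (hu.commute_rowWord _ h)

theorem IsHeckeFamily.rowWord_mul (hu : IsHeckeFamily u) {n d j : ℕ} (h1 : d ≤ j)
    (h2 : j < d + n) : rowWord u (n + 1) d * u j = u (j + 1) * rowWord u (n + 1) d := by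
  induction n generalizing d with
  | zero => omega
  | succ n ih =>
    rcases h1.eq_or_lt with rfl | h1
    · have hc := (hu.commute_rowWord n (le_refl (d + 2))).eq
      rw [rowWord, rowWord, mul_assoc, mul_assoc, ← hc]
      simp only [← mul_assoc]
      rw [hu.braid]
    · have hc := (hu.comm d (j + 1) (by omega)).eq
      rw [rowWord, mul_assoc, ih h1 (by omega), ← mul_assoc, hc, mul_assoc]

theorem IsHeckeFamily.rowWord_mul_rowWord (hu : IsHeckeFamily u) {n d : ℕ} (l e : ℕ) (h1 : d ≤ e)
    (h2 : e + l ≤ d + n) :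
    rowWord u (n + 1) d * rowWord u l e = rowWord u l (e + 1) * rowWord u (n + 1) d := by
  induction l generalizing e with
  | zero => simp [rowWord]
  | succ l ih =>
    rw [rowWord.eq_2 u e l, rowWord.eq_2 u (e + 1) l, ← mul_assoc, hu.rowWord_mul h1 (by omega),
      mul_assoc, ih (e + 1) (by omega) (by omega), mul_assoc]

/-- The word of the longest element absorbs all generators. -/
theorem IsHeckeFamily.mul_triWord (hu : IsHeckeFamily u) {n d i : ℕ} (h1 : d ≤ i)
    (h2 : i < d + n) : u i * triWord u n d = triWord u n d := by
  induction n generalizing d with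
  | zero => omega
  | succ n ih =>
    rcases h1.eq_or_lt with rfl | h1
    · have key : u d * (rowWord u n (d + 1) * rowWord u (n + 1) d) =
          rowWord u n (d + 1) * rowWord u (n + 1) d := by
        have h3 := hu.rowWord_mul_rowWord (n := n) n d le_rfl le_rfl
        calc u d * (rowWord u n (d + 1) * rowWord u (n + 1) d)
            = rowWord u (n + 1) d * rowWord u (n + 1) d := by rw [← mul_assoc, ← rowWord]
          _ = rowWord u n (d + 1) * (rowWord u (n + 1) d * u (d + n)) := by
              conv_lhs => rw [rowWord_succ u n d, ← mul_assoc, ← rowWord_succ, h3]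
              rw [mul_assoc]
          _ = _ := by rw [rowWord_succ u n d, mul_assoc, hu.idem]
      cases n with
      | zero => simpa [triWord, rowWord] using key
      | succ n =>
        have hc := (hu.commute_triWord n (le_refl (d + 2))).eq
        rw [triWord, triWord, mul_assoc, ← mul_assoc, hc, mul_assoc, key]
    · rw [triWord, ← mul_assoc, ih h1 (by omega)]

end LongWord

/-! ### The `0`-Hecke algebra acting on the free module on permutations -/

section HeckeGen

variable (R : Type*) [CommRing R] (N : ℕ)

/-- The operator on the free module on `S_{N+1}` that applies `heckeOp i` to the basis; it is zero
when there is no such generator. -/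
noncomputable def heckeGen (i : ℕ) : Module.End R (Equiv.Perm (Fin (N + 1)) →₀ R) :=
  if h : i < N then Finsupp.lmapDomain R R (heckeOp ⟨i, h⟩) else 0

variable {N}

theorem heckeGen_single (i : Fin N) (w : Equiv.Perm (Fin (N + 1))) (r : R) :
    heckeGen R N i (Finsupp.single w r) = Finsupp.single (heckeOp i w) r := by
  rw [heckeGen, dif_pos i.isLt, Finsupp.lmapDomain_apply, Finsupp.mapDomain_single]

theorem heckeGen_of_le {i : ℕ} (h : N ≤ i) : heckeGen R N i = 0 := dif_neg h.not_gt

theorem isHeckeFamily_heckeGen (N : ℕ) : IsHeckeFamily (heckeGen R N) where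
  idem i := by
    rcases Nat.lt_or_ge i N with h | h
    · refine Finsupp.lhom_ext fun w r => ?_
      lift i to Fin N using h
      simp only [Module.End.mul_apply, heckeGen_single, heckeOp_heckeOp]
    · simp [heckeGen_of_le R h]
  comm i j hij := by
    rcases Nat.lt_or_ge j N with h | h
    · refine Finsupp.lhom_ext fun w r => ?_
      have hi : i < N := by omega
      lift i to Fin N using hi
      lift j to Fin N using h
      simp only [Module.End.mul_apply, heckeGen_single, heckeOp_comm hij]
    · rw [heckeGen_of_le R h]; exact Commute.zero_right _
  braid i := by
    rcases Nat.lt_or_ge (i + 1) N with h | h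
    · refine Finsupp.lhom_ext fun w r => ?_
      obtain ⟨j, hj⟩ : ∃ j : Fin N, j.val = i + 1 := ⟨⟨_, h⟩, rfl⟩
      have hi : i < N := by omega
      lift i to Fin N using hi
      rw [← hj]
      simp only [Module.End.mul_apply, heckeGen_single, heckeOp_braid hj.symm]
    · simp [heckeGen_of_le R h]

end HeckeGen

/-! ### Maps intertwining two families of operators -/

section Intertwines

variable {R R' V V' : Type*} [CommRing R] [CommRing R'] [AddCommGroup V] [AddCommGroup V']
  [Module R V] [Module R' V']

/-- A map `L`, semilinear along `φ`, that carries the operators `u i` to the operators `u' i`. -/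
structure Intertwines (φ : R →+* R') (L : V →+ V') (u : ℕ → Module.End R V)
    (u' : ℕ → Module.End R' V') : Prop where
  map_smul : ∀ r v, L (r • v) = φ r • L v
  map_gen : ∀ i v, L (u i v) = u' i (L v)

variable {φ : R →+* R'} {L : V →+ V'} {u : ℕ → Module.End R V} {u' : ℕ → Module.End R' V'}

theorem hFactor_apply (u : ℕ → Module.End R V) (x : R) (i : ℕ) (v : V) :
    hFactor u x i v = v + x • u i v := by
  simp [hFactor]

namespace Intertwines

theorem map_hFactor (h : Intertwines φ L u u') (x : R) (i : ℕ) (v : V) :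
    L (hFactor u x i v) = hFactor u' (φ x) i (L v) := by
  rw [hFactor_apply, hFactor_apply, map_add, h.map_smul, h.map_gen]

theorem map_descProd (h : Intertwines φ L u u') (x : R) (n d : ℕ) (v : V) :
    L (descProd u x n d v) = descProd u' (φ x) n d (L v) := by
  induction n generalizing d v with
  | zero => rfl
  | succ n ih => rw [descProd, descProd, Module.End.mul_apply, Module.End.mul_apply, ih,
      h.map_hFactor]

theorem map_ascProd (h : Intertwines φ L u u') (x : R) (n d : ℕ) (v : V) :
    L (ascProd u x n d v) = ascProd u' (φ x) n d (L v) := by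
  induction n generalizing d v with
  | zero => rfl
  | succ n ih => rw [ascProd, ascProd, Module.End.mul_apply, Module.End.mul_apply,
      h.map_hFactor, ih]

theorem map_descChain (h : Intertwines φ L u u') (x : ℕ → R) (n d : ℕ) (v : V) :
    L (descChain u x n d v) = descChain u' (fun i => φ (x i)) n d (L v) := by
  induction n generalizing x d v with
  | zero => rfl
  | succ n ih => rw [descChain, descChain, Module.End.mul_apply, Module.End.mul_apply,
      h.map_descProd, ih]

theorem map_ascChain (h : Intertwines φ L u u') (y : ℕ → R) (n d : ℕ) (v : V) :
    L (ascChain u y n d v) = ascChain u' (fun i => φ (y i)) n d (L v) := by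
  induction n generalizing y d v with
  | zero => rfl
  | succ n ih => rw [ascChain, ascChain, Module.End.mul_apply, Module.End.mul_apply, ih,
      h.map_ascProd]

/-- The change of coefficients along a ring homomorphism. -/
theorem mapRange (φ : R →+* R') (N : ℕ) :
    Intertwines φ (Finsupp.mapRange.addMonoidHom φ.toAddMonoidHom :
      (Equiv.Perm (Fin (N + 1)) →₀ R) →+ _) (heckeGen R N) (heckeGen R' N) where
  map_smul r v := by
    ext w
    simp
  map_gen i v := by
    unfold heckeGen
    split_ifs with h
    · simp only [Finsupp.lmapDomain_apply, Finsupp.mapRange.addMonoidHom_apply]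
      exact (Finsupp.mapDomain_mapRange _ _ _ _ fun a b => map_add φ a b).symm
    · simp

/-- The operators acting on positions commute with those acting on values. -/
theorem lmapDomain_heckeOpRight (R : Type*) [CommRing R] {N : ℕ} (j : Fin N) :
    Intertwines (RingHom.id R) (Finsupp.lmapDomain R R (heckeOpRight j)).toAddMonoidHom
      (heckeGen R N) (heckeGen R N) where
  map_smul r v := (Finsupp.lmapDomain R R (heckeOpRight j)).map_smul r v
  map_gen i v := by
    unfold heckeGen
    split_ifs with h
    · simp only [LinearMap.toAddMonoidHom_coe, Finsupp.lmapDomain_apply,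
        ← Finsupp.mapDomain_comp]
      congr 1
      funext w
      exact (heckeOp_heckeOpRight _ _ _).symm
    · simp

end Intertwines

end Intertwines

/-! ### The coefficient of the longest permutation -/

section TopCoefficient

variable {R : Type*} [CommRing R] {N : ℕ}

theorem mapDomain_apply_eq_zero {α : Type*} {f : α → α} {v : α →₀ R} {b : α}
    (h : ∀ a, f a = b → v a = 0) : Finsupp.mapDomain f v b = 0 := by
  classical
  rw [Finsupp.mapDomain, Finsupp.sum_apply]
  refine Finset.sum_eq_zero fun a _ => ?_
  simp only [Finsupp.single_apply]
  split_ifs with hab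
  · exact h a hab
  · rfl

/-- `m` is the part of `v` supported on the permutations with at least `l` inversions, and no
permutation in its support has more. -/
def IsTopPart (l : ℕ) (v m : Equiv.Perm (Fin (N + 1)) →₀ R) : Prop :=
  (∀ w, l ≤ (inversions w).card → (v - m) w = 0) ∧ ∀ w, l < (inversions w).card → m w = 0

theorem heckeGen_apply_eq_zero {l : ℕ} {v : Equiv.Perm (Fin (N + 1)) →₀ R}
    (h : ∀ w, l ≤ (inversions w).card → v w = 0) (i : ℕ) {w : Equiv.Perm (Fin (N + 1))}
    (hw : l + 1 ≤ (inversions w).card) : heckeGen R N i v w = 0 := by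
  unfold heckeGen
  split_ifs with hi
  · refine mapDomain_apply_eq_zero fun w' hw' => h w' ?_
    have := card_inversions_heckeOp_le ⟨i, hi⟩ w'
    rw [hw'] at this
    omega
  · rfl

theorem IsTopPart.hFactor {l : ℕ} {v m : Equiv.Perm (Fin (N + 1)) →₀ R} (h : IsTopPart l v m)
    (t : R) (i : ℕ) :
    IsTopPart (l + 1) (hFactor (heckeGen R N) t i v) (t • heckeGen R N i m) := by
  refine ⟨fun w hw => ?_, fun w hw => ?_⟩
  · have e : Groth.hFactor (heckeGen R N) t i v - t • heckeGen R N i m =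
        ((v - m) + m) + t • heckeGen R N i (v - m) := by
      rw [hFactor_apply, map_sub, smul_sub]; abel
    rw [e, Finsupp.add_apply, Finsupp.add_apply, Finsupp.smul_apply,
      heckeGen_apply_eq_zero h.1 i hw, h.1 w (by omega), h.2 w (by omega)]
    simp
  · rw [Finsupp.smul_apply, heckeGen_apply_eq_zero (l := l + 1) (fun w hw => h.2 w hw) i hw,
      smul_zero]

theorem IsTopPart.rowProd {l : ℕ} {v m : Equiv.Perm (Fin (N + 1)) →₀ R} (h : IsTopPart l v m)
    (x : ℕ → R) (y : R) (n d : ℕ) :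
    IsTopPart (l + n) (rowProd (heckeGen R N) x y n d v)
      ((∏ i ∈ Finset.range n, (x i + y + x i * y)) • rowWord (heckeGen R N) n d m) := by
  induction n generalizing x d with
  | zero => simpa [Groth.rowProd, rowWord] using h
  | succ n ih =>
    have := (ih (fun i => x (i + 1)) (d + 1)).hFactor (x 0 + y + x 0 * y) d
    rwa [map_smul, smul_smul, mul_comm (x 0 + y + x 0 * y) (Finset.prod _ _),
      ← Finset.prod_range_succ' (fun i => x i + y + x i * y) n] at this

theorem IsTopPart.triProd {l : ℕ} {v m : Equiv.Perm (Fin (N + 1)) →₀ R} (h : IsTopPart l v m)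
    (x y : ℕ → R) (n d : ℕ) :
    IsTopPart (l + ∑ b ∈ Finset.range (n + 1), b) (triProd (heckeGen R N) x y n d v)
      ((∏ j ∈ Finset.range n, ∏ i ∈ Finset.range (n - j), (x i + y j + x i * y j)) •
        triWord (heckeGen R N) n d m) := by
  induction n generalizing l v m y d with
  | zero => simpa [Groth.triProd, triWord] using h
  | succ n ih =>
    have := ih (h.rowProd x (y 0) (n + 1) d) (fun j => y (j + 1)) (d + 1)
    rw [map_smul, smul_smul] at this
    rw [Finset.prod_range_succ', Finset.sum_range_succ, add_comm _ (n + 1), ← add_assoc]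
    simpa only [Nat.add_sub_add_right, Nat.sub_zero, Groth.triProd, triWord,
      Module.End.mul_apply] using this

theorem exists_rowWord_single (n d : ℕ) (h : d + n ≤ N) (w : Equiv.Perm (Fin (N + 1))) :
    ∃ v, rowWord (heckeGen R N) n d (Finsupp.single w 1) = Finsupp.single v 1 := by
  induction n generalizing d with
  | zero => exact ⟨w, rfl⟩
  | succ n ih =>
    obtain ⟨v, hv⟩ := ih (d + 1) (by omega)
    exact ⟨heckeOp ⟨d, by omega⟩ v, by
      rw [rowWord, Module.End.mul_apply, hv]
      exact heckeGen_single R ⟨d, by omega⟩ v 1⟩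

theorem exists_triWord_single (n d : ℕ) (h : d + n ≤ N) (w : Equiv.Perm (Fin (N + 1))) :
    ∃ v, triWord (heckeGen R N) n d (Finsupp.single w 1) = Finsupp.single v 1 := by
  induction n generalizing d w with
  | zero => exact ⟨w, rfl⟩
  | succ n ih =>
    obtain ⟨v, hv⟩ := exists_rowWord_single (R := R) (n + 1) d h w
    obtain ⟨v', hv'⟩ := ih (d + 1) (by omega) v
    exact ⟨v', by rw [triWord, Module.End.mul_apply, hv, hv']⟩

theorem triWord_single [Nontrivial R] (w : Equiv.Perm (Fin (N + 1))) :
    triWord (heckeGen R N) N 0 (Finsupp.single w 1) = Finsupp.single Fin.revPerm 1 := by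
  obtain ⟨v, hv⟩ := exists_triWord_single (R := R) N 0 (by omega) w
  suffices ∀ i, heckeOp i v = v by rw [hv, eq_revPerm_of_heckeOp_eq this]
  intro i
  have h := LinearMap.congr_fun ((isHeckeFamily_heckeGen R N).mul_triWord (n := N) (d := 0)
    (i := i) (Nat.zero_le _) (by omega)) (Finsupp.single w 1)
  rw [Module.End.mul_apply, hv, heckeGen_single] at h
  exact Finsupp.single_left_injective one_ne_zero h

/-- The product of all `1 + (x_i ⊕ y_j) u_{i+j}` has as many factors as the longest permutation
has inversions, so that its coefficient there is the product of all `x_i ⊕ y_j`. -/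
theorem triProd_apply_revPerm [Nontrivial R] (x y : ℕ → R) :
    triProd (heckeGen R N) x y N 0 (Finsupp.single 1 1) Fin.revPerm =
      ∏ j ∈ Finset.range N, ∏ i ∈ Finset.range (N - j), (x i + y j + x i * y j) := by
  have h0 : IsTopPart 0 (Finsupp.single 1 1 : Equiv.Perm (Fin (N + 1)) →₀ R)
      (Finsupp.single 1 1) := by
    refine ⟨fun w _ => by simp, fun w hw => ?_⟩
    rw [Finsupp.single_apply, if_neg]
    rintro rfl
    rw [card_inversions_one] at hw
    exact lt_irrefl _ hw
  have h1 := (h0.triProd x y N 0).1 Fin.revPerm (by rw [card_inversions_revPerm, zero_add])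
  rw [Finsupp.sub_apply, sub_eq_zero] at h1
  rw [h1, triWord_single, Finsupp.smul_apply, Finsupp.single_eq_same, smul_eq_mul, mul_one]

end TopCoefficient

/-! ### Isobaric divided differences of the coefficients -/

section Symmetry

/-- The staircase of decreasing products, multiplied by `1 + x_{i+1} u_{d+i}`, is symmetric in `x_i`
and `x_{i+1}`: the additional factor completes the decreasing product in `x_{i+1}` to one in the
same letters as that in `x_i`. -/
theorem IsHeckeFamily.descChain_mul_hFactor_swap {R A : Type*} [CommRing R] [Ring A] [Algebra R A]
    {u : ℕ → A} (hu : IsHeckeFamily u) {x x' : ℕ → R} {i n : ℕ} (d : ℕ) (h : i + 2 ≤ n)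
    (h1 : x' i = x (i + 1)) (h2 : x' (i + 1) = x i)
    (h3 : ∀ j, j ≠ i → j ≠ i + 1 → x' j = x j) :
    descChain u x n d * hFactor u (x (i + 1)) (d + i) =
      descChain u x' n d * hFactor u (x i) (d + i) := by
  induction i generalizing x x' n d with
  | zero =>
    obtain ⟨n, rfl⟩ := Nat.exists_eq_add_of_le' h
    have e : ∀ z : ℕ → R, descChain u z (n + 2) d * hFactor u (z 1) d =
        descProd u (z 0) (n + 1) d * descProd u (z 1) (n + 1) d *
          descChain u (fun i => z (i + 2)) n (d + 2) := by
      intro z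
      have hc := (commute_hFactor_of (z 1)
        (hu.commute_descChain (fun i => z (i + 2)) n (le_refl (d + 2)))).eq
      rw [descChain, descChain, descProd.eq_2 u (z 1), mul_assoc, mul_assoc, mul_assoc, ← hc]
      simp only [mul_assoc]
    have e1 := e x
    have e2 := e x'
    rw [h1, show x' 1 = x 0 from h2,
      show (fun i => x' (i + 2)) = fun i => x (i + 2) from
        funext fun j => h3 _ (by omega) (by omega)] at e2
    simp only [Nat.add_zero, zero_add] at e1 e2 ⊢
    rw [e1, e2, hu.descProd_comm]
  | succ i ih =>
    obtain ⟨n, rfl⟩ := Nat.exists_eq_add_of_le' (show 1 ≤ n by omega)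
    have := ih (x := fun j => x (j + 1)) (x' := fun j => x' (j + 1)) (n := n) (d + 1) (by omega)
      h1 h2 (fun j hj hj' => h3 _ (by omega) (by omega))
    rw [descChain, descChain, mul_assoc, mul_assoc, h3 0 (by omega) (by omega),
      ← Nat.add_assoc, Nat.add_right_comm d i 1, this]

variable {N : ℕ}

theorem mul_piOp (i : Fin N) (f : PolyXY (N + 1)) :
    (xv i.castSucc - xv i.succ) * piOp i f =
      (1 + xv i.succ) * f - (1 + xv i.castSucc) * swapX i f := by
  have h1 := divDiff_spec i f
  have h2 := divDiff_spec i (xv i.succ * f)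
  have h3 : swapX i (xv i.succ * f) = xv i.castSucc * swapX i f := by
    simp [swapX, xv]
  rw [h3] at h2
  rw [piOp, mul_add, ← h1, ← h2]
  ring

theorem xv_sub_xv_ne_zero (i : Fin N) : (xv i.castSucc - xv i.succ : PolyXY (N + 1)) ≠ 0 := by
  rw [sub_ne_zero]
  intro h
  have := Sum.inl_injective (MvPolynomial.X_injective h)
  simp [Fin.ext_iff] at this

/-- The sequence `x_0, …, x_{n-1}, 0, 0, …`. -/
noncomputable def xSeq (n : ℕ) (j : ℕ) : PolyXY n := if h : j < n then xv ⟨j, h⟩ else 0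

/-- The sequence `y_0, …, y_{n-1}, 0, 0, …`. -/
noncomputable def ySeq (n : ℕ) (j : ℕ) : PolyXY n := if h : j < n then yv ⟨j, h⟩ else 0

/-- The generating function of the double Grothendieck polynomials, as an element of the free
module on permutations. -/
noncomputable def grothendieckVector (N : ℕ) : Equiv.Perm (Fin (N + 1)) →₀ PolyXY (N + 1) :=
  ascChain (heckeGen _ N) (ySeq (N + 1)) (N + 1) 0
    (descChain (heckeGen _ N) (xSeq (N + 1)) (N + 1) 0 (Finsupp.single 1 1))

theorem grothendieckVector_revPerm :
    grothendieckVector N Fin.revPerm =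
      ∏ p ∈ (Finset.univ : Finset (Fin (N + 1) × Fin (N + 1))).filter
          (fun p => p.1.val + p.2.val < N), (xv p.1 + yv p.2 + xv p.1 * yv p.2) := by
  rw [grothendieckVector, ← Module.End.mul_apply,
    (isHeckeFamily_heckeGen (PolyXY (N + 1)) N).ascChain_mul_descChain, triProd_apply_revPerm]
  let f : ℕ → ℕ → PolyXY (N + 1) := fun j i =>
    if i + j < N then xSeq _ i + ySeq _ j + xSeq _ i * ySeq _ j else 1
  have hrhs : ∏ p ∈ (Finset.univ : Finset (Fin (N + 1) × Fin (N + 1))).filter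
      (fun p => p.1.val + p.2.val < N), (xv p.1 + yv p.2 + xv p.1 * yv p.2) =
      ∏ j ∈ Finset.range (N + 1), ∏ i ∈ Finset.range (N + 1), f j i := by
    rw [Finset.prod_filter, ← Finset.univ_product_univ, Finset.prod_product_right,
      ← Fin.prod_univ_eq_prod_range]
    refine Finset.prod_congr rfl fun j _ => ?_
    rw [← Fin.prod_univ_eq_prod_range]
    refine Finset.prod_congr rfl fun i _ => ?_
    simp only [f, xSeq, ySeq, Fin.is_lt, dif_pos]
  rw [hrhs, Finset.prod_range_succ, Finset.prod_eq_one (s := Finset.range (N + 1)) (f := f N)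
    (fun i _ => if_neg (by omega)), mul_one]
  refine Finset.prod_congr rfl fun j _ => ?_
  rw [← Finset.prod_filter]
  refine Finset.prod_congr ?_ fun _ _ => rfl
  ext i
  simp only [Finset.mem_range, Finset.mem_filter]
  omega

theorem heckeOpRight_apply_of_lt {i : Fin N} {w : Equiv.Perm (Fin (N + 1))}
    (h : w i.castSucc < w i.succ) : heckeOpRight i w = w * simpleSwap i := if_pos h

theorem heckeOpRight_apply_of_gt {i : Fin N} {w : Equiv.Perm (Fin (N + 1))}
    (h : w i.succ < w i.castSucc) : heckeOpRight i w = w := if_neg h.not_gt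

theorem heckeOpRight_descent (i : Fin N) (w : Equiv.Perm (Fin (N + 1))) :
    heckeOpRight i w i.succ < heckeOpRight i w i.castSucc := by
  rcases lt_trichotomy (w i.castSucc) (w i.succ) with h | h | h
  · rw [heckeOpRight_apply_of_lt h]
    simpa [simpleSwap_castSucc, simpleSwap_succ] using h
  · have := w.injective h
    simp [Fin.ext_iff] at this
  · rwa [heckeOpRight_apply_of_gt h]

/-- At a permutation without descent at `i`, the image of the right operator vanishes. -/
theorem mapDomain_heckeOpRight_of_lt {R : Type*} [CommRing R] {i : Fin N}
    {w : Equiv.Perm (Fin (N + 1))} (h : w i.castSucc < w i.succ)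
    (v : Equiv.Perm (Fin (N + 1)) →₀ R) : Finsupp.mapDomain (heckeOpRight i) v w = 0 :=
  mapDomain_apply_eq_zero fun w' hw' => by
    have := heckeOpRight_descent i w'
    rw [hw'] at this
    exact absurd h this.not_gt

theorem mapDomain_heckeOpRight_of_gt {R : Type*} [CommRing R] {i : Fin N}
    {w : Equiv.Perm (Fin (N + 1))} (h : w i.succ < w i.castSucc)
    (v : Equiv.Perm (Fin (N + 1)) →₀ R) :
    Finsupp.mapDomain (heckeOpRight i) v w = v w + v (w * simpleSwap i) := by
  classical
  have hlt : (w * simpleSwap i) i.castSucc < (w * simpleSwap i) i.succ := by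
    simpa [simpleSwap_castSucc, simpleSwap_succ] using h
  have hne : w ≠ w * simpleSwap i := fun e => by
    rw [← e] at hlt
    exact lt_asymm h hlt
  induction v using Finsupp.induction_linear with
  | zero => simp
  | add f g hf hg => rw [Finsupp.mapDomain_add, Finsupp.add_apply, hf, hg, Finsupp.add_apply,
      Finsupp.add_apply]; abel
  | single a r =>
    rw [Finsupp.mapDomain_single]
    simp only [Finsupp.single_apply]
    by_cases h1 : a = w
    · subst h1
      rw [heckeOpRight_apply_of_gt h, if_pos rfl, if_neg hne, add_zero]
    by_cases h2 : a = w * simpleSwap i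
    · subst h2
      rw [heckeOpRight_apply_of_lt hlt, mul_assoc, simpleSwap_mul_self, mul_one, if_pos rfl,
        if_neg hne.symm, if_pos rfl, zero_add]
    · rw [if_neg h1, if_neg h2, add_zero, if_neg]
      unfold heckeOpRight
      split_ifs
      · intro e
        apply h2
        rw [← e, mul_assoc, simpleSwap_mul_self, mul_one]
      · exact h1

/-- The combination `g + x_{i+1} R_i g` of the generating vector `g`, where `R_i` is the right
operator, is symmetric in `x_i` and `x_{i+1}`. -/
theorem swapX_grothendieckVector_add (i : Fin N) (w : Equiv.Perm (Fin (N + 1))) :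
    swapX i (grothendieckVector N w +
        xv i.succ * Finsupp.mapDomain (heckeOpRight i) (grothendieckVector N) w) =
      grothendieckVector N w +
        xv i.succ * Finsupp.mapDomain (heckeOpRight i) (grothendieckVector N) w := by
  set u := heckeGen (PolyXY (N + 1)) N with hu
  -- The vector `g + x_{i+1} R_i g`, with `x` and `x_{i+1}` replaced by arbitrary `x` and `t`.
  let E : (ℕ → PolyXY (N + 1)) → PolyXY (N + 1) → Equiv.Perm (Fin (N + 1)) →₀ PolyXY (N + 1) :=
    fun x t => ascChain u (ySeq (N + 1)) (N + 1) 0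
      (descChain u x (N + 1) 0 (hFactor u t i (Finsupp.single 1 1)))
  have hx1 : xSeq (N + 1) i.val = xv i.castSucc := dif_pos (by omega)
  have hx2 : xSeq (N + 1) (i.val + 1) = xv i.succ := dif_pos (by omega)
  have hE : grothendieckVector N + xv i.succ •
      Finsupp.mapDomain (heckeOpRight i) (grothendieckVector N) =
        E (xSeq (N + 1)) (xv i.succ) := by
    have hR := Intertwines.lmapDomain_heckeOpRight (PolyXY (N + 1)) i
    have h1 : Finsupp.mapDomain (heckeOpRight i) (grothendieckVector N) =
        ascChain u (ySeq (N + 1)) (N + 1) 0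
          (descChain u (xSeq (N + 1)) (N + 1) 0 (u i (Finsupp.single 1 1))) := by
      have h2 := hR.map_ascChain (ySeq (N + 1)) (N + 1) 0
        (descChain u (xSeq (N + 1)) (N + 1) 0 (Finsupp.single 1 1))
      rw [hR.map_descChain] at h2
      simp only [LinearMap.toAddMonoidHom_coe, Finsupp.lmapDomain_apply, Finsupp.mapDomain_single,
        RingHom.id_apply, heckeOpRight_one] at h2
      rw [hu, heckeGen_single]
      exact h2
    simp only [E, hFactor_apply, map_add, map_smul, h1]
    rfl
  let φ : PolyXY (N + 1) →+* PolyXY (N + 1) :=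
    (MvPolynomial.rename (Equiv.swap (Sum.inl i.castSucc) (Sum.inl i.succ)) :
      PolyXY (N + 1) →ₐ[ℤ] PolyXY (N + 1))
  have hφ : ∀ f, swapX i f = φ f := fun _ => rfl
  have hφx : ∀ a : Fin (N + 1), φ (xv a) = xv (Equiv.swap i.castSucc i.succ a) := by
    intro a
    simp only [φ, xv, RingHom.coe_coe, MvPolynomial.rename_X]
    congr 1
    simp only [Equiv.swap_apply_def, Sum.inl.injEq]
    split_ifs <;> rfl
  have hφy : ∀ a : Fin (N + 1), φ (yv a) = yv a := by
    intro a
    simp only [φ, yv, RingHom.coe_coe, MvPolynomial.rename_X]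
    congr 1
  have hy : (fun j => φ (ySeq (N + 1) j)) = ySeq (N + 1) := by
    funext j
    unfold ySeq
    split_ifs
    · exact hφy _
    · exact map_zero φ
  have hM := Intertwines.mapRange φ N
  have h3 : Finsupp.mapRange.addMonoidHom φ.toAddMonoidHom (E (xSeq (N + 1)) (xv i.succ)) =
      E (fun j => φ (xSeq (N + 1) j)) (xv i.castSucc) := by
    simp only [E]
    rw [hM.map_ascChain, hM.map_descChain, hM.map_hFactor, hy, hφx, Equiv.swap_apply_right]
    congr 3
    simp
  have h4 : E (fun j => φ (xSeq (N + 1) j)) (xv i.castSucc) =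
      E (xSeq (N + 1)) (xv i.succ) := by
    have h5 := (isHeckeFamily_heckeGen (PolyXY (N + 1)) N).descChain_mul_hFactor_swap
      (x := xSeq (N + 1)) (x' := fun j => φ (xSeq (N + 1) j)) (i := i) (n := N + 1) 0 (by omega)
      (by simp only [hx1, hx2, hφx, Equiv.swap_apply_left])
      (by simp only [hx1, hx2, hφx, Equiv.swap_apply_right])
      (fun j hj hj' => by
        simp only [xSeq]
        split_ifs with hlt
        · rw [hφx, Equiv.swap_apply_of_ne_of_ne]
          · simpa [Fin.ext_iff] using hj
          · simpa [Fin.ext_iff] using hj'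
        · exact map_zero φ)
    rw [hx1, hx2, zero_add] at h5
    simp only [E]
    rw [← Module.End.mul_apply (descChain u _ _ _), ← Module.End.mul_apply (descChain u _ _ _), h5]
  have h6 := congrArg (fun v => v w) (h3.trans h4)
  rw [← hE] at h6
  exact h6

/-- The isobaric divided differences move the coefficients of the generating vector down along
descents. -/
theorem piOp_grothendieckVector {i : Fin N} {w : Equiv.Perm (Fin (N + 1))}
    (h : w i.succ < w i.castSucc) :
    piOp i (grothendieckVector N w) = grothendieckVector N (w * simpleSwap i) := by
  have hlt : (w * simpleSwap i) i.castSucc < (w * simpleSwap i) i.succ := by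
    simpa [simpleSwap_castSucc, simpleSwap_succ] using h
  have h1 := swapX_grothendieckVector_add i w
  have h2 := swapX_grothendieckVector_add i (w * simpleSwap i)
  rw [mapDomain_heckeOpRight_of_gt h] at h1
  rw [mapDomain_heckeOpRight_of_lt hlt, mul_zero, add_zero] at h2
  have h3 : swapX i (xv i.succ) = xv i.castSucc := by simp [swapX, xv]
  have hadd : ∀ f g, swapX i (f + g) = swapX i f + swapX i g := fun f g => map_add _ f g
  have hmul : ∀ f g, swapX i (f * g) = swapX i f * swapX i g := fun f g => map_mul _ f g
  rw [hadd, hmul, hadd, h2, h3] at h1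
  refine mul_left_cancel₀ (xv_sub_xv_ne_zero i) ?_
  rw [mul_piOp]
  linear_combination -h1

/-- Along a reduced word the permutations descend from the longest one. -/
theorem foldr_piOp_grothendieckVector (l : List (Fin N))
    (hl : IsReducedWord (l.map simpleSwap).prod l) :
    l.foldr piOp (grothendieckVector N Fin.revPerm) =
      grothendieckVector N (Fin.revPerm * (l.map simpleSwap).prod⁻¹) := by
  induction l with
  | nil => simp
  | cons i l ih =>
    have h0 := hl.2
    have h1 := card_inversions_prod_le l
    simp only [List.map_cons, List.prod_cons, List.length_cons] at h0
    have h2 : ((l.map simpleSwap).prod⁻¹ : Equiv.Perm (Fin (N + 1))) i.castSucc <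
        ((l.map simpleSwap).prod⁻¹ : Equiv.Perm (Fin (N + 1))) i.succ := by
      rcases (inv_castSucc_ne_inv_succ i (l.map simpleSwap).prod).lt_or_gt with h | h
      · exact h
      · have := card_inversions_simpleSwap_mul_of_gt h
        omega
    have h3 := card_inversions_simpleSwap_mul_of_lt h2
    rw [List.foldr_cons, ih ⟨rfl, by omega⟩, piOp_grothendieckVector, List.map_cons,
      List.prod_cons, mul_inv_rev, simpleSwap_inv, mul_assoc]
    rw [Equiv.Perm.mul_apply, Equiv.Perm.mul_apply]
    simpa using h2

/-- The double Grothendieck polynomials are the coefficients of the generating vector. -/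
theorem doubleGrothendieck_eq (w : Equiv.Perm (Fin (N + 1))) :
    doubleGrothendieck w = grothendieckVector N w := by
  have h := reducedWord_spec (w⁻¹ * Fin.revPerm)
  rw [doubleGrothendieck, piPerm, ← grothendieckVector_revPerm,
    foldr_piOp_grothendieckVector _ ⟨rfl, by rw [h.1]; exact h.2⟩, h.1]
  simp

end Symmetry

/-! ### Restriction to a parabolic subgroup -/

section ShiftPerm

variable {m k : ℕ}

theorem shiftPerm_castAdd (ω : Equiv.Perm (Fin (k + 1))) (a : Fin m) :
    shiftPerm m ω (Fin.castAdd (k + 1) a) = Fin.castAdd (k + 1) a := by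
  simp [shiftPerm, Equiv.permCongr_apply]

theorem shiftPerm_natAdd (ω : Equiv.Perm (Fin (k + 1))) (a : Fin (k + 1)) :
    shiftPerm m ω (Fin.natAdd m a) = Fin.natAdd m (ω a) := by
  simp [shiftPerm, Equiv.permCongr_apply]

theorem perm_ext_add {v w : Equiv.Perm (Fin (m + k + 1))}
    (h1 : ∀ a : Fin m, v (Fin.castAdd (k + 1) a) = w (Fin.castAdd (k + 1) a))
    (h2 : ∀ a : Fin (k + 1), v (Fin.natAdd m a) = w (Fin.natAdd m a)) : v = w :=
  Equiv.ext fun a => Fin.addCases (motive := fun a : Fin (m + (k + 1)) => v a = w a) h1 h2 a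

theorem shiftPerm_one : shiftPerm m (1 : Equiv.Perm (Fin (k + 1))) = 1 :=
  perm_ext_add (fun a => shiftPerm_castAdd _ a) (fun a => shiftPerm_natAdd _ a)

theorem shiftPerm_mul (v w : Equiv.Perm (Fin (k + 1))) :
    shiftPerm m (v * w) = shiftPerm m v * shiftPerm m w :=
  perm_ext_add
    (fun a => by rw [Equiv.Perm.mul_apply, shiftPerm_castAdd, shiftPerm_castAdd,
      shiftPerm_castAdd])
    (fun a => by rw [Equiv.Perm.mul_apply, shiftPerm_natAdd, shiftPerm_natAdd, shiftPerm_natAdd,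
      Equiv.Perm.mul_apply])

theorem shiftPerm_inv (w : Equiv.Perm (Fin (k + 1))) : (shiftPerm m w)⁻¹ = shiftPerm m w⁻¹ := by
  rw [inv_eq_iff_mul_eq_one, ← shiftPerm_mul, mul_inv_cancel, shiftPerm_one]

theorem shiftPerm_injective : Function.Injective (shiftPerm m (k := k)) := fun v w h =>
  Equiv.ext fun a => by
    have := congrArg (fun p : Equiv.Perm (Fin (m + k + 1)) => p (Fin.natAdd m a)) h
    simp only [shiftPerm_natAdd] at this
    exact Fin.natAdd_injective _ _ this

theorem natAdd_castSucc' (i : Fin k) :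
    (Fin.natAdd m i).castSucc = (Fin.natAdd m i.castSucc : Fin (m + (k + 1))) := rfl

theorem natAdd_succ' (i : Fin k) :
    (Fin.natAdd m i).succ = (Fin.natAdd m i.succ : Fin (m + (k + 1))) := rfl

theorem simpleSwap_natAdd (i : Fin k) :
    simpleSwap (Fin.natAdd m i) = shiftPerm m (simpleSwap i) := by
  refine perm_ext_add (fun a => ?_) (fun a => ?_)
  · rw [shiftPerm_castAdd]
    refine simpleSwap_of_ne ?_ ?_
    · have := a.isLt
      simp only [ne_eq, Fin.ext_iff, Fin.val_castAdd, Fin.val_castSucc, Fin.val_natAdd]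
      omega
    · have := a.isLt
      simp only [ne_eq, Fin.ext_iff, Fin.val_castAdd, Fin.val_succ, Fin.val_natAdd]
      omega
  · rw [shiftPerm_natAdd, simpleSwap, simpleSwap, natAdd_castSucc', natAdd_succ',
      Equiv.swap_apply_def, Equiv.swap_apply_def]
    simp only [Fin.natAdd_inj]
    split_ifs <;> rfl

theorem heckeOp_natAdd (i : Fin k) (w : Equiv.Perm (Fin (k + 1))) :
    heckeOp (Fin.natAdd m i) (shiftPerm m w) = shiftPerm m (heckeOp i w) := by
  have h : (shiftPerm m w)⁻¹ (Fin.natAdd m i).castSucc < (shiftPerm m w)⁻¹ (Fin.natAdd m i).succ ↔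
      w⁻¹ i.castSucc < w⁻¹ i.succ := by
    rw [shiftPerm_inv, natAdd_castSucc', natAdd_succ', shiftPerm_natAdd, shiftPerm_natAdd]
    simp only [Fin.lt_def, Fin.val_natAdd]
    omega
  unfold heckeOp
  by_cases h1 : w⁻¹ i.castSucc < w⁻¹ i.succ
  · rw [if_pos h1, if_pos (h.2 h1), shiftPerm_mul, simpleSwap_natAdd]
  · rw [if_neg h1, if_neg fun h2 => h1 (h.1 h2)]

/-- The operators `heckeOp i` with `m ≤ i` preserve the complement of the parabolic subgroup. -/
theorem mem_range_of_heckeOp_natAdd {i : Fin k} {w : Equiv.Perm (Fin (m + k + 1))}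
    {v : Equiv.Perm (Fin (k + 1))} (h : heckeOp (Fin.natAdd m i) w = shiftPerm m v) :
    ∃ v', w = shiftPerm m v' := by
  unfold heckeOp at h
  split_ifs at h with h1
  · refine ⟨simpleSwap i * v, ?_⟩
    rw [shiftPerm_mul, ← simpleSwap_natAdd, ← h, ← mul_assoc, simpleSwap_mul_self, one_mul]
  · exact ⟨v, h⟩

theorem heckeOp_descent {N : ℕ} (i : Fin N) (w : Equiv.Perm (Fin (N + 1))) :
    (heckeOp i w)⁻¹ i.succ < (heckeOp i w)⁻¹ i.castSucc := by
  rcases (inv_castSucc_ne_inv_succ i w).lt_or_gt with h | h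
  · rw [heckeOp_of_lt h, inv_simpleSwap_mul, inv_simpleSwap_mul, simpleSwap_succ,
      simpleSwap_castSucc]
    exact h
  · rwa [heckeOp_of_gt h]

/-- The operators `heckeOp i` with `i < m` map into the complement of the parabolic subgroup. -/
theorem heckeOp_ne_shiftPerm {i : Fin (m + k)} (hi : i.val < m) (w : Equiv.Perm (Fin (m + k + 1)))
    (v : Equiv.Perm (Fin (k + 1))) : heckeOp i w ≠ shiftPerm m v := by
  intro h
  have h1 := heckeOp_descent i w
  rw [h, shiftPerm_inv] at h1
  have e : i.castSucc = Fin.castAdd (k + 1) (⟨i, hi⟩ : Fin m) := rfl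
  rw [e, shiftPerm_castAdd] at h1
  revert h1
  rw [imp_false, not_lt]
  by_cases h2 : i.val + 1 < m
  · have e2 : i.succ = Fin.castAdd (k + 1) (⟨i + 1, h2⟩ : Fin m) := rfl
    rw [e2, shiftPerm_castAdd]
    simp [Fin.le_def]
  · have e2 : i.succ = Fin.natAdd m (0 : Fin (k + 1)) := by
      simp only [Fin.ext_iff, Fin.val_succ, Fin.val_natAdd, Fin.val_zero]
      omega
    rw [e2, shiftPerm_natAdd]
    simp only [Fin.le_def, Fin.val_castAdd, Fin.val_natAdd]
    omega

/-- The restriction of coefficients to the parabolic subgroup of the permutations that fix the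
first `m` letters turns the operators with index less than `m` into zero. -/
theorem Intertwines.comapDomain_shiftPerm (R : Type*) [CommRing R] (m k : ℕ) :
    Intertwines (RingHom.id R)
      (Finsupp.lcomapDomain (shiftPerm m (k := k)) shiftPerm_injective :
        (Equiv.Perm (Fin (m + k + 1)) →₀ R) →ₗ[R] _).toAddMonoidHom
      (heckeGen R (m + k)) (fun i => if i < m then 0 else heckeGen R k (i - m)) where
  map_smul r v := (Finsupp.lcomapDomain (shiftPerm m (k := k)) shiftPerm_injective :
        (Equiv.Perm (Fin (m + k + 1)) →₀ R) →ₗ[R] _).map_smul r v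
  map_gen i v := by
    classical
    set P := (Finsupp.lcomapDomain (shiftPerm m (k := k)) shiftPerm_injective :
        (Equiv.Perm (Fin (m + k + 1)) →₀ R) →ₗ[R] _) with hP
    have hPa : ∀ v w, P v w = v (shiftPerm m w) := fun v w => rfl
    have hPs : ∀ w r, P (Finsupp.single (shiftPerm m w) r) = Finsupp.single w r := fun w r => by
      ext w'
      rw [hPa, Finsupp.single_apply, Finsupp.single_apply]
      simp only [shiftPerm_injective.eq_iff]
    have hP0 : ∀ w r, (∀ v, w ≠ shiftPerm m v) → P (Finsupp.single w r) = 0 := fun w r h => by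
      ext w'
      rw [hPa, Finsupp.single_apply, if_neg (h w')]
      rfl
    change P (heckeGen R (m + k) i v) = (if i < m then 0 else heckeGen R k (i - m)) (P v)
    suffices h : P ∘ₗ heckeGen R (m + k) i =
        (if i < m then 0 else heckeGen R k (i - m)) ∘ₗ P from LinearMap.congr_fun h v
    refine Finsupp.lhom_ext fun w r => ?_
    rw [LinearMap.comp_apply, LinearMap.comp_apply]
    split_ifs with him
    · rw [heckeGen_single R (⟨i, by omega⟩ : Fin (m + k)),
        hP0 _ _ fun v => heckeOp_ne_shiftPerm him w v]
      rfl
    · obtain ⟨i, rfl⟩ := Nat.exists_eq_add_of_le (not_lt.1 him)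
      rw [Nat.add_sub_cancel_left]
      rcases Nat.lt_or_ge i k with hik | hik
      · lift i to Fin k using hik
        have e := heckeGen_single R (Fin.natAdd m i) w r
        rw [Fin.val_natAdd] at e
        rw [e]
        by_cases hw : ∃ v, w = shiftPerm m v
        · obtain ⟨v, rfl⟩ := hw
          rw [heckeOp_natAdd, hPs, hPs, heckeGen_single]
        · rw [hP0 w r fun v hv => hw ⟨v, hv⟩, map_zero, hP0]
          exact fun v hv => hw (mem_range_of_heckeOp_natAdd hv)
      · rw [heckeGen_of_le R hik, heckeGen_of_le R (by omega)]
        simp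

end ShiftPerm

section Stable

variable {R A : Type*} [CommRing R] [Ring A] [Algebra R A] {u u' : ℕ → A} {m : ℕ}

theorem descProd_shift (h : ∀ i, u' (m + i) = u i) (x : R) (n d : ℕ) :
    descProd u' x n (m + d) = descProd u x n d := by
  induction n generalizing d with
  | zero => rfl
  | succ n ih => rw [descProd, descProd, Nat.add_assoc, ih, hFactor, hFactor, h]

theorem descProd_shift_of_zero (h0 : ∀ i < m, u' i = 0) (h : ∀ i, u' (m + i) = u i) (x : R)
    (k : ℕ) {a d : ℕ} (ha : d + a = m) : descProd u' x (a + k) d = descProd u x k 0 := by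
  induction a generalizing d with
  | zero => rw [← descProd_shift h, zero_add, Nat.add_zero, ← ha, Nat.add_zero]
  | succ a ih =>
    rw [Nat.add_right_comm, descProd, ih (by omega), hFactor, h0 d (by omega), smul_zero,
      add_zero, mul_one]

theorem descChain_of_zero (u : ℕ → A) {x : ℕ → R} (hx : ∀ i, x i = 0) (n d : ℕ) :
    descChain u x n d = 1 := by
  induction n generalizing x d with
  | zero => rfl
  | succ n ih => rw [descChain, hx, descProd_zero, ih fun i => hx _, one_mul]

/-- If the first `m` generators vanish, and all variables after the first `m + 1` do, then the
staircase of decreasing products becomes a rectangle. -/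
theorem descChain_eq_prod (h0 : ∀ i < m, u' i = 0) (h : ∀ i, u' (m + i) = u i) (k : ℕ) {a d : ℕ}
    (ha : d + a = m) {x : ℕ → R} (hx : ∀ i, a < i → x i = 0) :
    descChain u' x (a + k + 1) d =
      (List.ofFn fun i : Fin (a + 1) => descProd u (x i) k 0).prod := by
  induction a generalizing d x with
  | zero =>
    have e := descProd_shift_of_zero h0 h (x 0) k ha
    rw [descChain, e, descChain_of_zero u' fun i => hx _ (Nat.succ_pos i)]
    simp
  | succ a ih =>
    rw [descChain, descProd_shift_of_zero h0 h (x 0) k ha, Nat.add_right_comm a 1 k,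
      ih (by omega) fun i hi => hx _ (by omega), List.ofFn_succ (n := a + 1), List.prod_cons]
    rfl

theorem descChain_op (u : ℕ → A) (y : ℕ → R) (n d : ℕ) :
    descChain (fun i => MulOpposite.op (u i)) y n d = MulOpposite.op (ascChain u y n d) := by
  induction n generalizing y d with
  | zero => rfl
  | succ n ih => rw [descChain, ascChain, MulOpposite.op_mul, ih, descProd_op]

end Stable

/-- The stable double Grothendieck polynomials are the coefficients of a product of commuting
decreasing products and of commuting increasing products. -/
theorem stableDoubleGrothendieck_eq (m : ℕ) {k : ℕ} (ω : Equiv.Perm (Fin (k + 1))) :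
    stableDoubleGrothendieck m ω =
      (List.ofFn fun i : Fin (m + 1) => descProd
          (fun i => MulOpposite.op (heckeGen (PolyXY (m + 1)) k i)) (yv i) k 0).prod.unop
        ((List.ofFn fun i : Fin (m + 1) => descProd
          (heckeGen (PolyXY (m + 1)) k) (xv i) k 0).prod (Finsupp.single 1 1)) ω := by
  let φ : PolyXY (m + k + 1) →+* PolyXY (m + 1) :=
    (truncate (m + 1) : PolyXY (m + k + 1) →ₐ[ℤ] PolyXY (m + 1))
  have hx : (fun j => φ (xSeq (m + k + 1) j)) = xSeq (m + 1) := by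
    funext j
    unfold xSeq
    split_ifs with h1 h2 h2
    · simp only [φ, truncate, xv, RingHom.coe_coe, MvPolynomial.aeval_X, Sum.elim_inl, dif_pos h2]
    · simp only [φ, truncate, xv, RingHom.coe_coe, MvPolynomial.aeval_X, Sum.elim_inl, dif_neg h2]
    · omega
    · exact map_zero φ
  have hy : (fun j => φ (ySeq (m + k + 1) j)) = ySeq (m + 1) := by
    funext j
    unfold ySeq
    split_ifs with h1 h2 h2
    · simp only [φ, truncate, yv, RingHom.coe_coe, MvPolynomial.aeval_X, Sum.elim_inr, dif_pos h2]
    · simp only [φ, truncate, yv, RingHom.coe_coe, MvPolynomial.aeval_X, Sum.elim_inr, dif_neg h2]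
    · omega
    · exact map_zero φ
  have hx0 : ∀ i : Fin (m + 1), xSeq (m + 1) i = xv i := fun i => dif_pos i.isLt
  have hy0 : ∀ i : Fin (m + 1), ySeq (m + 1) i = yv i := fun i => dif_pos i.isLt
  have hM := Intertwines.mapRange φ (m + k)
  have hP := Intertwines.comapDomain_shiftPerm (PolyXY (m + 1)) m k
  set u' : ℕ → Module.End (PolyXY (m + 1)) (Equiv.Perm (Fin (k + 1)) →₀ PolyXY (m + 1)) :=
    fun i => if i < m then 0 else heckeGen (PolyXY (m + 1)) k (i - m) with hu'
  have h0 : ∀ i < m, u' i = 0 := fun i hi => if_pos hi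
  have h1 : ∀ i, u' (m + i) = heckeGen (PolyXY (m + 1)) k i := fun i => by
    rw [hu']
    simp
  have e1 := descChain_eq_prod h0 h1 k (zero_add m) (x := xSeq (m + 1))
    fun i hi => dif_neg (by omega)
  have e2 := descChain_eq_prod (u := fun i => MulOpposite.op (heckeGen (PolyXY (m + 1)) k i))
    (u' := fun i => MulOpposite.op (u' i)) (fun i hi => by rw [h0 i hi]; rfl)
    (fun i => by rw [h1]) k (zero_add m) (x := ySeq (m + 1)) fun i hi => dif_neg (by omega)
  rw [descChain_op] at e2
  simp only [hx0, hy0] at e1 e2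
  rw [← e1, ← e2, MulOpposite.unop_op]
  have h2 : Finsupp.mapRange.addMonoidHom φ.toAddMonoidHom (grothendieckVector (m + k)) =
      ascChain (heckeGen (PolyXY (m + 1)) (m + k)) (ySeq (m + 1)) (m + k + 1) 0
        (descChain (heckeGen (PolyXY (m + 1)) (m + k)) (xSeq (m + 1)) (m + k + 1) 0
          (Finsupp.single 1 1)) := by
    rw [grothendieckVector, hM.map_ascChain, hM.map_descChain, hx, hy]
    congr 2
    simp
  have h3 := congrArg (Finsupp.lcomapDomain (shiftPerm m (k := k)) shiftPerm_injective :
        (Equiv.Perm (Fin (m + k + 1)) →₀ PolyXY (m + 1)) →ₗ[PolyXY (m + 1)] _).toAddMonoidHom h2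
  rw [hP.map_ascChain, hP.map_descChain] at h3
  have h4 : (Finsupp.lcomapDomain (shiftPerm m (k := k)) shiftPerm_injective :
        (Equiv.Perm (Fin (m + k + 1)) →₀ PolyXY (m + 1)) →ₗ[PolyXY (m + 1)] _).toAddMonoidHom
      (Finsupp.single 1 1) = Finsupp.single 1 1 := by
    classical
    refine Finsupp.ext fun w => ?_
    change Finsupp.single 1 1 (shiftPerm m w) = _
    rw [← shiftPerm_one (m := m) (k := k), Finsupp.single_apply, Finsupp.single_apply]
    simp only [shiftPerm_injective.eq_iff]
  rw [h4] at h3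
  have h5 := congrArg (fun v => v ω) h3
  rw [stableDoubleGrothendieck, doubleGrothendieck_eq]
  exact h5

/-! ### Comparison of coefficients -/

section Comparison

open scoped Classical

variable {R : Type*} [CommRing R] {k : ℕ}

theorem IncTableau.wordProd_heckeGen_single (T : IncTableau k) (w : Equiv.Perm (Fin (k + 1)))
    (r : R) :
    T.wordProd (heckeGen R k) (Finsupp.single w r) =
      Finsupp.single (T.word.foldr heckeOp w) r := by
  rw [IncTableau.wordProd]
  induction T.word with
  | nil => rfl
  | cons i l ih => rw [List.map_cons, List.prod_cons, Module.End.mul_apply, ih, heckeGen_single,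
      List.foldr_cons]

theorem sum_wordProd_single (a : IncTableau k → R) (v : Equiv.Perm (Fin (k + 1)))
    (ω : Equiv.Perm (Fin (k + 1))) :
    (∑ T, a T • T.wordProd (heckeGen R k)) (Finsupp.single v 1) ω =
      ∑ T with T.word.foldr heckeOp v = ω, a T := by
  rw [LinearMap.sum_apply, Finsupp.finsetSum_apply, Finset.sum_filter]
  refine Finset.sum_congr rfl fun T _ => ?_
  rw [LinearMap.smul_apply, IncTableau.wordProd_heckeGen_single, Finsupp.smul_apply,
    Finsupp.single_apply, smul_eq_mul, mul_ite, mul_one, mul_zero]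

theorem sum_wordProd_sum_wordProd_single (a b : IncTableau k → R)
    (ω : Equiv.Perm (Fin (k + 1))) :
    (∑ S, a S • S.wordProd (heckeGen R k))
        ((∑ T, b T • T.wordProd (heckeGen R k)) (Finsupp.single 1 1)) ω =
      ∑ S, a S * ∑ T with S.word.foldr heckeOp ((T : IncTableau k).word.foldr heckeOp 1) = ω,
        b T := by
  have h : (∑ T, b T • T.wordProd (heckeGen R k)) (Finsupp.single 1 1) =
      ∑ T, b T • Finsupp.single ((T : IncTableau k).word.foldr heckeOp 1) (1 : R) := by
    rw [LinearMap.sum_apply]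
    refine Finset.sum_congr rfl fun T _ => ?_
    rw [LinearMap.smul_apply, IncTableau.wordProd_heckeGen_single]
  rw [h, map_sum, Finsupp.finsetSum_apply]
  simp only [map_smul, Finsupp.smul_apply, sum_wordProd_single, smul_eq_mul, Finset.mul_sum,
    Finset.sum_filter]
  rw [Finset.sum_comm]
  refine Finset.sum_congr rfl fun S _ => Finset.sum_congr rfl fun T _ => ?_
  split_ifs
  · rw [mul_comm]
  · simp

variable [IsDomain R] {n : ℕ}

theorem cauchy_heckeGen {x : Fin n → R} (hinj : Function.Injective x) (hx : ∀ i, 1 + x i ≠ 0) :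
    (List.ofFn fun i => descProd (heckeGen R k) (x i) k 0).prod =
      ∑ T : IncTableau k, symGrothendieck T.shape ⊥ x • T.wordProd (heckeGen R k) :=
  smul_right_injective _ (vandermondeProd_ne_zero hinj)
    ((isHeckeFamily_heckeGen R k).cauchy k hx)

/-- The Cauchy identity in the opposite algebra: the reversal of words transposes the shapes. -/
theorem cauchy_heckeGen_op {y : Fin n → R} (hinj : Function.Injective y)
    (hy : ∀ i, 1 + y i ≠ 0) :
    (List.ofFn fun i =>
        descProd (fun i => MulOpposite.op (heckeGen R k i)) (y i) k 0).prod.unop =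
      ∑ T : IncTableau k, symGrothendieck T.shape.transpose ⊥ y • T.wordProd (heckeGen R k) := by
  have h := congrArg MulOpposite.unop ((isHeckeFamily_heckeGen R k).op.cauchy k hy)
  rw [MulOpposite.unop_smul, MulOpposite.unop_smul] at h
  refine (smul_right_injective _ (vandermondeProd_ne_zero hinj) h).trans ?_
  rw [Finset.unop_sum]
  refine Fintype.sum_bijective IncTableau.transpose
    (Function.Involutive.bijective IncTableau.transpose_transpose) _ _ fun T => ?_
  rw [T.wordProd_op (isHeckeFamily_heckeGen R k), MulOpposite.unop_smul, MulOpposite.unop_op,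
    IncTableau.shape_transpose, YoungDiagram.transpose_transpose]

/-- The pairs of increasing tableaux `S`, `T` whose joint word yields `ω`, where `S` has the given
shape `mu` and `T` is weighted by the symmetric Grothendieck polynomial of its shape, are accounted
for by the single increasing tableaux whose word yields `ω` and whose shape contains `mu`.  Both
sides are coefficients of `G_mu` in the auxiliary variables `X`. -/
theorem sum_pairs_eq {x : Fin n → R} (hinj : Function.Injective x) (hx : ∀ i, 1 + x i ≠ 0)
    (ω : Equiv.Perm (Fin (k + 1))) {mu : YoungDiagram} (hmu : ∀ c ∈ mu.cells, c.1 < k ∧ c.2 < k) :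
    ∑ S : IncTableau k with S.shape = mu,
        ∑ T with S.word.foldr heckeOp ((T : IncTableau k).word.foldr heckeOp 1) = ω,
          symGrothendieck T.shape ⊥ x =
      ∑ T : IncTableau k with T.word.foldr heckeOp 1 = ω ∧ mu ≤ T.shape,
        ∑ rho ∈ (subdiagrams mu).filter (fun rho => IsRookStrip rho mu),
          symGrothendieck T.shape rho x := by
  let B : Finset YoungDiagram := (finite_boxed k).toFinset
  have hB : ∀ {nu : YoungDiagram}, nu ∈ B ↔ ∀ c ∈ nu.cells, c.1 < k ∧ c.2 < k := by
    simp [B]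
  have hcol : ∀ nu ∈ B, nu.colLen k = 0 := fun nu hnu => by
    by_contra hne
    have := hB.1 hnu (0, k) (YoungDiagram.mem_iff_lt_colLen.2 (Nat.pos_of_ne_zero hne))
    exact lt_irrefl _ this.2
  let X : Fin k → MvPolynomial (Fin k) R := MvPolynomial.X
  let C : R →+* MvPolynomial (Fin k) R := MvPolynomial.C
  have hCinj : Function.Injective C := MvPolynomial.C_injective _ _
  have hXne : ∀ i r, X i ≠ C r := fun i r h => by
    have := congrArg (MvPolynomial.coeff (Finsupp.single i 1)) h
    rw [MvPolynomial.coeff_X, MvPolynomial.coeff_C, if_pos rfl,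
      if_neg (Finsupp.single_ne_zero.2 one_ne_zero).symm] at this
    exact one_ne_zero this
  have hX1 : ∀ i, 1 + X i ≠ 0 := one_add_X_ne_zero
  have hXinj : Function.Injective X := MvPolynomial.X_injective
  have hCx1 : ∀ i, 1 + C (x i) ≠ 0 := fun i h => hx i <| hCinj <| by
    rw [map_add, map_one, h, map_zero]
  have hCxinj : Function.Injective fun i => C (x i) := hCinj.comp hinj
  have hz1 : ∀ i, 1 + Fin.append X (fun i => C (x i)) i ≠ 0 := fun i => by
    refine Fin.addCases (fun i => ?_) (fun i => ?_) i
    · rw [Fin.append_left]; exact hX1 i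
    · rw [Fin.append_right]; exact hCx1 i
  have hzinj : Function.Injective (Fin.append X fun i => C (x i)) :=
    Fin.append_injective_iff.2 ⟨hXinj, hCxinj, fun i j => hXne i _⟩
  have h1 := cauchy_heckeGen (k := k) hzinj hz1
  rw [List.ofFn_add, List.prod_append] at h1
  have e1 : ∀ i : Fin k, Fin.append X (fun i => C (x i)) (Fin.castLE (Nat.le_add_right k n) i) =
      X i := fun i => Fin.append_left X (fun i => C (x i)) i
  simp only [e1, Fin.append_right] at h1
  rw [cauchy_heckeGen hXinj hX1, cauchy_heckeGen hCxinj hCx1] at h1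
  have h2 := congrArg (fun L => L (Finsupp.single 1 1) ω) h1
  simp only [Module.End.mul_apply] at h2
  rw [sum_wordProd_sum_wordProd_single, sum_wordProd_single] at h2
  simp only [symGrothendieck_append, ← map_symGrothendieck C, ← map_sum, ← Finset.mul_sum] at h2
  have h3 : ∀ g : IncTableau k → R, ∑ S, symGrothendieck S.shape ⊥ X * C (g S) =
      ∑ nu ∈ B, symGrothendieck nu ⊥ X * C (∑ S : IncTableau k with S.shape = nu, g S) := by
    intro g
    rw [← Finset.sum_fiberwise_of_maps_to (s := Finset.univ) (t := B)
      (g := IncTableau.shape) fun S _ => hB.2 S.boxed]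
    refine Finset.sum_congr rfl fun nu _ => ?_
    rw [map_sum, Finset.mul_sum]
    refine Finset.sum_congr rfl fun S hS => ?_
    rw [(Finset.mem_filter.1 hS).2]
  have h4 : ∀ g : IncTableau k → YoungDiagram → R,
      ∑ T : IncTableau k with T.word.foldr heckeOp 1 = ω, ∑ nu ∈ subdiagrams T.shape,
          symGrothendieck nu ⊥ X * C (g T nu) =
        ∑ nu ∈ B, symGrothendieck nu ⊥ X *
          C (∑ T : IncTableau k with T.word.foldr heckeOp 1 = ω ∧ nu ≤ T.shape, g T nu) := by
    intro g
    simp only [map_sum, Finset.mul_sum]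
    refine Finset.sum_comm' fun T nu => ?_
    simp only [Finset.mem_filter, Finset.mem_univ, true_and, mem_subdiagrams]
    constructor
    · rintro ⟨h, h'⟩
      exact ⟨⟨h, h'⟩, hB.2 fun c hc => T.boxed c (YoungDiagram.cells_subset_iff.2 h' hc)⟩
    · rintro ⟨⟨h, h'⟩, -⟩
      exact ⟨h, h'⟩
  rw [h3, h4, ← sub_eq_zero, ← Finset.sum_sub_distrib] at h2
  simp only [← mul_sub, ← map_sub] at h2
  exact sub_eq_zero.1 (symGrothendieck_linearIndependent B hcol _ h2 mu (hB.2 hmu))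

theorem sum_heckeTableau {M : Type*} [AddCommMonoid M] (ω : Equiv.Perm (Fin (k + 1)))
    (f : YoungDiagram → M) :
    ∑ T : HeckeTableau ω, f T.shape = ∑ T : IncTableau k with T.word.foldr heckeOp 1 = ω,
      f T.shape := by
  refine Finset.sum_bij'
    (fun T _ => ⟨T.shape, T.entry, T.row_strict, T.col_strict⟩)
    (fun T hT => ⟨T.shape, T.entry, T.row_strict, T.col_strict, (Finset.mem_filter.1 hT).2⟩)
    ?_ ?_ ?_ ?_ ?_
  · exact fun T _ => Finset.mem_filter.2 ⟨Finset.mem_univ _, T.hecke_word⟩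
  all_goals intros; first | rfl | exact Finset.mem_univ _

/-- The expansion of the product of the increasing part in the variables `y` and the decreasing part
in the variables `x`. -/
theorem unop_prod_apply_prod_apply {p : ℕ} {x : Fin n → R} {y : Fin p → R}
    (hxinj : Function.Injective x) (hx : ∀ i, 1 + x i ≠ 0)
    (hyinj : Function.Injective y) (hy : ∀ i, 1 + y i ≠ 0) (ω : Equiv.Perm (Fin (k + 1))) :
    (List.ofFn fun i => descProd
          (fun i => MulOpposite.op (heckeGen R k i)) (y i) k 0).prod.unop
        ((List.ofFn fun i => descProd (heckeGen R k) (x i) k 0).prod (Finsupp.single 1 1)) ω =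
      ∑ T : HeckeTableau ω, ∑ mu ∈ subdiagrams T.shape,
        ∑ rho ∈ (subdiagrams mu).filter (fun rho => IsRookStrip rho mu),
          symGrothendieck T.shape rho x * symGrothendieck mu.transpose ⊥ y := by
  let B : Finset YoungDiagram := (finite_boxed k).toFinset
  have hB : ∀ {nu : YoungDiagram}, nu ∈ B ↔ ∀ c ∈ nu.cells, c.1 < k ∧ c.2 < k := by
    simp [B]
  rw [cauchy_heckeGen hxinj hx, cauchy_heckeGen_op hyinj hy, sum_wordProd_sum_wordProd_single,
    ← Finset.sum_fiberwise_of_maps_to (s := Finset.univ) (t := B)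
      (g := IncTableau.shape) fun S _ => hB.2 S.boxed,
    sum_heckeTableau ω fun lam => ∑ mu ∈ subdiagrams lam,
      ∑ rho ∈ (subdiagrams mu).filter (fun rho => IsRookStrip rho mu),
          symGrothendieck lam rho x * symGrothendieck mu.transpose ⊥ y]
  have h1 : ∀ mu ∈ B, ∑ S : IncTableau k with S.shape = mu,
      symGrothendieck S.shape.transpose ⊥ y *
        ∑ T with S.word.foldr heckeOp ((T : IncTableau k).word.foldr heckeOp 1) = ω,
          symGrothendieck T.shape ⊥ x =
      ∑ T : IncTableau k with T.word.foldr heckeOp 1 = ω ∧ mu ≤ T.shape,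
        ∑ rho ∈ (subdiagrams mu).filter (fun rho => IsRookStrip rho mu),
          symGrothendieck T.shape rho x * symGrothendieck mu.transpose ⊥ y := by
    intro mu hmu
    simp only [← Finset.sum_mul]
    rw [← sum_pairs_eq hxinj hx ω (hB.1 hmu), mul_comm, Finset.mul_sum]
    refine Finset.sum_congr rfl fun S hS => ?_
    rw [(Finset.mem_filter.1 hS).2]
  rw [Finset.sum_congr rfl h1]
  refine Finset.sum_comm' fun mu T => ?_
  simp only [Finset.mem_filter, Finset.mem_univ, true_and, mem_subdiagrams]
  constructor
  · rintro ⟨-, h, h'⟩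
    exact ⟨h', h⟩
  · rintro ⟨h', h⟩
    exact ⟨hB.2 fun c hc => T.boxed c (YoungDiagram.cells_subset_iff.2 h' hc), h, h'⟩

end Comparison

end Groth

theorem mainTheorem4 (k m : ℕ) (ω : Equiv.Perm (Fin (k + 1))) :
    Groth.stableDoubleGrothendieck m ω =
      ∑ T : Groth.HeckeTableau ω,
        ∑ mu ∈ Groth.subdiagrams T.shape,
          ∑ rho ∈ (Groth.subdiagrams mu).filter (fun rho => Groth.IsRookStrip rho mu),
            Groth.symGrothendieck T.shape rho (Groth.xv : Fin (m + 1) → Groth.PolyXY (m + 1)) *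
              Groth.symGrothendieck mu.transpose ⊥
                (Groth.yv : Fin (m + 1) → Groth.PolyXY (m + 1)) := by
  rw [Groth.stableDoubleGrothendieck_eq]
  exact Groth.unop_prod_apply_prod_apply
    (MvPolynomial.X_injective.comp Sum.inl_injective) (fun i => Groth.one_add_X_ne_zero _)
    (MvPolynomial.X_injective.comp Sum.inr_injective) (fun i => Groth.one_add_X_ne_zero _) ω
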